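/- Let $(V,c)$ be a finite metric space, $s,t\in V$ with $s\neq t$, and $E=\binom V2$. For $U\subseteq V$ let $\delta(U)\subseteq E$ be the set of edges with exactly one endpoint in $U$, and $\delta(v)=\delta(\{v\})$; write $x(F)=\sum_{e\in F}x(e)$ and $c(x)=\sum_{e\in E}c(e)x(e)$. Consider the linear program of minimizing $c(x)$ over all $x\in\mathbb R^E_{\ge 0}$ with $x(\delta(U))\ge 2$ for $\emptyset\ne U\subseteq V\setminus\{s,t\}$, $x(\delta(U))\ge 1$ for $\{s\}\subseteq U\subseteq V\setminus\{t\}$, $x(\delta(v))=2$ for $v\in V\setminus\{s,t\}$, and $x(\delta(s))=x(\delta(t))=1$. The best-of-many Christofides algorithm with lonely edge deletion works as follows. 1. Compute an optimum solution $x^*$ of the linear program. Let $\mathcal N=\{\delta(U): s\in U\subseteq V\setminus\{t\},\ x^*(\delta(U))<2\}$ be the set of narrow cuts. 2. Compute spanning trees $(V,S_1),\dots,(V,S_k)$ and $p_1,\dots,p_k\ge 0$ with $\sum_j p_j=1$ and $x^*=\sum_j p_j\chi^{S_j}$ such that for every $C\in\mathcal N$ there is an $r\in\{1,\dots,k\}$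 with $\sum_{j=1}^r p_j=2-x^*(C)$ and $|C\cap S_j|=1$ for all $j\le r$. Call $C\in\mathcal N$ lonely in $S_j$ if $|C\cap S_j|=1$ and $\sum_{i=1}^j p_i\le 2-x^*(C)$; the edge in $C\cap S_j$ is then also called lonely. Let $\mathcal L(S_j)$ be the set of cuts lonely in $S_j$, let $F_j$ arise from $S_j$ by deleting all its lonely edges, let $T_j=\{v\in V:|F_j\cap\delta(v)|\text{ odd}\}\,\triangle\,\{s,t\}$, and for $e\in E$ let $$c^j(e)=c(e)+\sum_{C\in\mathcal L(S_j),\,e\in C}2c(C\cap S_j)-\max\Bigl\{0,\max_{C\in\mathcal L(S_j),\,e\in C}2c(C\cap S_j)\Bigr\}.$$ 3. For each $j=1,\dots,k$: compute a $T_j$-join $J_j\subseteq E$ (an edge set whose set of odd-degree vertices is $T_j$) of minimum $c^j$-cost; compute a set $R_j\subseteq S_j\setminus F_j$ of minimum $c$-cost such that $(V,F_j\cup J_j\cup R_j)$ is connected; find an Eulerian $s$-$t$-walk in the multigraph with edge multiset $H_j=F_j\,\dot\cup\, J_j\,\dot\cup\, R_j\,\dot\cup\, R_j$, and shortcut it to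 an $s$-$t$-path by skipping repeated visits of vertices. 4. Return a cheapest of these $k$ paths. Let $h:[0,1]\to[0,1]$ be an integrable function such that for all $z\in[0,1]$ $$\int_z^1\max\{0,\,h(\sigma)-1+z\,h(\sigma)\}\,d\sigma+\int_0^z\bigl(h(\sigma)-1-z\,h(\sigma)\bigr)\,d\sigma\ \le\ 0 .$$ Then the algorithm computes a solution of cost at most $$\Bigl(1+\frac1{1+\int_0^1h(\sigma)\,d\sigma}\Bigr)\,c(x^*).$$ That is: the linear program has an optimum solution; every optimum solution $x^*$ has a decomposition as in step 2; and for every such $x^*$ and decomposition, steps 3 and 4 produce an output, and every possible output (whatever choices are made) is a Hamiltonian path from $s$ to $t$ whose cost is bounded as above. -/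

import Mathlib

namespace PathTSP

/-- The edge set `E` of the complete graph on `V`: the two-element subsets of `V`. -/
abbrev Edge (V : Type*) : Type _ := {e : Sym2 V // ¬ e.IsDiag}

section Basic

variable {V : Type*} [Fintype V] [DecidableEq V]

/-- The cut `δ(U)`: all edges with exactly one endpoint in `U`. -/
def cut (U : Finset V) : Finset (Edge V) :=
  Finset.univ.filter fun e => ∃ v ∈ U, ∃ w, w ∉ U ∧ e.1 = s(v, w)

/-- The graph `(V, A)` for an edge set `A`. -/
def edgeGraph (A : Finset (Edge V)) : SimpleGraph V :=
  SimpleGraph.fromEdgeSet {e | ∃ a ∈ A, a.1 = e}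

/-- `(V, A)` is a spanning tree. -/
def IsSpanningTree (A : Finset (Edge V)) : Prop := (edgeGraph A).IsTree

/-- The vertices of odd degree in `(V, A)`. -/
def oddVertices (A : Finset (Edge V)) : Finset V :=
  Finset.univ.filter fun v => Odd (A ∩ cut {v}).card

/-- `J` is a `T`-join: `T` is the set of odd-degree vertices of `(V, J)`. -/
def IsTJoin (T : Finset V) (J : Finset (Edge V)) : Prop := oddVertices J = T

/-- `x(F)`, the sum of the entries of `x` over the edge set `F`. -/
def vecSum (x : Edge V → ℝ) (F : Finset (Edge V)) : ℝ := ∑ e ∈ F, x e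

end Basic

section Metric

variable {V : Type*} [MetricSpace V]

/-- The cost `c({v,w})`, the distance of `v` and `w`. -/
noncomputable def edgeCost : Sym2 V → ℝ :=
  Sym2.lift ⟨fun v w => dist v w, fun v w => dist_comm v w⟩

/-- The cost `c(A)` of an edge set. -/
noncomputable def setCost (A : Finset (Edge V)) : ℝ := ∑ e ∈ A, edgeCost e.1

/-- The cost `c(x)` of a vector `x`. -/
noncomputable def vecCost [Fintype V] [DecidableEq V] (x : Edge V → ℝ) : ℝ :=
  ∑ e, edgeCost e.1 * x e

/-- The cost of a walk: every traversal of an edge is paid for. -/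
noncomputable def walkCost {s t : V} (w : (⊤ : SimpleGraph V).Walk s t) : ℝ :=
  (w.edges.map edgeCost).sum

end Metric

section Algorithm

variable {V : Type*} [Fintype V] [DecidableEq V]

/-- Feasible solutions of the linear programming relaxation of the `s`-`t`-path TSP. -/
structure IsFeasible (s t : V) (x : Edge V → ℝ) : Prop where
  two_le : ∀ U : Finset V, U.Nonempty → s ∉ U → t ∉ U → 2 ≤ vecSum x (cut U)
  one_le : ∀ U : Finset V, s ∈ U → t ∉ U → 1 ≤ vecSum x (cut U)
  degree_inner : ∀ v : V, v ≠ s → v ≠ t → vecSum x (cut {v}) = 2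
  degree_s : vecSum x (cut {s}) = 1
  degree_t : vecSum x (cut {t}) = 1
  nonneg : ∀ e, 0 ≤ x e

/-- Optimum solutions of the linear program. -/
def IsOptimal [MetricSpace V] (s t : V) (x : Edge V → ℝ) : Prop :=
  IsFeasible s t x ∧ ∀ y : Edge V → ℝ, IsFeasible s t y → vecCost x ≤ vecCost y

open Classical in
/-- The narrow cuts `δ(U)`, each given by its side `U` with `s ∈ U` and `t ∉ U`
(different such `U` have different cuts). -/
noncomputable def narrowCuts (s t : V) (x : Edge V → ℝ) : Finset (Finset V) :=
  Finset.univ.filter fun U => s ∈ U ∧ t ∉ U ∧ vecSum x (cut U) < 2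

/-- A convex combination `x = ∑ⱼ pⱼ χ^{Sⱼ}` of (ordered) spanning trees, such that every narrow cut
`C` is crossed exactly once by an initial segment of the trees of total weight `2 - x(C)`. -/
structure TreeDecomposition (s t : V) (x : Edge V → ℝ) where
  k : ℕ
  p : Fin k → ℝ
  S : Fin k → Finset (Edge V)
  tree : ∀ j, IsSpanningTree (S j)
  nonneg : ∀ j, 0 ≤ p j
  sum_eq_one : ∑ j, p j = 1
  eq_sum : ∀ e, x e = ∑ j, p j * (if e ∈ S j then 1 else 0)
  narrow : ∀ U ∈ narrowCuts s t x, ∃ r : Fin k,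
    ∑ i ∈ Finset.Iic r, p i = 2 - vecSum x (cut U) ∧
      ∀ j, j ≤ r → (cut U ∩ S j).card = 1

namespace TreeDecomposition

variable {s t : V} {x : Edge V → ℝ} (D : TreeDecomposition s t x) (j : Fin D.k)

open Classical in
/-- The set `𝓛(Sⱼ)` of the lonely cuts of the tree `Sⱼ`. -/
noncomputable def lonelyCuts : Finset (Finset V) :=
  (narrowCuts s t x).filter fun U =>
    (cut U ∩ D.S j).card = 1 ∧ ∑ i ∈ Finset.Iic j, D.p i ≤ 2 - vecSum x (cut U)

/-- The lonely edges of the tree `Sⱼ`. -/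
noncomputable def lonelyEdges : Finset (Edge V) :=
  (D.lonelyCuts j).biUnion fun U => cut U ∩ D.S j

/-- The forest `Fⱼ`. -/
noncomputable def forest : Finset (Edge V) := D.S j \ D.lonelyEdges j

/-- The set `Tⱼ` of vertices whose degree in `Fⱼ` has the wrong parity. -/
noncomputable def wrongParity : Finset V := symmDiff (oddVertices (D.forest j)) {s, t}

variable [MetricSpace V]

/-- The modified cost `c^j(e)`; `Finset.fold max 0` is the maximum of `0` and all the values. -/
noncomputable def modCost (e : Edge V) : ℝ :=
  edgeCost e.1
    + ∑ U ∈ (D.lonelyCuts j).filter (fun U => e ∈ cut U), 2 * setCost (cut U ∩ D.S j)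
    - Finset.fold max 0 (fun U => 2 * setCost (cut U ∩ D.S j))
        ((D.lonelyCuts j).filter (fun U => e ∈ cut U))

/-- `J` is a `Tⱼ`-join of minimum `c^j`-cost. -/
def IsMinJoin (J : Finset (Edge V)) : Prop :=
  IsTJoin (D.wrongParity j) J ∧
    ∀ J' : Finset (Edge V), IsTJoin (D.wrongParity j) J' →
      ∑ e ∈ J, D.modCost j e ≤ ∑ e ∈ J', D.modCost j e

/-- `R` is a set of lonely edges that makes `Fⱼ ∪ J ∪ R` connected. -/
def IsReconnection (J R : Finset (Edge V)) : Prop :=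
  R ⊆ D.S j \ D.forest j ∧ (edgeGraph (D.forest j ∪ J ∪ R)).Connected

/-- `R` is such a set of minimum `c`-cost. -/
def IsMinReconnection (J R : Finset (Edge V)) : Prop :=
  D.IsReconnection j J R ∧
    ∀ R' : Finset (Edge V), D.IsReconnection j J R' → setCost R ≤ setCost R'

/-- The edge multiset `Hⱼ`, the disjoint union of `Fⱼ`, `J`, `R` and `R`. -/
noncomputable def multiEdges (J R : Finset (Edge V)) : Multiset (Edge V) :=
  (D.forest j).val + J.val + R.val + R.val

end TreeDecomposition

/-- The walk `w` is Eulerian in the multigraph `(V, H)`: it uses every edge exactly as often as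
it occurs in `H`. -/
def IsEulerianIn {s t : V} (w : (⊤ : SimpleGraph V).Walk s t) (H : Multiset (Edge V)) : Prop :=
  (w.edges : Multiset (Sym2 V)) = H.map Subtype.val

/-- The `s`-`t`-path `P` results from the `s`-`t`-walk `w` by shortcutting: all vertices of `w` are
visited, in the order of `w`, but all repeated visits are skipped. -/
def IsShortcut {s t : V} (w P : (⊤ : SimpleGraph V).Walk s t) : Prop :=
  P.support.Sublist w.support ∧ P.support.Nodup ∧ ∀ v ∈ w.support, v ∈ P.support

namespace TreeDecomposition

variable {s t : V} {x : Edge V → ℝ} [MetricSpace V] (D : TreeDecomposition s t x)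

/-- `P` is a possible result of the iteration of the algorithm for the tree `Sⱼ`. -/
def IsTreeTour (j : Fin D.k) (P : (⊤ : SimpleGraph V).Walk s t) : Prop :=
  ∃ J R : Finset (Edge V), D.IsMinJoin j J ∧ D.IsMinReconnection j J R ∧
    ∃ w : (⊤ : SimpleGraph V).Walk s t, IsEulerianIn w (D.multiEdges j J R) ∧ IsShortcut w P

/-- `P` is a possible output of the best-of-many Christofides algorithm with lonely edge deletion,
working with the decomposition `D`: a cheapest one among tours computed for `S₁, …, S_k`. -/
def IsOutput (P : (⊤ : SimpleGraph V).Walk s t) : Prop :=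
  ∃ Q : Fin D.k → (⊤ : SimpleGraph V).Walk s t, (∀ j, D.IsTreeTour j (Q j)) ∧
    ∃ j, P = Q j ∧ ∀ i, walkCost (Q j) ≤ walkCost (Q i)

end TreeDecomposition

end Algorithm

end PathTSP

set_option linter.unusedSectionVars false

/-! The proof has two independent halves: the cost bound for a given decomposition, and the
existence of a decomposition. For a narrow cut `U` write `z = 2 - x(δ(U))`, its deficiency; the
narrow cuts form a chain (`IsFeasible.narrow_chain`).

Cost bound. A `Tⱼ`-join `J` crosses every cut that is lonely in `Sⱼ`. If for each edge of `J` the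
lonely edges of all lonely cuts it crosses, except a dearest one, are bought back twice, the graph
becomes connected, and the price of this together with `J` is at most `c^j(J)`
(`exists_reconnection_le`). Hence a tour costs at most `c(Fⱼ) + c^j(J)`, and as `J` is minimum, any
nonnegative vector with value at least one on all `Tⱼ`-cuts may replace it (`exists_join_le`). For
each `η` in `[0,1]` such a vector is `(1 + η)⁻¹` times the following sum (`correction`): `ηx + (1 -
η)χ^{Sⱼ}`, plus `ηz` units of the lonely edge of each lonely cut, plus `max(0, η - 1 + zη)` units of
each other narrow cut, spread over the edges by which earlier trees cross it. Since every tree meets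
a chain of cuts in distinct representatives (`sum_le_sum_of_chain`), `c^j(x)` exceeds `c(x)` only by
a controlled amount, and `walkCost_mul_le` results. Now give the tree `Sⱼ` an interval of length
`pⱼ` in `[0,1]`, put `η = h(σ)`, integrate and add up. The main terms become `(2 + ∫h) c(x)`. What
remains is a loss of the trees with `σ < z` and a gain of those with `σ > z` for each narrow cut;
the hypothesis on `h` says that the loss pays for the gain once the spreading is proportional to the
loss (`exists_isCutWeight`).

Existence. For a threshold `θ`, call the narrow cuts of deficiency at least `θ` active. The spanning
trees that cross each active cut exactly once arise as bases of a matroid, represented over the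
field with two elements by `levelVec`. If the thresholds are weighted so that those up to a
deficiency `y` weigh `y`, then writing `x` as an average of such trees and sorting them by threshold
yields the decomposition. The heart is the inequality `x(A) ≤` averaged rank of `A`
(`LevelWeights.vecSum_le_rank`). In a counterexample with fewest cuts and maximal `A`, uncrossing
`A` with the complete graph on a level (`Violator.no_gain`) forces each cut to own an edge of `A`
crossing it alone, and forces all edges of `A` in the cut into one component (`Violator.all_good`).
Then the rank at each threshold is at least the graphic rank of `A`, hence at least `x(A)`. The
greedy algorithm and a separating hyperplane turn the inequality into a convex combination. -/

namespace PathTSP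

/-! ### Parities of cuts, odd vertices and connectedness -/

section Parity

variable {V : Type*} [Fintype V] [DecidableEq V]

/-- The edge joining two distinct vertices. -/
def mkEdge (u v : V) (h : u ≠ v) : Edge V := ⟨s(u, v), by simpa using h⟩

theorem Edge.exists_rep (e : Edge V) : ∃ u v, ∃ h : u ≠ v, e = mkEdge u v h := by
  obtain ⟨e, he⟩ := e
  induction e using Sym2.ind with
  | _ u v => exact ⟨u, v, by simpa using he, rfl⟩

theorem mkEdge_comm (u v : V) (h : u ≠ v) : mkEdge u v h = mkEdge v u h.symm := by
  apply Subtype.ext; exact Sym2.eq_swap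

theorem mkEdge_mem_cut {u v : V} {h : u ≠ v} {U : Finset V} :
    mkEdge u v h ∈ cut U ↔ ((u ∈ U ∧ v ∉ U) ∨ (v ∈ U ∧ u ∉ U)) := by
  simp only [cut, Finset.mem_filter, Finset.mem_univ, true_and, mkEdge]
  constructor
  · rintro ⟨a, ha, b, hb, hab⟩
    rcases Sym2.eq_iff.1 hab with ⟨rfl, rfl⟩ | ⟨rfl, rfl⟩
    · exact Or.inl ⟨ha, hb⟩
    · exact Or.inr ⟨ha, hb⟩
  · rintro (⟨h1, h2⟩ | ⟨h1, h2⟩)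
    · exact ⟨u, h1, v, h2, rfl⟩
    · exact ⟨v, h1, u, h2, Sym2.eq_swap⟩

theorem cut_compl (U : Finset V) : cut Uᶜ = cut U := by
  ext e
  obtain ⟨u, v, h, rfl⟩ := e.exists_rep
  simp only [mkEdge_mem_cut, Finset.mem_compl]
  tauto

/-- The parity of the number of edges of `A` in the cut `δ(U)`. -/
def cutParity (A : Finset (Edge V)) (U : Finset V) : ZMod 2 := ((A ∩ cut U).card : ZMod 2)

theorem cutParity_eq_sum (A : Finset (Edge V)) (U : Finset V) :
    cutParity A U = ∑ e ∈ A, if e ∈ cut U then (1 : ZMod 2) else 0 := by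
  rw [cutParity, Finset.sum_ite_mem, Finset.sum_const, nsmul_eq_mul, mul_one]

/-- An edge inside `U` is counted at both of its ends and cancels modulo 2. This makes cut parities
additive over vertices. -/
theorem indicator_cut (e : Edge V) (U : Finset V) :
    (if e ∈ cut U then (1 : ZMod 2) else 0) = ∑ v ∈ U, if e ∈ cut {v} then (1 : ZMod 2) else 0 := by
  obtain ⟨u, v, h, rfl⟩ := e.exists_rep
  have key : ∀ w, (if mkEdge u v h ∈ cut {w} then (1 : ZMod 2) else 0)
      = (if w = u then 1 else 0) + if w = v then 1 else 0 := by
    intro w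
    simp only [mkEdge_mem_cut, Finset.mem_singleton]
    by_cases h1 : w = u
    · subst h1; simp [h, h.symm]
    · by_cases h2 : w = v
      · subst h2; simp [h, h.symm]
      · simp [h1, h2, Ne.symm h1, Ne.symm h2]
  simp only [key, Finset.sum_add_distrib, Finset.sum_ite_eq']
  simp only [mkEdge_mem_cut]
  by_cases h1 : u ∈ U <;> by_cases h2 : v ∈ U <;> simp [h1, h2]
  decide

theorem cutParity_eq_sum_vertices (A : Finset (Edge V)) (U : Finset V) :
    cutParity A U = ∑ v ∈ U, cutParity A {v} := by
  simp only [cutParity_eq_sum]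
  rw [Finset.sum_comm]
  exact Finset.sum_congr rfl fun e _ => indicator_cut e U

theorem sum_symmDiff_zmod_two {α : Type*} [DecidableEq α] (A B : Finset α) (f : α → ZMod 2) :
    ∑ e ∈ symmDiff A B, f e = ∑ e ∈ A, f e + ∑ e ∈ B, f e := by
  have h1 : ∑ e ∈ A, f e = ∑ e ∈ A \ B, f e + ∑ e ∈ A ∩ B, f e := by
    rw [← Finset.sum_union (Finset.disjoint_sdiff_inter A B), Finset.sdiff_union_inter]
  have h2 : ∑ e ∈ B, f e = ∑ e ∈ B \ A, f e + ∑ e ∈ A ∩ B, f e := by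
    rw [Finset.inter_comm, ← Finset.sum_union (Finset.disjoint_sdiff_inter B A),
      Finset.sdiff_union_inter]
  rw [symmDiff_def, Finset.sup_eq_union, Finset.sum_union, h1, h2]
  · have : (∑ e ∈ A ∩ B, f e) + ∑ e ∈ A ∩ B, f e = 0 := CharTwo.add_self_eq_zero _
    linear_combination -this
  · exact disjoint_sdiff_sdiff

theorem cutParity_symmDiff (A B : Finset (Edge V)) (U : Finset V) :
    cutParity (symmDiff A B) U = cutParity A U + cutParity B U := by
  simp only [cutParity_eq_sum, sum_symmDiff_zmod_two]

theorem zmod_two_cases (a : ZMod 2) : a = 0 ∨ a = 1 := by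
  revert a; decide

theorem mem_oddVertices {A : Finset (Edge V)} {v : V} :
    v ∈ oddVertices A ↔ cutParity A {v} = 1 := by
  simp [oddVertices, cutParity, ZMod.natCast_eq_one_iff_odd]

theorem odd_inter_cut_iff {A : Finset (Edge V)} {U : Finset V} :
    Odd (A ∩ cut U).card ↔ cutParity A U = 1 := by
  simp [cutParity, ZMod.natCast_eq_one_iff_odd]

/-- A cut contains an odd number of edges of `A` if and only if its side contains an odd number
of vertices of odd degree. -/
theorem odd_inter_cut_iff_odd_inter (A : Finset (Edge V)) (U : Finset V) :
    Odd (A ∩ cut U).card ↔ Odd (U ∩ oddVertices A).card := by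
  rw [odd_inter_cut_iff, cutParity_eq_sum_vertices, ← ZMod.natCast_eq_one_iff_odd]
  have : ∑ v ∈ U, cutParity A {v} = ((U ∩ oddVertices A).card : ZMod 2) := by
    rw [← Finset.filter_mem_eq_inter, Finset.card_filter, Nat.cast_sum]
    refine Finset.sum_congr rfl fun v _ => ?_
    rcases zmod_two_cases (cutParity A {v}) with h | h <;> simp [mem_oddVertices, h]
  rw [this]

theorem oddVertices_symmDiff (A B : Finset (Edge V)) :
    oddVertices (symmDiff A B) = symmDiff (oddVertices A) (oddVertices B) := by
  ext v
  rw [Finset.mem_symmDiff, mem_oddVertices, mem_oddVertices, mem_oddVertices, cutParity_symmDiff]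
  rcases zmod_two_cases (cutParity A {v}) with h | h <;>
    rcases zmod_two_cases (cutParity B {v}) with h' | h' <;> simp [h, h']

theorem oddVertices_singleton (u v : V) (h : u ≠ v) :
    oddVertices {mkEdge u v h} = symmDiff {u} {v} := by
  ext w
  rw [mem_oddVertices, cutParity_eq_sum, Finset.sum_singleton, Finset.mem_symmDiff]
  simp only [mkEdge_mem_cut, Finset.mem_singleton]
  by_cases h1 : w = u
  · subst h1; simp [h, h.symm]
  · by_cases h2 : w = v
    · subst h2; simp [h, h.symm]
    · simp [h1, h2, Ne.symm h1, Ne.symm h2]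

theorem oddVertices_empty : oddVertices (∅ : Finset (Edge V)) = ∅ := by
  ext v; simp [oddVertices]

/-- Adjacency in the edge set `A`. -/
def EdgeRel (A : Finset (Edge V)) (u v : V) : Prop := ∃ h : u ≠ v, mkEdge u v h ∈ A

theorem EdgeRel.symm {A : Finset (Edge V)} {u v : V} (h : EdgeRel A u v) : EdgeRel A v u := by
  obtain ⟨h1, h2⟩ := h
  exact ⟨h1.symm, by rwa [mkEdge_comm]⟩

theorem EdgeRel.mono {A B : Finset (Edge V)} (hAB : A ⊆ B) {u v : V} (h : EdgeRel A u v) :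
    EdgeRel B u v := ⟨h.1, hAB h.2⟩

/-- Connectedness of two vertices by the edge set `A`. -/
def Joined (A : Finset (Edge V)) (u v : V) : Prop := Relation.ReflTransGen (EdgeRel A) u v

theorem Joined.refl (A : Finset (Edge V)) (u : V) : Joined A u u := Relation.ReflTransGen.refl

theorem Joined.trans {A : Finset (Edge V)} {u v w : V} (h : Joined A u v) (h' : Joined A v w) :
    Joined A u w := Relation.ReflTransGen.trans h h'

theorem Joined.symm {A : Finset (Edge V)} {u v : V} (h : Joined A u v) : Joined A v u :=
  Std.Symm.symm (self := @Relation.ReflTransGen.stdSymm V (EdgeRel A)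
    ⟨fun _ _ h => EdgeRel.symm h⟩) _ _ h

theorem Joined.mono {A B : Finset (Edge V)} (hAB : A ⊆ B) {u v : V} (h : Joined A u v) :
    Joined B u v := Relation.ReflTransGen.mono (fun _ _ h => EdgeRel.mono hAB h) _ _ h

theorem Joined.of_mem {A : Finset (Edge V)} {u v : V} {h : u ≠ v} (hA : mkEdge u v h ∈ A) :
    Joined A u v := Relation.ReflTransGen.single ⟨h, hA⟩

theorem edgeGraph_adj {A : Finset (Edge V)} {u v : V} : (edgeGraph A).Adj u v ↔ EdgeRel A u v := by
  simp only [edgeGraph, SimpleGraph.fromEdgeSet_adj, Set.mem_ofPred_eq, EdgeRel]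
  constructor
  · rintro ⟨⟨a, ha, hae⟩, h⟩
    refine ⟨h, ?_⟩
    have : mkEdge u v h = a := Subtype.ext hae.symm
    rwa [this]
  · rintro ⟨h, ha⟩
    exact ⟨⟨_, ha, rfl⟩, h⟩

theorem edgeGraph_reachable {A : Finset (Edge V)} {u v : V} :
    (edgeGraph A).Reachable u v ↔ Joined A u v := by
  rw [SimpleGraph.reachable_iff_reflTransGen, Joined]
  have : (edgeGraph A).Adj = EdgeRel A := by
    ext a b; exact edgeGraph_adj
  rw [this]

theorem edgeGraph_connected [Nonempty V] {A : Finset (Edge V)} :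
    (edgeGraph A).Connected ↔ ∀ u v, Joined A u v := by
  rw [SimpleGraph.connected_iff]
  simp only [SimpleGraph.Preconnected, edgeGraph_reachable]
  exact ⟨fun h => h.1, fun h => ⟨h, inferInstance⟩⟩

/-- Joined vertices are the ends of a join inside the edge set. -/
theorem Joined.exists_join {A : Finset (Edge V)} {u v : V} (h : Joined A u v) :
    ∃ P ⊆ A, oddVertices P = symmDiff {u} {v} := by
  induction h with
  | refl => exact ⟨∅, by simp, by simp [oddVertices_empty]⟩
  | tail _ hbc ih =>
    obtain ⟨P, hP, hP'⟩ := ih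
    obtain ⟨hne, hm⟩ := hbc
    -- The walk may traverse an edge repeatedly; the symmetric difference cancels repetitions, which
    -- insertion would not.
    refine ⟨symmDiff P {mkEdge _ _ hne}, ?_, ?_⟩
    · intro e he
      rcases Finset.mem_symmDiff.1 he with h | h
      · exact hP h.1
      · rw [Finset.mem_singleton.1 h.1]; exact hm
    · rw [oddVertices_symmDiff, hP', oddVertices_singleton, symmDiff_assoc,
        symmDiff_symmDiff_cancel_left]

end Parity

end PathTSP

namespace PathTSP

/-! ### Minimum joins and the dominant of the join polytope -/

section TJoins

variable {V : Type*} [Fintype V] [DecidableEq V]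

theorem vecSum_symmDiff (c : Edge V → ℝ) (A B : Finset (Edge V)) :
    vecSum c (symmDiff A B) = vecSum c A + vecSum c B - 2 * vecSum c (A ∩ B) := by
  simp only [vecSum]
  have h1 : ∑ e ∈ A, c e = ∑ e ∈ A \ B, c e + ∑ e ∈ A ∩ B, c e := by
    rw [← Finset.sum_union (Finset.disjoint_sdiff_inter A B), Finset.sdiff_union_inter]
  have h2 : ∑ e ∈ B, c e = ∑ e ∈ B \ A, c e + ∑ e ∈ A ∩ B, c e := by
    rw [Finset.inter_comm, ← Finset.sum_union (Finset.disjoint_sdiff_inter B A),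
      Finset.sdiff_union_inter]
  rw [symmDiff_def, Finset.sup_eq_union, Finset.sum_union disjoint_sdiff_sdiff, h1, h2]
  ring

theorem vecSum_symmDiff_of_zero (c : Edge V → ℝ) (A Z : Finset (Edge V)) (hZ : ∀ e ∈ Z, c e = 0) :
    vecSum c (symmDiff A Z) = vecSum c A := by
  have h1 : vecSum c Z = 0 := Finset.sum_eq_zero hZ
  have h2 : vecSum c (A ∩ Z) = 0 :=
    Finset.sum_eq_zero fun e he => hZ e (Finset.mem_inter.1 he).2
  rw [vecSum_symmDiff, h1, h2]; ring

theorem vecSum_symmDiff_singleton_of_mem (c : Edge V → ℝ) {A : Finset (Edge V)} {e : Edge V}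
    (he : e ∈ A) : vecSum c (symmDiff A {e}) = vecSum c A - c e := by
  rw [vecSum_symmDiff, Finset.inter_singleton_of_mem he]
  simp only [vecSum, Finset.sum_singleton]; ring

theorem symmDiff_exchange (T a b u v : Finset V) :
    symmDiff (symmDiff (symmDiff T (symmDiff a b)) (symmDiff u v)) (symmDiff b u)
      = symmDiff T (symmDiff a v) := by
  ext w
  simp only [Finset.mem_symmDiff]
  grind

theorem symmDiff_telescope (a b w u : Finset V) :
    symmDiff (symmDiff a b) (symmDiff (symmDiff a w) (symmDiff w u)) = symmDiff b u := by
  ext w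
  simp only [Finset.mem_symmDiff]
  grind

theorem exists_min_join (c : Edge V → ℝ) {T : Finset V} (hT : ∃ J, IsTJoin T J) :
    ∃ J, IsTJoin T J ∧ ∀ J', IsTJoin T J' → vecSum c J ≤ vecSum c J' := by
  obtain ⟨J, hJ, hm⟩ := Set.exists_min_image {J : Finset (Edge V) | IsTJoin T J} (vecSum c)
    (Set.toFinite _) hT
  exact ⟨J, hJ, hm⟩

theorem exists_mem_cut_of_parity {D : Finset (Edge V)} {K : Finset V} (h : cutParity D K = 1) :
    ∃ w ∈ K, ∃ u, u ∉ K ∧ ∃ hne : w ≠ u, mkEdge w u hne ∈ D := by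
  have : (D ∩ cut K).Nonempty := by
    rw [Finset.nonempty_iff_ne_empty]
    rintro h0
    simp [cutParity, h0] at h
  obtain ⟨e, he⟩ := this
  obtain ⟨u, v, huv, rfl⟩ := e.exists_rep
  obtain ⟨he1, he2⟩ := Finset.mem_inter.1 he
  rcases mkEdge_mem_cut.1 he2 with ⟨h1, h2⟩ | ⟨h1, h2⟩
  · exact ⟨u, h1, v, h2, huv, he1⟩
  · exact ⟨v, h1, u, h2, huv.symm, by rwa [mkEdge_comm]⟩

theorem cutParity_of_join {D : Finset (Edge V)} {a b : V} (hD : oddVertices D = symmDiff {a} {b})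
    {K : Finset V} (ha : a ∈ K) (hb : b ∉ K) : cutParity D K = 1 := by
  rw [← odd_inter_cut_iff, odd_inter_cut_iff_odd_inter, hD]
  have : K ∩ symmDiff {a} {b} = {a} := by
    ext w
    simp only [Finset.mem_inter, Finset.mem_symmDiff, Finset.mem_singleton]
    constructor
    · rintro ⟨h1, h2 | h2⟩
      · exact h2.1
      · exact absurd (h2.1 ▸ h1) hb
    · rintro rfl
      exact ⟨ha, Or.inl ⟨rfl, fun h => hb (h ▸ ha)⟩⟩
  rw [this]; simp

open Classical in
/-- If all `T`-joins have positive cost, then there is a `T`-cut of positive edges which every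
minimum `T`-join crosses exactly once. -/
theorem exists_tight_cut (c : Edge V → ℝ) (hc : ∀ e, 0 ≤ c e) {T : Finset V}
    (hT : ∃ J, IsTJoin T J) (hpos : ∀ J, IsTJoin T J → 0 < vecSum c J) :
    ∃ X : Finset V, Odd (X ∩ T).card ∧ (∀ e ∈ cut X, 0 < c e) ∧
      ∀ F, IsTJoin T F → (∀ J, IsTJoin T J → vecSum c F ≤ vecSum c J) → (F ∩ cut X).card = 1 := by
  obtain ⟨F₀, hF₀, hF₀min⟩ := exists_min_join c hT
  obtain ⟨e₀, he₀, hce₀⟩ : ∃ e ∈ F₀, 0 < c e := by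
    by_contra! hcon
    exact absurd (hpos F₀ hF₀) (not_lt.2 (Finset.sum_nonpos hcon))
  obtain ⟨u₀, v₀, huv₀, rfl⟩ := e₀.exists_rep
  have hF₁ : IsTJoin (symmDiff T (symmDiff {u₀} {v₀})) (symmDiff F₀ {mkEdge u₀ v₀ huv₀}) := by
    rw [IsTJoin, oddVertices_symmDiff, oddVertices_singleton, hF₀]
  -- The minimum is over all pairs `a`, `b` simultaneously. Removing a positive edge from a minimum
  -- `T`-join gives a competitor, so `B` is strictly cheaper than every `T`-join.
  obtain ⟨⟨a, b, B⟩, hB, hBmin'⟩ := Set.exists_min_image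
    {q : V × V × Finset (Edge V) | IsTJoin (symmDiff T (symmDiff {q.1} {q.2.1})) q.2.2}
    (fun q => vecSum c q.2.2) (Set.toFinite _) ⟨(u₀, v₀, _), hF₁⟩
  have hBmin : ∀ a' b' B', IsTJoin (symmDiff T (symmDiff {a'} {b'})) B' →
      vecSum c B ≤ vecSum c B' := fun a' b' B' h => hBmin' (a', b', B') h
  replace hB : oddVertices B = symmDiff T (symmDiff {a} {b}) := hB
  have hlt : ∀ J, IsTJoin T J → vecSum c B < vecSum c J := by
    intro J hJ
    have h1 := hBmin _ _ _ hF₁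
    rw [vecSum_symmDiff_singleton_of_mem c he₀] at h1
    have h2 := hF₀min J hJ
    linarith
  set Z₀ : Finset (Edge V) := Finset.univ.filter fun e => c e = 0 with hZ₀
  -- The terminal `b` can be moved to any vertex of `X` free of charge.
  set X : Finset V := Finset.univ.filter fun v => Joined Z₀ b v with hX
  have hZX : ∀ e ∈ Z₀, e ∉ cut X := by
    intro e he hcut
    obtain ⟨u, v, huv, rfl⟩ := e.exists_rep
    simp only [mkEdge_mem_cut, hX, Finset.mem_filter, Finset.mem_univ, true_and] at hcut
    rcases hcut with ⟨h1, h2⟩ | ⟨h1, h2⟩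
    · exact h2 (h1.trans (Joined.of_mem he))
    · exact h2 (h1.trans (Joined.of_mem he).symm)
  have hposX : ∀ e ∈ cut X, 0 < c e := by
    intro e he
    refine lt_of_le_of_ne (hc e) fun h => hZX e ?_ he
    simp [hZ₀, h.symm]
  have hZ0 : ∀ Z ⊆ Z₀, ∀ e ∈ Z, c e = 0 := fun Z hZ e he => by
    have := hZ he; simpa [hZ₀] using this
  have hzero : ∀ u ∈ X, ∃ Z ⊆ Z₀, oddVertices Z = symmDiff {b} {u} := by
    intro u hu
    exact Joined.exists_join (by simpa [hX] using hu)
  have hbX : b ∈ X := by simp [hX, Joined.refl]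
  -- Suppose `B'` used an edge `uv` with `u` in `X`. Deleting it and moving the terminal `b` to `u`
  -- for free would leave a strictly cheaper join for the pair `a`, `v`.
  have hnocut : ∀ B', oddVertices B' = symmDiff T (symmDiff {a} {b}) → vecSum c B' ≤ vecSum c B →
      ∀ e ∈ B', e ∉ cut X := by
    intro B' hB' hle e he hcut
    obtain ⟨u, v, huv, rfl, huX⟩ : ∃ u v, ∃ h : u ≠ v, e = mkEdge u v h ∧ u ∈ X := by
      obtain ⟨u, v, huv, rfl⟩ := e.exists_rep
      rcases mkEdge_mem_cut.1 hcut with ⟨h1, h2⟩ | ⟨h1, h2⟩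
      · exact ⟨u, v, huv, rfl, h1⟩
      · exact ⟨v, u, huv.symm, mkEdge_comm _ _ _, h1⟩
    obtain ⟨Z, hZ, hZ'⟩ := hzero u huX
    have h1 := hBmin a v (symmDiff (symmDiff B' {mkEdge u v huv}) Z) (by
      rw [IsTJoin, oddVertices_symmDiff, oddVertices_symmDiff, hB', oddVertices_singleton, hZ']
      exact symmDiff_exchange _ _ _ _ _)
    rw [vecSum_symmDiff_of_zero c _ _ (hZ0 Z hZ), vecSum_symmDiff_singleton_of_mem c he] at h1
    have := hposX _ hcut
    linarith
  -- A free path from `b` to `a` would turn `B` into a `T`-join of the same cost.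
  have haX : a ∉ X := by
    intro ha
    obtain ⟨Z, hZ, hZ'⟩ := hzero a ha
    have h1 := hlt (symmDiff B Z) (by
      rw [IsTJoin, oddVertices_symmDiff, hB, hZ']
      rw [symmDiff_comm ({b} : Finset V) {a}, symmDiff_symmDiff_cancel_right])
    rw [vecSum_symmDiff_of_zero c _ _ (hZ0 Z hZ)] at h1
    exact lt_irrefl _ h1
  have hBX : B ∩ cut X = ∅ := by
    rw [Finset.eq_empty_iff_forall_notMem]
    intro e he
    exact hnocut B hB le_rfl e (Finset.mem_inter.1 he).1 (Finset.mem_inter.1 he).2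
  have hDodd : ∀ F, IsTJoin T F → oddVertices (symmDiff F B) = symmDiff {a} {b} := by
    intro F hF
    rw [oddVertices_symmDiff, hF, hB, symmDiff_symmDiff_cancel_left]
  have hFodd : ∀ F, IsTJoin T F → cutParity F X = 1 := by
    intro F hF
    have h1 : cutParity (symmDiff F B) X = 1 :=
      cutParity_of_join ((hDodd F hF).trans (symmDiff_comm _ _)) hbX haX
    rw [cutParity_symmDiff] at h1
    have h2 : cutParity B X = 0 := by simp [cutParity, hBX]
    rwa [h2, add_zero] at h1
  refine ⟨X, ?_, hposX, ?_⟩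
  · have := hFodd F₀ hF₀
    rwa [← odd_inter_cut_iff, odd_inter_cut_iff_odd_inter, hF₀] at this
  intro F hF hFmin
  set D := symmDiff F B with hD
  have hDo : oddVertices D = symmDiff {a} {b} := hDodd F hF
  -- Follow `D` from `a` until it first enters `X`: all edges before the last one, `e`, avoid `X`
  -- altogether.
  set D' : Finset (Edge V) := D.filter fun e => ∀ v ∈ X, v ∉ e.1 with hD'
  set K : Finset V := Finset.univ.filter fun v => Joined D' a v with hK
  have hKX : ∀ v ∈ K, v ∉ X := by
    intro v hv
    have hj : Joined D' a v := by simpa [hK] using hv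
    clear hv
    induction hj with
    | refl => exact haX
    | tail _ hbc _ =>
      obtain ⟨hne, hm⟩ := hbc
      intro hX'
      exact (Finset.mem_filter.1 hm).2 _ hX' (by simp [mkEdge])
  have haK : a ∈ K := by simp [hK, Joined.refl]
  have hbK : b ∉ K := fun h => hKX b h hbX
  obtain ⟨w, hw, u, hu, hne, hmem⟩ := exists_mem_cut_of_parity (cutParity_of_join hDo haK hbK)
  have hwj : Joined D' a w := by simpa [hK] using hw
  have huX : u ∈ X := by
    by_contra huX
    apply hu
    simp only [hK, Finset.mem_filter, Finset.mem_univ, true_and]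
    refine hwj.trans (Joined.of_mem (h := hne) (Finset.mem_filter.2 ⟨hmem, ?_⟩))
    intro v hv hve
    simp only [mkEdge, Sym2.mem_iff] at hve
    rcases hve with rfl | rfl
    · exact hKX _ hw hv
    · exact huX hv
  obtain ⟨P₀, hP₀, hP₀'⟩ := hwj.exists_join
  set e := mkEdge w u hne with he
  set P := symmDiff P₀ {e} with hP
  have hPD : P ⊆ D := by
    intro f hf
    rcases Finset.mem_symmDiff.1 hf with h | h
    · exact (Finset.mem_filter.1 (hP₀ h.1)).1
    · rw [Finset.mem_singleton.1 h.1]; exact hmem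
  have hPcut : P ∩ cut X ⊆ {e} := by
    intro f hf
    obtain ⟨h1, h2⟩ := Finset.mem_inter.1 hf
    rcases Finset.mem_symmDiff.1 h1 with h | h
    · exfalso
      have h3 := (Finset.mem_filter.1 (hP₀ h.1)).2
      obtain ⟨p, q, hpq, rfl⟩ := f.exists_rep
      rcases mkEdge_mem_cut.1 h2 with h4 | h4
      · exact h3 p h4.1 (by simp [mkEdge])
      · exact h3 q h4.1 (by simp [mkEdge])
    · exact h.1
  -- Closed up by a free path from `b` to `u`, the remainder `C` of `D` preserves all degree
  -- parities. Exchanging along it in the optimal `F` gives `c(F ∩ C) ≤ c(B ∩ C)`, so exchanging in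
  -- `B` does not raise the cost and the result avoids `δ(X)`. Hence so does `C`, and only `e` is
  -- left for `F`.
  set C := symmDiff D P with hC
  have hCo : oddVertices C = symmDiff {b} {u} := by
    have hPo : oddVertices P = symmDiff (symmDiff {a} {w}) (symmDiff {w} {u}) := by
      rw [hP, oddVertices_symmDiff, hP₀', he, oddVertices_singleton]
    have h0 := oddVertices_symmDiff D P
    rw [hDo, hPo] at h0
    refine h0.trans ?_
    exact symmDiff_telescope _ _ _ _
  have hCD : C ⊆ D := by
    intro f hf
    rcases Finset.mem_symmDiff.1 hf with h | h
    · exact h.1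
    · exact hPD h.1
  obtain ⟨Z, hZ, hZo⟩ := hzero u huX
  have h1 := hFmin (symmDiff (symmDiff F C) Z) (by
    rw [IsTJoin, oddVertices_symmDiff, oddVertices_symmDiff, hF, hCo, hZo, symmDiff_symmDiff_cancel_right])
  rw [vecSum_symmDiff_of_zero c _ _ (hZ0 Z hZ), vecSum_symmDiff] at h1
  have hCsplit : vecSum c C = vecSum c (F ∩ C) + vecSum c (B ∩ C) := by
    simp only [vecSum]
    rw [← Finset.sum_union]
    · congr 1
      ext f
      have h2 : f ∈ C → _ := fun h => Finset.mem_symmDiff.1 (hCD h)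
      rw [Finset.mem_union, Finset.mem_inter, Finset.mem_inter]
      constructor
      · intro h3
        rcases h2 h3 with h4 | h4
        · exact Or.inl ⟨h4.1, h3⟩
        · exact Or.inr ⟨h4.1, h3⟩
      · rintro (h3 | h3)
        exacts [h3.2, h3.2]
    · rw [Finset.disjoint_left]
      intro f hf hf'
      rcases Finset.mem_symmDiff.1 (hCD (Finset.mem_inter.1 hf).2) with h2 | h2
      · exact h2.2 (Finset.mem_inter.1 hf').1
      · exact h2.2 (Finset.mem_inter.1 hf).1
  have hBZ : ∀ f ∈ symmDiff (symmDiff B C) Z, f ∉ cut X := by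
    refine hnocut _ ?_ ?_
    · rw [oddVertices_symmDiff, oddVertices_symmDiff, hB, hCo, hZo, symmDiff_symmDiff_cancel_right]
    · rw [vecSum_symmDiff_of_zero c _ _ (hZ0 Z hZ), vecSum_symmDiff]
      linarith
  have hCcut : ∀ f ∈ C, f ∉ cut X := by
    intro f hf hcut
    refine hBZ f ?_ hcut
    have hfB : f ∉ B := fun h => hnocut B hB le_rfl f h hcut
    have hfZ : f ∉ Z := fun h => hZX f (hZ h) hcut
    exact Finset.mem_symmDiff.2 (Or.inl ⟨Finset.mem_symmDiff.2 (Or.inr ⟨hf, hfB⟩), hfZ⟩)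
  have hsub : F ∩ cut X ⊆ {e} := by
    intro f hf
    obtain ⟨h2, h3⟩ := Finset.mem_inter.1 hf
    apply hPcut
    refine Finset.mem_inter.2 ⟨?_, h3⟩
    have hfB : f ∉ B := fun h => hnocut B hB le_rfl f h h3
    have hfD : f ∈ D := Finset.mem_symmDiff.2 (Or.inl ⟨h2, hfB⟩)
    by_contra hfP
    exact hCcut f (Finset.mem_symmDiff.2 (Or.inl ⟨hfD, hfP⟩)) h3
  have hle : (F ∩ cut X).card ≤ 1 := by simpa using Finset.card_le_card hsub
  have hodd := odd_inter_cut_iff.2 (hFodd F hF)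
  have := hodd.pos
  omega

/-- The dominant of the `T`-join polytope: a nonnegative vector that has value at least one on all
`T`-cuts costs at least as much as some `T`-join. -/
theorem exists_join_le (c y : Edge V → ℝ) (hc : ∀ e, 0 ≤ c e) (hy : ∀ e, 0 ≤ y e) {T : Finset V}
    (hT : ∃ J, IsTJoin T J) (hcut : ∀ X : Finset V, Odd (X ∩ T).card → 1 ≤ vecSum y (cut X)) :
    ∃ J, IsTJoin T J ∧ vecSum c J ≤ ∑ e, c e * y e := by
  obtain ⟨J₀, hJ₀, hJ₀min⟩ := exists_min_join c hT
  refine ⟨J₀, hJ₀, ?_⟩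
  -- A substitute for linear programming duality: costs `d ≤ c` such that passing from `c` to `d`
  -- lowers the minimum join cost by at most the drop of `c·y`. Take one with least total; if its
  -- joins still had positive cost, a tight cut would allow lowering `d` further.
  set A : Set (Edge V → ℝ) := {d | (∀ e, d e ∈ Set.Icc 0 (c e)) ∧ ∀ J, IsTJoin T J →
    vecSum c J₀ - vecSum d J ≤ ∑ e, c e * y e - ∑ e, d e * y e} with hA
  have hAcomp : IsCompact A := by
    have hbox : IsCompact (Set.univ.pi fun e : Edge V => Set.Icc 0 (c e)) :=
      isCompact_univ_pi fun e => isCompact_Icc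
    refine hbox.of_isClosed_subset ?_ ?_
    · have : A = (Set.univ.pi fun e : Edge V => Set.Icc 0 (c e)) ∩
          ⋂ J, ⋂ _ : IsTJoin T J, {d : Edge V → ℝ | vecSum c J₀ - vecSum d J ≤
            ∑ e, c e * y e - ∑ e, d e * y e} := by
        ext d
        simp only [hA, Set.mem_ofPred_eq, Set.mem_inter_iff, Set.mem_iInter, Set.mem_pi,
          Set.mem_univ, true_imp_iff]
      rw [this]
      refine hbox.isClosed.inter (isClosed_iInter fun J => isClosed_iInter fun _ => ?_)
      refine isClosed_le ?_ ?_
      · simp only [vecSum]; fun_prop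
      · fun_prop
    · exact fun d hd e _ => hd.1 e
  have hcA : c ∈ A := ⟨fun e => ⟨hc e, le_rfl⟩, fun J hJ => by
    have := hJ₀min J hJ; linarith⟩
  obtain ⟨d, hd, hdmin⟩ := hAcomp.exists_isMinOn ⟨c, hcA⟩
    (f := fun d : Edge V → ℝ => ∑ e, d e) (by fun_prop)
  obtain ⟨J₁, hJ₁, hJ₁min⟩ := exists_min_join d hT
  have hd0 : ∀ e, 0 ≤ d e := fun e => (hd.1 e).1
  have hdy : 0 ≤ ∑ e, d e * y e := Finset.sum_nonneg fun e _ => mul_nonneg (hd0 e) (hy e)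
  by_cases hzero : vecSum d J₁ ≤ 0
  · have := hd.2 J₁ hJ₁
    linarith
  exfalso
  push Not at hzero
  obtain ⟨X, hXodd, hXpos, hX⟩ := exists_tight_cut d hd0 hT
    fun J hJ => hzero.trans_le (hJ₁min J hJ)
  -- a bound on the decrement
  obtain ⟨ε, hε, hεe, hεJ⟩ : ∃ ε : ℝ, 0 < ε ∧ (∀ e ∈ cut X, ε ≤ d e) ∧
      ∀ J, IsTJoin T J → vecSum d J₁ < vecSum d J →
        ε * (J ∩ cut X).card ≤ vecSum d J - vecSum d J₁ := by
    have h1 : ∀ᶠ ε : ℝ in nhdsWithin 0 (Set.Ioi 0), ∀ e, e ∈ cut X → ε ≤ d e := by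
      rw [Filter.eventually_all]
      intro e
      by_cases he : e ∈ cut X
      · filter_upwards [Ioo_mem_nhdsGT (hXpos e he)] with ε hε _ using hε.2.le
      · exact Filter.Eventually.of_forall fun ε h => absurd h he
    have h2 : ∀ᶠ ε : ℝ in nhdsWithin 0 (Set.Ioi 0), ∀ J, IsTJoin T J →
        vecSum d J₁ < vecSum d J → ε * (J ∩ cut X).card ≤ vecSum d J - vecSum d J₁ := by
      rw [Filter.eventually_all]
      intro J
      by_cases hJ : vecSum d J₁ < vecSum d J
      · have ht : Filter.Tendsto (fun ε : ℝ => ε * (J ∩ cut X).card) (nhdsWithin 0 (Set.Ioi 0))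
            (nhds (0 * (J ∩ cut X).card)) :=
          (Filter.Tendsto.mul_const _ Filter.tendsto_id).mono_left nhdsWithin_le_nhds
        rw [zero_mul] at ht
        filter_upwards [ht.eventually (eventually_lt_nhds (sub_pos.2 hJ))] with ε hε _ _ using hε.le
      · exact Filter.Eventually.of_forall fun ε _ h => absurd h hJ
    have h3 : ∀ᶠ ε : ℝ in nhdsWithin 0 (Set.Ioi 0), 0 < ε :=
      eventually_mem_nhdsWithin
    obtain ⟨ε, h⟩ := (h3.and (h1.and h2)).exists
    exact ⟨ε, h.1, h.2.1, h.2.2⟩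
  -- Each `d`-minimum join loses exactly `ε`, while `d·y` loses at least `ε` because `y(δ(X)) ≥ 1`.
  -- By the choice of `ε` no other join drops below the old minimum.
  set d' : Edge V → ℝ := fun e => d e - if e ∈ cut X then ε else 0 with hd'
  have hsumJ : ∀ J, vecSum d' J = vecSum d J - ε * (J ∩ cut X).card := by
    intro J
    simp only [vecSum, hd', Finset.sum_sub_distrib, Finset.sum_ite_mem, Finset.sum_const,
      nsmul_eq_mul]
    ring
  have hsumy : ∑ e, d' e * y e = ∑ e, d e * y e - ε * vecSum y (cut X) := by
    simp only [hd', vecSum, sub_mul, Finset.sum_sub_distrib, ite_mul, zero_mul, Finset.mul_sum]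
    rw [Finset.sum_ite_mem, Finset.univ_inter]
  have hd'A : d' ∈ A := by
    refine ⟨fun e => ?_, fun J hJ => ?_⟩
    · by_cases he : e ∈ cut X
      · have := hεe e he
        have := (hd.1 e).2
        simp only [hd', he, if_true, Set.mem_Icc]
        constructor <;> linarith
      · simpa [hd', he] using hd.1 e
    · rw [hsumJ, hsumy]
      have hy1 := mul_le_mul_of_nonneg_left (hcut X hXodd) hε.le
      rcases (hJ₁min J hJ).lt_or_eq with hlt | heq
      · have h1 := hεJ J hJ hlt
        have h2 := hd.2 J₁ hJ₁
        linarith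
      · have h1 := hX J hJ fun J' hJ' => heq ▸ hJ₁min J' hJ'
        have h2 := hd.2 J hJ
        rw [h1]; push_cast
        linarith
  have h1 := hdmin hd'A
  have h2 : ∑ e, d' e = ∑ e, d e - ε * (cut X).card := by
    have := hsumJ Finset.univ
    simpa [vecSum] using this
  simp only [Set.mem_ofPred_eq] at h1
  rw [h2] at h1
  have h3 : (0 : ℝ) < (cut X).card := by
    have h4 := hX J₁ hJ₁ hJ₁min
    have h5 : (J₁ ∩ cut X).card ≤ (cut X).card := Finset.card_le_card Finset.inter_subset_right
    have : 0 < (cut X).card := by omega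
    exact_mod_cast this
  have := mul_pos hε h3
  linarith

end TJoins

end PathTSP

namespace PathTSP

/-! ### Eulerian trails in connected multigraphs -/

section Euler

variable {V : Type*} [Fintype V] [DecidableEq V]

/-- `Trail M u v`: the edge multiset `M` can be traversed by a walk from `u` to `v`. -/
inductive Trail : Multiset (Edge V) → V → V → Prop
  | nil (u : V) : Trail 0 u u
  | cons {M : Multiset (Edge V)} {u v w : V} (h : u ≠ v) (p : Trail M v w) :
      Trail (mkEdge u v h ::ₘ M) u w

theorem Trail.append {M N : Multiset (Edge V)} {u v w : V} (p : Trail M u v) (q : Trail N v w) :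
    Trail (M + N) u w := by
  induction p with
  | nil u => simpa using q
  | cons h p ih => rw [Multiset.cons_add]; exact Trail.cons h (ih q)

theorem Trail.exists_walk {M : Multiset (Edge V)} {u v : V} (p : Trail M u v) :
    ∃ w : (⊤ : SimpleGraph V).Walk u v, IsEulerianIn w M := by
  induction p with
  | nil u => exact ⟨SimpleGraph.Walk.nil, by simp [IsEulerianIn]⟩
  | cons h p ih =>
    obtain ⟨w, hw⟩ := ih
    refine ⟨SimpleGraph.Walk.cons (by simpa using h) w, ?_⟩
    simp only [IsEulerianIn, SimpleGraph.Walk.edges_cons, Multiset.map_cons] at hw ⊢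
    rw [← hw]; rfl

/-- The parity of the degree of `x` in the multigraph `(V, M)`. -/
def degParity (M : Multiset (Edge V)) (x : V) : ZMod 2 :=
  (M.map fun e => if e ∈ cut {x} then (1 : ZMod 2) else 0).sum

theorem degParity_add (M N : Multiset (Edge V)) (x : V) :
    degParity (M + N) x = degParity M x + degParity N x := by
  simp [degParity]

theorem degParity_val (A : Finset (Edge V)) (x : V) : degParity A.val x = cutParity A {x} := by
  rw [cutParity_eq_sum]; rfl

theorem mkEdge_mem_cut_singleton {u v x : V} {h : u ≠ v} :
    mkEdge u v h ∈ cut {x} ↔ (x = u ∨ x = v) := by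
  simp only [mkEdge_mem_cut, Finset.mem_singleton]
  constructor
  · rintro (⟨h1, -⟩ | ⟨h1, -⟩)
    exacts [Or.inl h1.symm, Or.inr h1.symm]
  · rintro (rfl | rfl)
    exacts [Or.inl ⟨rfl, h.symm⟩, Or.inr ⟨rfl, h⟩]

theorem Trail.degParity {M : Multiset (Edge V)} {u v : V} (p : Trail M u v) (x : V) :
    degParity M x = (if x = u then 1 else 0) + if x = v then 1 else 0 := by
  induction p with
  | nil u =>
    simp only [PathTSP.degParity, Multiset.map_zero, Multiset.sum_zero]
    exact (CharTwo.add_self_eq_zero _).symm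
  | @cons M u v w h p ih =>
    have : PathTSP.degParity (mkEdge u v h ::ₘ M) x =
        (if mkEdge u v h ∈ cut {x} then 1 else 0) + PathTSP.degParity M x := by
      simp [PathTSP.degParity]
    rw [this, ih]
    simp only [mkEdge_mem_cut_singleton]
    by_cases h1 : x = u
    · subst h1; simp [h]
    · by_cases h2 : x = v
      · subst h2; simp only [h1, if_false, if_true, or_true, zero_add]
        rw [← add_assoc, CharTwo.add_self_eq_zero, zero_add]
      · simp [h1, h2]

theorem exists_edge_of_degParity {M : Multiset (Edge V)} {x : V} (h : degParity M x ≠ 0) :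
    ∃ y, ∃ hne : x ≠ y, mkEdge x y hne ∈ M := by
  by_contra! hcon
  apply h
  refine Multiset.sum_eq_zero fun a ha => ?_
  obtain ⟨e, he, rfl⟩ := Multiset.mem_map.1 ha
  obtain ⟨u, v, huv, rfl⟩ := e.exists_rep
  simp only [mkEdge_mem_cut_singleton, ite_eq_right_iff, one_ne_zero, imp_false]
  rintro (rfl | rfl)
  · exact hcon _ _ he
  · exact hcon u huv.symm (by rwa [mkEdge_comm])

/-- A longest trail from `s` can only stop at `t`: at any other end the number of unused edges is
odd, so the trail could continue. -/
theorem exists_maximal_trail {M : Multiset (Edge V)} {s t : V}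
    (h : ∀ x, degParity M x = (if x = s then 1 else 0) + if x = t then 1 else 0) :
    ∃ N ≤ M, Trail N s t ∧ ∀ y, ∀ hne : t ≠ y, mkEdge t y hne ∉ M - N := by
  obtain ⟨⟨N, v⟩, ⟨hN, hT⟩, hmax⟩ := Set.exists_max_image
    {q : Multiset (Edge V) × V | q.1 ≤ M ∧ Trail q.1 s q.2} (fun q => q.1.card)
    (Set.Finite.subset ((Set.finite_Iic M).prod Set.finite_univ) fun q hq => ⟨hq.1, trivial⟩)
    ⟨(0, s), Multiset.zero_le _, Trail.nil s⟩
  have hno : ∀ y, ∀ hne : v ≠ y, mkEdge v y hne ∉ M - N := by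
    intro y hne hmem
    have h1 : N + (mkEdge v y hne ::ₘ 0) ≤ M := by
      calc N + (mkEdge v y hne ::ₘ 0) ≤ N + (M - N) := by
            gcongr
            simpa using hmem
        _ = M := add_tsub_cancel_of_le hN
    have h2 := hmax (N + (mkEdge v y hne ::ₘ 0), y)
      ⟨h1, hT.append (Trail.cons hne (Trail.nil y))⟩
    simp at h2
  have hvt : v = t := by
    by_contra hvt
    have h1 : degParity M v = degParity N v + degParity (M - N) v := by
      rw [← degParity_add, add_tsub_cancel_of_le hN]
    rw [h, hT.degParity v] at h1
    simp only [hvt, if_false, if_true] at h1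
    have h2 : degParity (M - N) v = 1 := by
      rcases zmod_two_cases (degParity (M - N) v) with h3 | h3
      · rw [h3] at h1
        exfalso
        have := add_left_cancel (a := if v = s then (1 : ZMod 2) else 0) (by linear_combination h1 :
          _ + 0 = _ + (1 : ZMod 2))
        exact absurd this (by decide)
      · exact h3
    obtain ⟨y, hne, hy⟩ := exists_edge_of_degParity (M := M - N) (x := v) (by rw [h2]; decide)
    exact hno y hne hy
  subst hvt
  exact ⟨N, hN, hT, hno⟩

theorem Trail.split {N : Multiset (Edge V)} {s t x y : V} (p : Trail N s t) {h : x ≠ y}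
    (hxy : mkEdge x y h ∈ N) : ∃ N₁ N₂, N = N₁ + N₂ ∧ Trail N₁ s x ∧ Trail N₂ x t := by
  induction p with
  | nil u => simp at hxy
  | @cons M u v w hne p ih =>
    rcases Multiset.mem_cons.1 hxy with h1 | h1
    · have h2 : s(x, y) = s(u, v) := congrArg Subtype.val h1
      rcases Sym2.eq_iff.1 h2 with ⟨rfl, rfl⟩ | ⟨rfl, rfl⟩
      · exact ⟨0, _, (zero_add _).symm, Trail.nil _, Trail.cons hne p⟩
      · exact ⟨_, M, by rw [← Multiset.singleton_add]; rfl, Trail.cons hne (Trail.nil _), p⟩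
    · obtain ⟨N₁, N₂, rfl, h2, h3⟩ := ih h1
      exact ⟨_, N₂, by rw [← Multiset.cons_add], Trail.cons hne h2, h3⟩

/-- Euler's theorem for connected multigraphs. -/
theorem exists_trail_of_connected {M : Multiset (Edge V)} {s t : V}
    (h : ∀ x, degParity M x = (if x = s then 1 else 0) + if x = t then 1 else 0)
    (hconn : ∀ u v, Joined M.toFinset u v) : Trail M s t := by
  obtain ⟨N₀, hN₀, hT₀, -⟩ := exists_maximal_trail h
  obtain ⟨N, ⟨hN, hT⟩, hmax⟩ := Set.exists_max_image
    {N : Multiset (Edge V) | N ≤ M ∧ Trail N s t} (fun q => q.card)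
    (Set.Finite.subset (Set.finite_Iic M) fun q hq => hq.1) ⟨N₀, hN₀, hT₀⟩
  have hMN : N + (M - N) = M := add_tsub_cancel_of_le hN
  have hR : ∀ x, degParity (M - N) x = 0 := by
    intro x
    have h1 : degParity M x = degParity N x + degParity (M - N) x := by
      rw [← degParity_add, hMN]
    rw [h, hT.degParity x] at h1
    linear_combination -h1
  -- A closed trail through an unused edge at a visited vertex could be spliced into the longest
  -- trail.
  have hvis : ∀ N₁ N₂ x, N = N₁ + N₂ → Trail N₁ s x → Trail N₂ x t →
      ∀ y, ∀ hne : x ≠ y, mkEdge x y hne ∉ M - N := by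
    intro N₁ N₂ x hNN h1 h2 y hne hmem
    obtain ⟨N', hN', hT', hno⟩ := exists_maximal_trail (M := M - N) (s := x) (t := x)
      (fun v => by rw [hR, CharTwo.add_self_eq_zero])
    have h3 := hmax (N₁ + (N' + N₂)) ⟨?_, h1.append (hT'.append h2)⟩
    · have h4 : N' = 0 := by
        rw [← Multiset.card_eq_zero]
        rw [hNN] at h3
        simp only [Multiset.card_add] at h3
        omega
      subst h4
      exact hno y hne (by simpa using hmem)
    · calc N₁ + (N' + N₂) = N + N' := by rw [hNN]; abel
        _ ≤ N + (M - N) := by gcongr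
        _ = M := hMN
  have hall : ∀ x, ∃ N₁ N₂, N = N₁ + N₂ ∧ Trail N₁ s x ∧ Trail N₂ x t := by
    intro x
    have hj := hconn s x
    induction hj with
    | refl => exact ⟨0, N, (zero_add _).symm, Trail.nil _, hT⟩
    | @tail b c _ hbc ih =>
      obtain ⟨N₁, N₂, hNN, h1, h2⟩ := ih
      obtain ⟨hne, hm⟩ := hbc
      have hm' : mkEdge b c hne ∈ N + (M - N) := by rw [hMN]; simpa using hm
      rcases Multiset.mem_add.1 hm' with h3 | h3
      · rw [mkEdge_comm] at h3
        exact hT.split h3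
      · exact absurd h3 (hvis N₁ N₂ b hNN h1 h2 c hne)
  have hzero : M - N = 0 := by
    rw [Multiset.eq_zero_iff_forall_notMem]
    intro e he
    obtain ⟨u, v, huv, rfl⟩ := e.exists_rep
    obtain ⟨N₁, N₂, hNN, h1, h2⟩ := hall u
    exact hvis N₁ N₂ u hNN h1 h2 v huv he
  rw [hzero, add_zero] at hMN
  rwa [← hMN]

end Euler

/-! ### Shortcutting walks and the triangle inequality -/

section Shortcut

variable {V : Type*} [Fintype V] [DecidableEq V]

theorem exists_walk_of_list (l : List V) (s t : V) (h : (s :: (l ++ [t])).Nodup) :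
    ∃ P : (⊤ : SimpleGraph V).Walk s t, P.support = s :: (l ++ [t]) := by
  induction l generalizing s with
  | nil =>
    have hne : s ≠ t := by
      rintro rfl
      simp at h
    exact ⟨SimpleGraph.Walk.cons (by simpa using hne) SimpleGraph.Walk.nil, by simp⟩
  | cons a l ih =>
    obtain ⟨P, hP⟩ := ih a (List.nodup_cons.1 h).2
    have hne : s ≠ a := by
      rintro rfl
      simp at h
    exact ⟨SimpleGraph.Walk.cons (by simpa using hne) P, by simp [hP]⟩

theorem exists_shortcut {s t : V} (hst : s ≠ t) (w : (⊤ : SimpleGraph V).Walk s t) :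
    ∃ P, IsShortcut w P := by
  obtain ⟨m, hm⟩ : ∃ m, w.support = s :: (m ++ [t]) := by
    cases w with
    | nil => exact absurd rfl hst
    | cons h p =>
      refine ⟨p.support.dropLast, ?_⟩
      rw [SimpleGraph.Walk.support_cons]
      congr 1
      conv_lhs => rw [← List.dropLast_append_getLast p.support_ne_nil]
      rw [SimpleGraph.Walk.getLast_support]
  -- Both `s` and `t` are removed from the interior before duplicates are, so that an early visit of
  -- `t` is skipped and the path still ends there.
  obtain ⟨P, hP⟩ := exists_walk_of_list ((m.filter fun v => v ≠ s ∧ v ≠ t).dedup) s t (by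
    rw [List.nodup_cons]
    refine ⟨by simp [hst], ?_⟩
    rw [List.nodup_append]
    refine ⟨List.nodup_dedup _, by simp, ?_⟩
    intro a ha b hb
    simp only [List.mem_dedup, List.mem_filter, List.mem_singleton, decide_eq_true_eq] at ha hb
    rw [hb]; exact ha.2.2)
  refine ⟨P, ?_, ?_, ?_⟩
  · rw [hP, hm]
    refine List.Sublist.cons_cons _ (List.Sublist.append_right ?_ _)
    exact (List.dedup_sublist _).trans List.filter_sublist
  · rw [hP, List.nodup_cons]
    refine ⟨by simp [hst], ?_⟩
    rw [List.nodup_append]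
    refine ⟨List.nodup_dedup _, by simp, ?_⟩
    intro a ha b hb
    simp only [List.mem_dedup, List.mem_filter, List.mem_singleton, decide_eq_true_eq] at ha hb
    rw [hb]; exact ha.2.2
  · intro v hv
    rw [hm] at hv
    rw [hP]
    by_cases h1 : v = s
    · simp [h1]
    · by_cases h2 : v = t
      · simp [h2]
      · simp only [List.mem_cons, List.mem_append, h1, h2, false_or, List.not_mem_nil,
          or_false] at hv
        simp [h1, h2, hv]

variable [MetricSpace V]

/-- The length of the polygonal line through the points of a list. -/
noncomputable def listCost : List V → ℝ
  | [] => 0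
  | [_] => 0
  | a :: b :: l => dist a b + listCost (b :: l)

theorem listCost_cons_le (a b : V) (l : List V) :
    listCost (a :: l) ≤ dist a b + listCost (b :: l) := by
  cases l with
  | nil => simp [listCost]
  | cons d l =>
    simp only [listCost]
    have := dist_triangle a b d
    linarith

/-- Every skipped point is one application of the triangle inequality. The head varies because after
skipping `b` the induction hypothesis is used with head `b`. -/
theorem listCost_cons_le_of_sublist {l₁ l₂ : List V} (h : l₁.Sublist l₂) :
    ∀ a, listCost (a :: l₁) ≤ listCost (a :: l₂) := by
  induction h with
  | slnil => exact fun _ => le_rfl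
  | cons b _ ih =>
    intro a
    refine (listCost_cons_le a b _).trans ?_
    simp only [listCost]
    have := ih b
    linarith
  | cons_cons b _ ih =>
    intro a
    simp only [listCost]
    have := ih b
    linarith

theorem walkCost_eq_listCost {s t : V} (w : (⊤ : SimpleGraph V).Walk s t) :
    walkCost w = listCost w.support := by
  induction w with
  | nil => simp [walkCost, listCost]
  | @cons u v w h p ih =>
    rw [SimpleGraph.Walk.support_cons]
    have : p.support = v :: p.support.tail := by
      rw [SimpleGraph.Walk.cons_tail_support]
    rw [this, listCost, ← this, ← ih]
    simp [walkCost, edgeCost]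

theorem IsShortcut.walkCost_le {s t : V} {w P : (⊤ : SimpleGraph V).Walk s t}
    (h : IsShortcut w P) : walkCost P ≤ walkCost w := by
  rw [walkCost_eq_listCost, walkCost_eq_listCost]
  have h1 := h.1
  have hw : w.support = s :: w.support.tail := by
    rw [SimpleGraph.Walk.cons_tail_support]
  have hP : P.support = s :: P.support.tail := by
    rw [SimpleGraph.Walk.cons_tail_support]
  rw [hw, hP] at h1 ⊢
  exact listCost_cons_le_of_sublist (List.cons_sublist_cons.1 h1) s

theorem IsEulerianIn.walkCost {s t : V} {w : (⊤ : SimpleGraph V).Walk s t}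
    {H : Multiset (Edge V)} (h : IsEulerianIn w H) :
    walkCost w = (H.map fun e => edgeCost e.1).sum := by
  rw [IsEulerianIn] at h
  rw [PathTSP.walkCost, ← Multiset.sum_coe, ← Multiset.map_coe, h, Multiset.map_map]
  rfl

theorem IsShortcut.isHamiltonian {s t : V} {w P : (⊤ : SimpleGraph V).Walk s t}
    (h : IsShortcut w P) (hw : ∀ v, v ∈ w.support) : P.IsHamiltonian := fun v =>
  List.count_eq_one_of_mem h.2.1 (h.2.2 v (hw v))

theorem IsEulerianIn.mem_support {s t : V} {w : (⊤ : SimpleGraph V).Walk s t}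
    {H : Multiset (Edge V)} (h : IsEulerianIn w H) {u v : V} {hne : u ≠ v}
    (hm : mkEdge u v hne ∈ H) : u ∈ w.support := by
  have h1 : s(u, v) ∈ (w.edges : Multiset (Sym2 V)) := by
    rw [h]; exact Multiset.mem_map_of_mem Subtype.val hm
  exact w.fst_mem_support_of_mem_edges (by simpa using h1)

end Shortcut

end PathTSP

namespace PathTSP

/-! ### The linear program, narrow cuts and their deficiencies -/

section LinearProgram

variable {V : Type*} [Fintype V] [DecidableEq V]

/-- The edges with both ends in `W`. -/
def inner (W : Finset V) : Finset (Edge V) := Finset.univ.filter fun e => ∀ v ∈ e.1, v ∈ W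

theorem mkEdge_mem_inner {u v : V} {h : u ≠ v} {W : Finset V} :
    mkEdge u v h ∈ inner W ↔ u ∈ W ∧ v ∈ W := by
  simp [inner, mkEdge]

theorem inner_mono {W W' : Finset V} (h : W ⊆ W') : inner W ⊆ inner W' := by
  intro e he
  simp only [inner, Finset.mem_filter, Finset.mem_univ, true_and] at he ⊢
  exact fun v hv => h (he v hv)

theorem inner_univ : inner (Finset.univ : Finset V) = Finset.univ := by
  ext e; simp [inner]

theorem vecSum_eq_sum_ite (x : Edge V → ℝ) (A : Finset (Edge V)) :
    vecSum x A = ∑ e, if e ∈ A then x e else 0 := by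
  simp [vecSum]

theorem vecSum_mono {x : Edge V → ℝ} (hx : ∀ e, 0 ≤ x e) {A B : Finset (Edge V)} (h : A ⊆ B) :
    vecSum x A ≤ vecSum x B :=
  Finset.sum_le_sum_of_subset_of_nonneg h fun e _ _ => hx e

theorem vecSum_nonneg {x : Edge V → ℝ} (hx : ∀ e, 0 ≤ x e) (A : Finset (Edge V)) :
    0 ≤ vecSum x A := Finset.sum_nonneg fun e _ => hx e

theorem sum_degree (x : Edge V → ℝ) (W : Finset V) :
    ∑ v ∈ W, vecSum x (cut {v}) = 2 * vecSum x (inner W) + vecSum x (cut W) := by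
  simp only [vecSum_eq_sum_ite]
  rw [Finset.sum_comm, Finset.mul_sum, ← Finset.sum_add_distrib]
  refine Finset.sum_congr rfl fun e _ => ?_
  obtain ⟨u, v, h, rfl⟩ := e.exists_rep
  have key : ∀ w, (if mkEdge u v h ∈ cut {w} then x (mkEdge u v h) else 0)
      = (if w = u then x (mkEdge u v h) else 0) + if w = v then x (mkEdge u v h) else 0 := by
    intro w
    simp only [mkEdge_mem_cut_singleton]
    by_cases h1 : w = u
    · subst h1; simp [h]
    · by_cases h2 : w = v
      · subst h2; simp [h.symm]
      · simp [h1, h2]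
  simp only [key, Finset.sum_add_distrib, Finset.sum_ite_eq']
  simp only [mkEdge_mem_inner, mkEdge_mem_cut]
  by_cases h1 : u ∈ W <;> by_cases h2 : v ∈ W <;> simp [h1, h2]
  ring

theorem cut_posimodular {x : Edge V → ℝ} (hx : ∀ e, 0 ≤ x e) (U W : Finset V) :
    vecSum x (cut (U \ W)) + vecSum x (cut (W \ U)) ≤ vecSum x (cut U) + vecSum x (cut W) := by
  simp only [vecSum_eq_sum_ite]
  rw [← Finset.sum_add_distrib, ← Finset.sum_add_distrib]
  refine Finset.sum_le_sum fun e _ => ?_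
  obtain ⟨u, v, h, rfl⟩ := e.exists_rep
  have := hx (mkEdge u v h)
  simp only [mkEdge_mem_cut, Finset.mem_sdiff]
  by_cases h1 : u ∈ U <;> by_cases h2 : v ∈ U <;> by_cases h3 : u ∈ W <;> by_cases h4 : v ∈ W <;>
    simp [h1, h2, h3, h4, this]

/-- For `U ⊆ W` an edge in both cuts joins `U` to the complement of `W` and bypasses `W \ U`; these
edges are the only discrepancy. -/
theorem cut_sdiff_eq (x : Edge V → ℝ) {U W : Finset V} (hUW : U ⊆ W) :
    vecSum x (cut (W \ U)) = vecSum x (cut U) + vecSum x (cut W)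
      - 2 * vecSum x (cut U ∩ cut W) := by
  simp only [vecSum_eq_sum_ite]
  rw [Finset.mul_sum, ← Finset.sum_add_distrib, ← Finset.sum_sub_distrib]
  refine Finset.sum_congr rfl fun e _ => ?_
  obtain ⟨u, v, h, rfl⟩ := e.exists_rep
  simp only [mkEdge_mem_cut, Finset.mem_sdiff, Finset.mem_inter]
  have h5 := @hUW u
  have h6 := @hUW v
  by_cases h1 : u ∈ U <;> by_cases h2 : v ∈ U <;> by_cases h3 : u ∈ W <;> by_cases h4 : v ∈ W <;>
    simp_all
  all_goals ring

variable {s t : V} {x : Edge V → ℝ}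

theorem IsFeasible.two_le_cut (hx : IsFeasible s t x) {U : Finset V} (hne : U.Nonempty)
    (hne' : U ≠ Finset.univ) (h : s ∈ U ↔ t ∈ U) : 2 ≤ vecSum x (cut U) := by
  by_cases hs : s ∈ U
  · rw [← cut_compl]
    refine hx.two_le _ ?_ (by simpa using hs) (by simpa using h.1 hs)
    rw [Finset.nonempty_iff_ne_empty]
    simpa using hne'
  · exact hx.two_le U hne hs (fun ht => hs (h.2 ht))

theorem IsFeasible.one_le_cut (hx : IsFeasible s t x) {U : Finset V} (hne : U.Nonempty)
    (hne' : U ≠ Finset.univ) : 1 ≤ vecSum x (cut U) := by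
  by_cases h : s ∈ U ↔ t ∈ U
  · linarith [hx.two_le_cut hne hne' h]
  · by_cases hs : s ∈ U
    · exact hx.one_le U hs (by tauto)
    · rw [← cut_compl]
      exact hx.one_le _ (by simpa using hs) (by simp; tauto)

theorem IsFeasible.sum_degree (hx : IsFeasible s t x) (hst : s ≠ t) (W : Finset V) :
    2 * vecSum x (inner W) + vecSum x (cut W)
      = 2 * W.card - (if s ∈ W then 1 else 0) - if t ∈ W then 1 else 0 := by
  rw [← PathTSP.sum_degree]
  have : ∀ v, vecSum x (cut {v}) = 2 - (if s = v then 1 else 0) - if t = v then 1 else 0 := by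
    intro v
    by_cases h1 : v = s
    · subst h1; rw [hx.degree_s]; simp [hst.symm]; norm_num
    · by_cases h2 : v = t
      · subst h2; rw [hx.degree_t]; simp [hst]; norm_num
      · rw [hx.degree_inner v h1 h2]; simp [Ne.symm h1, Ne.symm h2]
  simp only [this, Finset.sum_sub_distrib, Finset.sum_const, Finset.sum_ite_eq, nsmul_eq_mul]
  ring

/-- With the degrees fixed, a lower bound on `x(δ(W))` is an upper bound on the inside of `W`. This
is the spanning tree polytope constraint. -/
theorem IsFeasible.inner_le (hx : IsFeasible s t x) (hst : s ≠ t) {W : Finset V}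
    (hW : W.Nonempty) : vecSum x (inner W) ≤ W.card - 1 := by
  have h1 := hx.sum_degree hst W
  have h0 := vecSum_nonneg hx.nonneg (cut W)
  by_cases hs : s ∈ W <;> by_cases ht : t ∈ W
  · simp only [hs, ht, if_true] at h1; linarith
  · have h2 := hx.one_le W hs ht
    simp only [hs, ht, if_true, if_false] at h1; linarith
  · have h2 : 1 ≤ vecSum x (cut W) := hx.one_le_cut hW (by rintro rfl; simp at hs)
    simp only [hs, ht, if_true, if_false] at h1; linarith
  · have h2 := hx.two_le W hW hs ht
    simp only [hs, ht, if_false] at h1; linarith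

theorem mem_narrowCuts {U : Finset V} :
    U ∈ narrowCuts s t x ↔ s ∈ U ∧ t ∉ U ∧ vecSum x (cut U) < 2 := by
  simp [narrowCuts]

/-- Otherwise `U \ W` and `W \ U` are nonempty and avoid `s` and `t`, so their cuts total at least
4, whereas the two narrow cuts total less. -/
theorem IsFeasible.narrow_chain (hx : IsFeasible s t x) {U W : Finset V}
    (hU : U ∈ narrowCuts s t x) (hW : W ∈ narrowCuts s t x) : U ⊆ W ∨ W ⊆ U := by
  by_contra! hcon
  obtain ⟨hs, ht, h2⟩ := mem_narrowCuts.1 hU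
  obtain ⟨hs', ht', h2'⟩ := mem_narrowCuts.1 hW
  have h3 := cut_posimodular hx.nonneg U W
  have h4 := hx.two_le (U \ W) (by rw [Finset.sdiff_nonempty]; exact hcon.1) (by simp [hs'])
    (by simp [ht])
  have h5 := hx.two_le (W \ U) (by rw [Finset.sdiff_nonempty]; exact hcon.2) (by simp [hs])
    (by simp [ht'])
  linarith

/-- The deficiency `2 - x(δ(U))` of a narrow cut; the trivial sets get the value one. -/
noncomputable def deficiency (x : Edge V → ℝ) (U : Finset V) : ℝ :=
  if U = ∅ ∨ U = Finset.univ then 1 else 2 - vecSum x (cut U)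

theorem deficiency_narrow {U : Finset V} (hU : U ∈ narrowCuts s t x) :
    deficiency x U = 2 - vecSum x (cut U) := by
  obtain ⟨hs, ht, -⟩ := mem_narrowCuts.1 hU
  have h1 : U ≠ ∅ := by rintro rfl; simp at hs
  have h2 : U ≠ Finset.univ := by rintro rfl; simp at ht
  simp [deficiency, h1, h2]

theorem deficiency_pos {U : Finset V} (hU : U ∈ narrowCuts s t x) : 0 < deficiency x U := by
  rw [deficiency_narrow hU]
  linarith [(mem_narrowCuts.1 hU).2.2]

theorem IsFeasible.deficiency_le_one (hx : IsFeasible s t x) {U : Finset V}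
    (hU : U ∈ narrowCuts s t x) : deficiency x U ≤ 1 := by
  rw [deficiency_narrow hU]
  linarith [hx.one_le U (mem_narrowCuts.1 hU).1 (mem_narrowCuts.1 hU).2.1]

theorem deficiency_empty : deficiency x ∅ = 1 := by simp [deficiency]

theorem deficiency_univ : deficiency x Finset.univ = 1 := by simp [deficiency]

/-- The edges inside a level between two narrow cuts almost span it. -/
theorem IsFeasible.le_inner_sdiff (hx : IsFeasible s t x) (hst : s ≠ t) {U W : Finset V}
    (hU : U = ∅ ∨ U ∈ narrowCuts s t x) (hW : W = Finset.univ ∨ W ∈ narrowCuts s t x)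
    (hUW : U ⊆ W) :
    ((W \ U).card : ℝ) - 2 + (deficiency x U + deficiency x W) / 2 ≤ vecSum x (inner (W \ U)) := by
  -- A first or last level misses one unit of degree, at `s` or at `t`. Giving `∅` and `V`
  -- deficiency one accounts for exactly this, so that all four cases share one formula.
  have h1 := hx.sum_degree hst (W \ U)
  have h2 := cut_sdiff_eq x hUW
  have h3 := vecSum_nonneg hx.nonneg (cut U ∩ cut W)
  have hcu : cut (Finset.univ : Finset V) = ∅ := by
    ext e; obtain ⟨u, v, h, rfl⟩ := e.exists_rep; simp [mkEdge_mem_cut]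
  have hce : cut (∅ : Finset V) = ∅ := by
    ext e; obtain ⟨u, v, h, rfl⟩ := e.exists_rep; simp [mkEdge_mem_cut]
  have h0 : vecSum x ∅ = 0 := by simp [vecSum]
  rcases hU with rfl | hU <;> rcases hW with rfl | hW
  · rw [deficiency_empty, deficiency_univ]
    simp only [hcu, hce, Finset.inter_self, h0] at h2
    simp only [Finset.sdiff_empty, Finset.mem_univ, if_true] at h1 h2 ⊢
    linarith
  · rw [deficiency_empty, deficiency_narrow hW]
    simp only [hce, Finset.empty_inter, h0] at h2
    simp only [Finset.sdiff_empty, (mem_narrowCuts.1 hW).1, (mem_narrowCuts.1 hW).2.1, if_true,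
      if_false] at h1 h2 ⊢
    linarith
  · rw [deficiency_univ, deficiency_narrow hU]
    simp only [hcu, Finset.inter_empty, h0] at h2
    simp only [Finset.mem_sdiff, Finset.mem_univ, true_and, (mem_narrowCuts.1 hU).1,
      (mem_narrowCuts.1 hU).2.1, not_true, not_false_eq_true, if_true, if_false] at h1 h2 ⊢
    linarith
  · rw [deficiency_narrow hU, deficiency_narrow hW]
    simp only [Finset.mem_sdiff, (mem_narrowCuts.1 hU).1, (mem_narrowCuts.1 hW).2.1, not_true,
      and_false, false_and, if_false] at h1
    linarith

/-- The set between the two cuts avoids `s` and `t`, so its cut has value at least 2; this limits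
how many edges can cross both. -/
theorem IsFeasible.cut_inter_le (hx : IsFeasible s t x) {U W : Finset V}
    (hU : U ∈ narrowCuts s t x) (hW : W ∈ narrowCuts s t x) (hne : U ≠ W) :
    vecSum x (cut U ∩ cut W) ≤ 1 - (deficiency x U + deficiency x W) / 2 := by
  wlog h : U ⊆ W generalizing U W
  · have := this hW hU hne.symm ((hx.narrow_chain hU hW).resolve_left h)
    rw [Finset.inter_comm]; linarith
  have h1 := hx.two_le (W \ U)
    (by rw [Finset.sdiff_nonempty]; exact fun h' => hne (h.antisymm h'))
    (by simp [(mem_narrowCuts.1 hU).1]) (by simp [(mem_narrowCuts.1 hW).2.1])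
  have h2 := cut_sdiff_eq x h
  rw [deficiency_narrow hU, deficiency_narrow hW]
  linarith

/-- The incidence vector of such a path will witness feasibility. Connectivity and parity are all
that is recorded, since the degrees then follow by counting. -/
theorem exists_hamiltonian_path_set (W : Finset V) (t : V) (ht : t ∉ W) :
    ∀ s, s ∉ W → s ≠ t → ∃ P : Finset (Edge V), P ⊆ inner (insert s (insert t W)) ∧
      P.card = W.card + 1 ∧ oddVertices P = symmDiff {s} {t} ∧
      ∀ v ∈ insert s (insert t W), Joined P s v := by
  induction W using Finset.induction_on with
  | empty =>
    intro s _ hst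
    refine ⟨{mkEdge s t hst}, ?_, by simp, oddVertices_singleton _ _ _, ?_⟩
    · intro e he
      rw [Finset.mem_singleton.1 he, mkEdge_mem_inner]; simp
    · intro v hv
      simp only [Finset.mem_insert, Finset.notMem_empty, or_false] at hv
      rcases hv with rfl | rfl
      · exact Joined.refl _ _
      · exact Joined.of_mem (h := hst) (by simp)
  | insert a W ha ih =>
    intro s hs hst
    simp only [Finset.mem_insert, not_or] at ht hs
    obtain ⟨P, hP, hcard, hodd, hconn⟩ := ih ht.2 a ha (Ne.symm ht.1)
    have hnew : mkEdge s a hs.1 ∉ P := by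
      intro h
      have := mkEdge_mem_inner.1 (hP h)
      simp [hs.1, hs.2, hst] at this
    refine ⟨insert (mkEdge s a hs.1) P, ?_, ?_, ?_, ?_⟩
    · intro e he
      rcases Finset.mem_insert.1 he with rfl | he
      · rw [mkEdge_mem_inner]; simp
      · refine inner_mono ?_ (hP he)
        intro v hv
        simp only [Finset.mem_insert] at hv ⊢
        tauto
    · rw [Finset.card_insert_of_notMem hnew, hcard, Finset.card_insert_of_notMem ha]
    · have : insert (mkEdge s a hs.1) P = symmDiff {mkEdge s a hs.1} P := by
        rw [Finset.insert_eq, Disjoint.symmDiff_eq_sup]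
        · rfl
        · rwa [Finset.disjoint_singleton_left]
      rw [this, oddVertices_symmDiff, hodd, oddVertices_singleton, symmDiff_assoc,
        symmDiff_symmDiff_cancel_left]
    · have hsa : Joined (insert (mkEdge s a hs.1) P) s a := Joined.of_mem (h := hs.1) (by simp)
      intro v hv
      by_cases hvs : v = s
      · rw [hvs]; exact Joined.refl _ _
      · refine hsa.trans ((hconn v ?_).mono (Finset.subset_insert _ _))
        simp only [Finset.mem_insert] at hv ⊢
        tauto

theorem exists_feasible (hst : s ≠ t) : ∃ x : Edge V → ℝ, IsFeasible s t x := by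
  obtain ⟨P, -, hcard, hodd, hconn⟩ := exists_hamiltonian_path_set
    (Finset.univ \ {s, t}) t (by simp) s (by simp) hst
  have hall : insert s (insert t (Finset.univ \ {s, t} : Finset V)) = Finset.univ := by
    ext v; simp; tauto
  rw [hall] at hconn
  set x : Edge V → ℝ := fun e => if e ∈ P then 1 else 0 with hx
  have hxc : ∀ A, vecSum x A = (P ∩ A).card := by
    intro A
    simp [vecSum, hx, Finset.inter_comm]
  have hpos : ∀ U : Finset V, U.Nonempty → U ≠ Finset.univ → 1 ≤ (P ∩ cut U).card := by
    intro U hU hU'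
    rw [Nat.one_le_iff_ne_zero, Finset.card_ne_zero]
    by_contra hcon
    rw [Finset.not_nonempty_iff_eq_empty] at hcon
    have hclosed : ∀ u v, Joined P u v → (u ∈ U ↔ v ∈ U) := by
      intro u v huv
      induction huv with
      | refl => rfl
      | tail _ hbc ih =>
        rw [ih]
        obtain ⟨hne, hm⟩ := hbc
        by_contra hcon'
        have : mkEdge _ _ hne ∈ P ∩ cut U :=
          Finset.mem_inter.2 ⟨hm, mkEdge_mem_cut.2 (by tauto)⟩
        rw [hcon] at this
        simp at this
    obtain ⟨u, hu⟩ := hU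
    apply hU'
    rw [Finset.eq_univ_iff_forall]
    intro v
    exact (hclosed u v ((hconn u (by simp)).symm.trans (hconn v (by simp)))).1 hu
  have heven : ∀ U : Finset V, U.Nonempty → s ∉ U → t ∉ U → 2 ≤ (P ∩ cut U).card := by
    intro U hU hs ht
    have h1 := hpos U hU (by rintro rfl; simp at hs)
    have h2 : ¬ Odd (P ∩ cut U).card := by
      rw [odd_inter_cut_iff_odd_inter, hodd]
      have : U ∩ symmDiff {s} {t} = ∅ := by
        ext v
        simp only [Finset.mem_inter, Finset.mem_symmDiff, Finset.mem_singleton,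
          Finset.notMem_empty, iff_false]
        rintro ⟨hv, ⟨rfl, -⟩ | ⟨rfl, -⟩⟩
        exacts [hs hv, ht hv]
      rw [this]; simp
    rcases Nat.lt_or_ge (P ∩ cut U).card 2 with h3 | h3
    · exact absurd (by rw [show (P ∩ cut U).card = 1 by omega]; exact odd_one) h2
    · exact h3
  have hnu : ∀ v : V, ({v} : Finset V) ≠ Finset.univ := by
    intro v h
    have h1 : s ∈ ({v} : Finset V) := by rw [h]; simp
    have h2 : t ∈ ({v} : Finset V) := by rw [h]; simp
    rw [Finset.mem_singleton] at h1 h2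
    exact hst (h1.trans h2.symm)
  have hdeg := PathTSP.sum_degree x Finset.univ
  have hcu : cut (Finset.univ : Finset V) = ∅ := by
    ext e; obtain ⟨u, v, h, rfl⟩ := e.exists_rep; simp [mkEdge_mem_cut]
  have hc2 : ((Finset.univ \ {s, t} : Finset V).card : ℝ) = Fintype.card V - 2 := by
    have h1 := Finset.card_sdiff_add_card_eq_card (Finset.subset_univ ({s, t} : Finset V))
    rw [Finset.card_pair hst, Finset.card_univ] at h1
    have : ((Finset.univ \ {s, t} : Finset V).card : ℝ) + 2 = Fintype.card V := by exact_mod_cast h1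
    linarith
  rw [hcu, inner_univ, hxc, hxc, Finset.inter_univ, Finset.inter_empty, hcard] at hdeg
  push_cast at hdeg
  rw [hc2, Finset.card_empty] at hdeg
  -- lower bounds on all degrees which sum up to the total degree
  set lo : V → ℝ := fun v => 2 - (if s = v then 1 else 0) - if t = v then 1 else 0 with hlo
  have hle : ∀ v ∈ Finset.univ, lo v ≤ vecSum x (cut {v}) := by
    intro v _
    rw [hxc]
    by_cases h1 : v = s
    · subst h1
      have h3 : (1 : ℝ) ≤ (P ∩ cut {v}).card := by exact_mod_cast hpos {v} (by simp) (hnu v)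
      simp only [hlo, hst.symm, if_true, if_false]; linarith
    · by_cases h2 : v = t
      · subst h2
        have h3 : (1 : ℝ) ≤ (P ∩ cut {v}).card := by exact_mod_cast hpos {v} (by simp) (hnu v)
        simp only [hlo, hst, if_true, if_false]; linarith
      · have h3 : (2 : ℝ) ≤ (P ∩ cut {v}).card := by
          exact_mod_cast heven {v} (by simp) (by simpa using Ne.symm h1) (by simpa using Ne.symm h2)
        simp only [hlo, Ne.symm h1, Ne.symm h2, if_false]; linarith
  have hsum : ∑ v, lo v = ∑ v, vecSum x (cut {v}) := by
    rw [hdeg]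
    simp only [hlo, Finset.sum_sub_distrib, Finset.sum_const, Finset.sum_ite_eq, nsmul_eq_mul,
      Finset.mem_univ, if_true, Finset.card_univ]
    push_cast; ring
  have heq := (Finset.sum_eq_sum_iff_of_le hle).1 hsum
  refine ⟨x, ?_, ?_, ?_, ?_, ?_, ?_⟩
  · intro U hU hs ht
    rw [hxc]; exact_mod_cast heven U hU hs ht
  · intro U hs ht
    rw [hxc]; exact_mod_cast hpos U ⟨s, hs⟩ (by rintro rfl; simp at ht)
  · intro v h1 h2
    rw [← heq v (Finset.mem_univ _)]; simp [hlo, Ne.symm h1, Ne.symm h2]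
  · rw [← heq s (Finset.mem_univ _)]; simp [hlo, hst.symm]; norm_num
  · rw [← heq t (Finset.mem_univ _)]; simp [hlo, hst]; norm_num
  · intro e; simp only [hx]; split_ifs <;> norm_num

theorem IsFeasible.le_two (hx : IsFeasible s t x) (e : Edge V) : x e ≤ 2 := by
  obtain ⟨u, v, h, rfl⟩ := e.exists_rep
  have h1 : x (mkEdge u v h) ≤ vecSum x (cut {u}) :=
    Finset.single_le_sum (f := x) (fun e _ => hx.nonneg e)
      (mkEdge_mem_cut_singleton.2 (Or.inl rfl))
  refine h1.trans ?_
  by_cases h2 : u = s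
  · rw [h2, hx.degree_s]; norm_num
  · by_cases h3 : u = t
    · rw [h3, hx.degree_t]; norm_num
    · rw [hx.degree_inner u h2 h3]

theorem isCompact_feasible (s t : V) : IsCompact {x : Edge V → ℝ | IsFeasible s t x} := by
  have hbox : IsCompact (Set.univ.pi fun _ : Edge V => Set.Icc (0 : ℝ) 2) :=
    isCompact_univ_pi fun e => isCompact_Icc
  have hcont : ∀ A : Finset (Edge V), Continuous fun x : Edge V → ℝ => vecSum x A := by
    intro A; simp only [vecSum]; fun_prop
  refine hbox.of_isClosed_subset ?_ fun x hx e _ => ⟨hx.nonneg e, hx.le_two e⟩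
  have : {x : Edge V → ℝ | IsFeasible s t x} =
      {x | ∀ U : Finset V, U.Nonempty → s ∉ U → t ∉ U → 2 ≤ vecSum x (cut U)} ∩
      ({x | ∀ U : Finset V, s ∈ U → t ∉ U → 1 ≤ vecSum x (cut U)} ∩
      ({x | ∀ v : V, v ≠ s → v ≠ t → vecSum x (cut {v}) = 2} ∩
      ({x | vecSum x (cut {s}) = 1} ∩ ({x | vecSum x (cut {t}) = 1} ∩ {x | ∀ e, 0 ≤ x e})))) := by
    ext x
    exact ⟨fun h => ⟨h.1, h.2, h.3, h.4, h.5, h.6⟩, fun h => ⟨h.1, h.2.1, h.2.2.1, h.2.2.2.1,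
      h.2.2.2.2.1, h.2.2.2.2.2⟩⟩
  rw [this]
  simp only [Set.ofPred_forall]
  refine IsClosed.inter ?_ (IsClosed.inter ?_ (IsClosed.inter ?_ (IsClosed.inter ?_
    (IsClosed.inter ?_ ?_))))
  · exact isClosed_iInter fun U => isClosed_iInter fun _ => isClosed_iInter fun _ =>
      isClosed_iInter fun _ => isClosed_le continuous_const (hcont _)
  · exact isClosed_iInter fun U => isClosed_iInter fun _ => isClosed_iInter fun _ =>
      isClosed_le continuous_const (hcont _)
  · exact isClosed_iInter fun U => isClosed_iInter fun _ => isClosed_iInter fun _ =>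
      isClosed_eq (hcont _) continuous_const
  · exact isClosed_eq (hcont _) continuous_const
  · exact isClosed_eq (hcont _) continuous_const
  · exact isClosed_iInter fun e => isClosed_le continuous_const (continuous_apply e)

theorem exists_optimal [MetricSpace V] (hst : s ≠ t) : ∃ x : Edge V → ℝ, IsOptimal s t x := by
  obtain ⟨x, hx, hmin⟩ := (isCompact_feasible s t).exists_isMinOn (exists_feasible hst)
    (f := vecCost) (by unfold vecCost; fun_prop)
  exact ⟨x, hx, fun y hy => hmin hy⟩

end LinearProgram

end PathTSP

namespace PathTSP

/-! ### The level matroid over the field with two elements -/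

section Rank

variable {V : Type*} [Fintype V] [DecidableEq V]

/-- The active cuts crossed by an edge. -/
def crossing (𝒜 : Finset (Finset V)) (e : Edge V) : Finset (Finset V) :=
  𝒜.filter fun U => e ∈ cut U

/-- The incidence vector of an edge over the field with two elements. -/
def chi (e : Edge V) : V → ZMod 2 := fun v => if e ∈ cut {v} then 1 else 0

/-- The vector of an edge in the matroid whose bases are the spanning trees that cross all active
cuts exactly once. -/
def levelVec (𝒜 : Finset (Finset V)) (e : Edge V) : (V → ZMod 2) × (Finset V → ZMod 2) :=
  if (crossing 𝒜 e).card = 0 then (chi e, 0)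
  else if (crossing 𝒜 e).card = 1 then (0, fun U => if U ∈ crossing 𝒜 e then 1 else 0)
  else 0

/-- The span of the vectors of an edge set. -/
def levelSpan (𝒜 : Finset (Finset V)) (A : Finset (Edge V)) :
    Submodule (ZMod 2) ((V → ZMod 2) × (Finset V → ZMod 2)) :=
  Submodule.span (ZMod 2) (levelVec 𝒜 '' (A : Set (Edge V)))

/-- The rank of an edge set. -/
noncomputable def levelRank (𝒜 : Finset (Finset V)) (A : Finset (Edge V)) : ℕ :=
  Module.finrank (ZMod 2) (levelSpan 𝒜 A)

/-- The edges of `A` that cross no active cut. -/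
def level (𝒜 : Finset (Finset V)) (A : Finset (Edge V)) : Finset (Edge V) :=
  A.filter fun e => crossing 𝒜 e = ∅

/-- The vector of a pair of vertices of the same level. -/
def pairVec (u v : V) : (V → ZMod 2) × (Finset V → ZMod 2) :=
  (Pi.single u 1 + Pi.single v 1, 0)

/-- The vector of a cut. -/
def cutVec (U : Finset V) : (V → ZMod 2) × (Finset V → ZMod 2) := (0, Pi.single U 1)

theorem mem_crossing {𝒜 : Finset (Finset V)} {e : Edge V} {U : Finset V} :
    U ∈ crossing 𝒜 e ↔ U ∈ 𝒜 ∧ e ∈ cut U := by simp [crossing]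

theorem crossing_eq_empty {𝒜 : Finset (Finset V)} {e : Edge V} :
    crossing 𝒜 e = ∅ ↔ ∀ U ∈ 𝒜, e ∉ cut U := by
  simp [crossing, Finset.filter_eq_empty_iff]

theorem mem_level {𝒜 : Finset (Finset V)} {A : Finset (Edge V)} {e : Edge V} :
    e ∈ level 𝒜 A ↔ e ∈ A ∧ ∀ U ∈ 𝒜, e ∉ cut U := by
  simp [level, crossing_eq_empty]

theorem level_empty (A : Finset (Edge V)) : level ∅ A = A := by
  ext e; simp [mem_level]

theorem chi_mkEdge (u v : V) (h : u ≠ v) : chi (mkEdge u v h) = Pi.single u 1 + Pi.single v 1 := by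
  ext w
  simp only [chi, mkEdge_mem_cut_singleton, Pi.add_apply, Pi.single_apply]
  by_cases h1 : w = u
  · subst h1; simp [h]
  · by_cases h2 : w = v
    · subst h2; simp [h1]
    · simp [h1, h2]

theorem levelVec_of_empty {𝒜 : Finset (Finset V)} {u v : V} {h : u ≠ v}
    (hc : crossing 𝒜 (mkEdge u v h) = ∅) : levelVec 𝒜 (mkEdge u v h) = pairVec u v := by
  simp [levelVec, hc, chi_mkEdge, pairVec]

theorem levelVec_of_singleton {𝒜 : Finset (Finset V)} {e : Edge V} {U : Finset V}
    (hc : crossing 𝒜 e = {U}) : levelVec 𝒜 e = cutVec U := by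
  simp only [levelVec, hc, cutVec, Finset.card_singleton, one_ne_zero, if_false, if_true]
  ext w
  · simp
  · simp [Pi.single_apply]

theorem levelVec_mem {𝒜 : Finset (Finset V)} {A : Finset (Edge V)} {e : Edge V} (he : e ∈ A) :
    levelVec 𝒜 e ∈ levelSpan 𝒜 A := Submodule.subset_span ⟨e, he, rfl⟩

theorem levelSpan_mono {𝒜 : Finset (Finset V)} {A B : Finset (Edge V)} (h : A ⊆ B) :
    levelSpan 𝒜 A ≤ levelSpan 𝒜 B :=
  Submodule.span_mono (Set.image_mono (by exact_mod_cast h))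

theorem levelSpan_union (𝒜 : Finset (Finset V)) (A B : Finset (Edge V)) :
    levelSpan 𝒜 (A ∪ B) = levelSpan 𝒜 A ⊔ levelSpan 𝒜 B := by
  rw [levelSpan, Finset.coe_union, Set.image_union, Submodule.span_union]; rfl

theorem levelRank_mono {𝒜 : Finset (Finset V)} {A B : Finset (Edge V)} (h : A ⊆ B) :
    levelRank 𝒜 A ≤ levelRank 𝒜 B := Submodule.finrank_mono (levelSpan_mono h)

theorem levelRank_submodular (𝒜 : Finset (Finset V)) (A B : Finset (Edge V)) :
    levelRank 𝒜 (A ∪ B) + levelRank 𝒜 (A ∩ B) ≤ levelRank 𝒜 A + levelRank 𝒜 B := by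
  have h1 := Submodule.finrank_sup_add_finrank_inf_eq (levelSpan 𝒜 A) (levelSpan 𝒜 B)
  have h2 : levelRank 𝒜 (A ∩ B) ≤ Module.finrank (ZMod 2) ↥(levelSpan 𝒜 A ⊓ levelSpan 𝒜 B) :=
    Submodule.finrank_mono (le_inf (levelSpan_mono Finset.inter_subset_left)
      (levelSpan_mono Finset.inter_subset_right))
  simp only [levelRank] at h2 ⊢
  rw [levelSpan_union]
  omega

/-- The vector `w` witnesses that the intersection of the two spans is larger than the span of the
common edges, which sharpens submodularity by one. -/
theorem levelRank_submodular_gain {𝒜 : Finset (Finset V)} {A B : Finset (Edge V)}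
    {w : (V → ZMod 2) × (Finset V → ZMod 2)} (hA : w ∈ levelSpan 𝒜 A) (hB : w ∈ levelSpan 𝒜 B)
    (hw : w ∉ levelSpan 𝒜 (A ∩ B)) :
    levelRank 𝒜 (A ∪ B) + levelRank 𝒜 (A ∩ B) + 1 ≤ levelRank 𝒜 A + levelRank 𝒜 B := by
  have h1 := Submodule.finrank_sup_add_finrank_inf_eq (levelSpan 𝒜 A) (levelSpan 𝒜 B)
  have h2 : levelRank 𝒜 (A ∩ B) < Module.finrank (ZMod 2) ↥(levelSpan 𝒜 A ⊓ levelSpan 𝒜 B) := by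
    refine Submodule.finrank_lt_finrank_of_lt (lt_of_le_of_ne
      (le_inf (levelSpan_mono Finset.inter_subset_left)
      (levelSpan_mono Finset.inter_subset_right)) ?_)
    intro h
    rw [h] at hw
    exact hw ⟨hA, hB⟩
  simp only [levelRank] at h2 ⊢
  rw [levelSpan_union]
  omega

theorem levelRank_add_one_le {𝒜 : Finset (Finset V)} {A B : Finset (Edge V)} (h : B ⊆ A)
    {w : (V → ZMod 2) × (Finset V → ZMod 2)} (hA : w ∈ levelSpan 𝒜 A) (hB : w ∉ levelSpan 𝒜 B) :
    levelRank 𝒜 B + 1 ≤ levelRank 𝒜 A :=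
  Submodule.finrank_lt_finrank_of_lt (lt_of_le_of_ne (levelSpan_mono h) fun h' => hB (h' ▸ hA))

theorem levelRank_add_two_le {𝒜 : Finset (Finset V)} {A B : Finset (Edge V)} (h : B ⊆ A)
    {w w' : (V → ZMod 2) × (Finset V → ZMod 2)} (hA : w ∈ levelSpan 𝒜 A)
    (hA' : w' ∈ levelSpan 𝒜 A) (hB : w ∉ levelSpan 𝒜 B)
    (hB' : w' ∉ levelSpan 𝒜 B ⊔ Submodule.span (ZMod 2) {w}) :
    levelRank 𝒜 B + 2 ≤ levelRank 𝒜 A := by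
  have h1 : levelSpan 𝒜 B < levelSpan 𝒜 B ⊔ Submodule.span (ZMod 2) {w} := by
    refine lt_of_le_of_ne le_sup_left fun h' => hB ?_
    rw [h']
    exact Submodule.mem_sup_right (Submodule.mem_span_singleton_self w)
  have h2 : levelSpan 𝒜 B ⊔ Submodule.span (ZMod 2) {w} < levelSpan 𝒜 A := by
    refine lt_of_le_of_ne (sup_le (levelSpan_mono h) ?_) fun h' => hB' ?_
    · rw [Submodule.span_singleton_le_iff_mem]; exact hA
    · rw [h']; exact hA'
  have h3 := Submodule.finrank_lt_finrank_of_lt h1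
  have h4 := Submodule.finrank_lt_finrank_of_lt h2
  simp only [levelRank]
  omega

theorem levelVec_congr {𝒜 ℬ : Finset (Finset V)} {e : Edge V}
    (h : crossing 𝒜 e = crossing ℬ e) : levelVec 𝒜 e = levelVec ℬ e := by
  simp only [levelVec, h]

theorem levelRank_congr {𝒜 ℬ : Finset (Finset V)} {A : Finset (Edge V)}
    (h : ∀ e ∈ A, crossing 𝒜 e = crossing ℬ e) : levelRank 𝒜 A = levelRank ℬ A := by
  have : levelSpan 𝒜 A = levelSpan ℬ A := by
    rw [levelSpan, levelSpan]
    congr 1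
    exact Set.image_congr fun e he => levelVec_congr (h e he)
  rw [levelRank, levelRank, this]

/-- The functional that sums up the entries of the vertices of `K`. -/
def vertexSum (K : Finset V) : (V → ZMod 2) × (Finset V → ZMod 2) →ₗ[ZMod 2] ZMod 2 :=
  (∑ v ∈ K, LinearMap.proj v) ∘ₗ LinearMap.fst (ZMod 2) _ _

theorem vertexSum_apply (K : Finset V) (w : (V → ZMod 2) × (Finset V → ZMod 2)) :
    vertexSum K w = ∑ v ∈ K, w.1 v := by
  simp [vertexSum]

theorem vertexSum_pairVec (K : Finset V) (u v : V) :
    vertexSum K (pairVec u v) = (if u ∈ K then 1 else 0) + if v ∈ K then 1 else 0 := by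
  rw [vertexSum_apply]
  simp [pairVec, Finset.sum_add_distrib, Finset.sum_pi_single']

/-- A level edge off `δ(K)` has both or no ends in `K`, and all other edges have zero vertex part.
So a nonzero value of this functional certifies that a vector lies outside the span. -/
theorem vertexSum_eq_zero {𝒜 : Finset (Finset V)} {A : Finset (Edge V)} {K : Finset V}
    (hK : ∀ e ∈ level 𝒜 A, e ∉ cut K) {w : (V → ZMod 2) × (Finset V → ZMod 2)}
    (hw : w ∈ levelSpan 𝒜 A) : vertexSum K w = 0 := by
  have : levelSpan 𝒜 A ≤ LinearMap.ker (vertexSum K) := by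
    rw [levelSpan, Submodule.span_le]
    rintro _ ⟨e, he, rfl⟩
    simp only [SetLike.mem_coe, LinearMap.mem_ker]
    by_cases h0 : crossing 𝒜 e = ∅
    · have h1 := hK e (Finset.mem_filter.2 ⟨he, h0⟩)
      obtain ⟨u, v, h, rfl⟩ := e.exists_rep
      rw [levelVec_of_empty h0, vertexSum_pairVec]
      rw [mkEdge_mem_cut] at h1
      by_cases h2 : u ∈ K <;> by_cases h3 : v ∈ K <;> simp [h2, h3] at h1 ⊢
      decide
    · have h1 : (levelVec 𝒜 e).1 = 0 := by
        have : (crossing 𝒜 e).card ≠ 0 := by simpa using h0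
        simp only [levelVec, this, if_false]
        split_ifs <;> rfl
      rw [vertexSum_apply, h1]; simp
  exact this hw

theorem pi_zmod_two_add_self {ι : Type*} (f : ι → ZMod 2) : f + f = 0 :=
  funext fun i => CharTwo.add_self_eq_zero (f i)

theorem pairVec_add (u v w : V) : pairVec u v + pairVec v w = pairVec u w := by
  simp only [pairVec, Prod.mk_add_mk, add_zero, Prod.mk.injEq, and_true]
  have : (Pi.single v 1 : V → ZMod 2) + Pi.single v 1 = 0 := pi_zmod_two_add_self _
  linear_combination this

theorem pairVec_self (u : V) : pairVec u u = 0 := by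
  simp only [pairVec, pi_zmod_two_add_self]; rfl

theorem Joined.pairVec_mem {𝒜 : Finset (Finset V)} {A : Finset (Edge V)} {u v : V}
    (h : Joined (level 𝒜 A) u v) : pairVec u v ∈ levelSpan 𝒜 A := by
  induction h with
  | refl => rw [pairVec_self]; exact zero_mem _
  | tail _ hbc ih =>
    obtain ⟨hne, hm⟩ := hbc
    rw [← pairVec_add]
    refine add_mem ih ?_
    rw [← levelVec_of_empty (𝒜 := 𝒜) (h := hne) (Finset.mem_filter.1 hm).2]
    exact levelVec_mem (Finset.mem_filter.1 hm).1

open Classical in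
theorem joined_of_pairVec_mem {𝒜 : Finset (Finset V)} {A : Finset (Edge V)} {u v : V}
    (h : pairVec u v ∈ levelSpan 𝒜 A) : Joined (level 𝒜 A) u v := by
  set K : Finset V := Finset.univ.filter fun w => Joined (level 𝒜 A) u w with hK
  have h1 := vertexSum_eq_zero (K := K) (by
    intro e he hcut
    obtain ⟨p, q, hpq, rfl⟩ := e.exists_rep
    simp only [mkEdge_mem_cut, hK, Finset.mem_filter, Finset.mem_univ, true_and] at hcut
    rcases hcut with ⟨h1, h2⟩ | ⟨h1, h2⟩
    · exact h2 (h1.trans (Joined.of_mem he))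
    · exact h2 (h1.trans (Joined.of_mem he).symm)) h
  rw [vertexSum_pairVec] at h1
  have hu : u ∈ K := by simp [hK, Joined.refl]
  by_contra hcon
  have hv : v ∉ K := by simpa [hK] using hcon
  simp [hu, hv] at h1

theorem cutVec_mem {𝒜 : Finset (Finset V)} {A : Finset (Edge V)} {U : Finset V} {e : Edge V}
    (he : e ∈ A) (hc : crossing 𝒜 e = {U}) : cutVec U ∈ levelSpan 𝒜 A := by
  rw [← levelVec_of_singleton hc]; exact levelVec_mem he

/-- The coordinate `U` vanishes on all vectors of `A` but not on `cutVec U`. -/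
theorem cutVec_notMem {𝒜 : Finset (Finset V)} {A : Finset (Edge V)} {U : Finset V}
    (h : ∀ e ∈ A, crossing 𝒜 e ≠ {U}) : cutVec U ∉ levelSpan 𝒜 A := by
  intro hmem
  have : levelSpan 𝒜 A ≤ LinearMap.ker (LinearMap.proj U ∘ₗ
      LinearMap.snd (ZMod 2) (V → ZMod 2) (Finset V → ZMod 2)) := by
    rw [levelSpan, Submodule.span_le]
    rintro _ ⟨e, he, rfl⟩
    simp only [SetLike.mem_coe, LinearMap.mem_ker, LinearMap.comp_apply, LinearMap.snd_apply,
      LinearMap.proj_apply]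
    unfold levelVec
    split_ifs with h0 h1
    · rfl
    · obtain ⟨W, hW⟩ := Finset.card_eq_one.1 h1
      simp only [hW, Finset.mem_singleton, ite_eq_right_iff, one_ne_zero, imp_false]
      rintro rfl
      exact h e he hW
    · rfl
  have h1 := this hmem
  simp [cutVec] at h1

theorem Joined.exists_crossing {A : Finset (Edge V)} {p q : V} (h : Joined A p q) {U : Finset V}
    (hp : p ∈ U) (hq : q ∉ U) :
    ∃ y ∈ U, ∃ y', y' ∉ U ∧ (∃ hne : y ≠ y', mkEdge y y' hne ∈ A) ∧ Joined A p y := by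
  induction h with
  | refl => exact absurd hp hq
  | @tail b c hpb hbc ih =>
    by_cases hb : b ∈ U
    · exact ⟨b, hb, c, hq, hbc, hpb⟩
    · exact ih hb

open Classical in
/-- The graphic rank bounds every point of the spanning tree polytope. -/
theorem vecSum_le_levelRank {x : Edge V → ℝ} (hx : ∀ e, 0 ≤ x e)
    (hin : ∀ W : Finset V, W.Nonempty → vecSum x (inner W) ≤ W.card - 1) (A : Finset (Edge V)) :
    vecSum x A ≤ levelRank ∅ A := by
  -- Sum the bound `|W| - 1` over the connected components `W` of `(V, A)`.
  let R : Setoid V := ⟨Joined A, Joined.refl A, Joined.symm, Joined.trans⟩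
  let cls : Quotient R → Finset V := fun q => Finset.univ.filter fun v => Quotient.mk R v = q
  have hcls : ∀ q, (cls q).Nonempty := by
    intro q
    induction q using Quotient.ind with
    | _ v => exact ⟨v, by simp [cls]⟩
  have h1 : vecSum x A ≤ ∑ q, vecSum x (inner (cls q)) := by
    simp only [vecSum]
    rw [← Finset.sum_biUnion]
    · refine Finset.sum_le_sum_of_subset_of_nonneg ?_ fun e _ _ => hx e
      intro e he
      obtain ⟨u, v, h, rfl⟩ := e.exists_rep
      simp only [Finset.mem_biUnion, Finset.mem_univ, true_and]
      refine ⟨Quotient.mk R u, mkEdge_mem_inner.2 ⟨by simp [cls], ?_⟩⟩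
      simp only [cls, Finset.mem_filter, Finset.mem_univ, true_and]
      exact Quotient.sound (Joined.of_mem he).symm
    · intro q _ q' _ hqq
      simp only [Function.onFun]
      rw [Finset.disjoint_left]
      intro e he he'
      obtain ⟨u, v, h, rfl⟩ := e.exists_rep
      have h2 := (mkEdge_mem_inner.1 he).1
      have h3 := (mkEdge_mem_inner.1 he').1
      simp only [cls, Finset.mem_filter, Finset.mem_univ, true_and] at h2 h3
      exact hqq (h2.symm.trans h3)
  have h2 : ∑ q, vecSum x (inner (cls q)) ≤ ∑ q, ((cls q).card - 1 : ℝ) :=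
    Finset.sum_le_sum fun q _ => hin _ (hcls q)
  have h3 : ∑ q, ((cls q).card : ℝ) = Fintype.card V := by
    rw [← Nat.cast_sum]
    congr 1
    rw [← Finset.card_univ (α := V)]
    exact (Finset.card_eq_sum_card_fiberwise fun v _ => Finset.mem_univ (Quotient.mk R v)).symm
  -- Modulo the span of `A` each unit vector equals that of the representative of its component, so
  -- the rank and the number of components together reach `|V|`.
  have h4 : Fintype.card V ≤ levelRank ∅ A + Fintype.card (Quotient R) := by
    set S := Submodule.map (LinearMap.fst (ZMod 2) (V → ZMod 2) (Finset V → ZMod 2))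
      (levelSpan ∅ A) with hS
    set Q := Submodule.span (ZMod 2)
      (Set.range fun q : Quotient R => (Pi.single q.out 1 : V → ZMod 2)) with hQ
    have htop : S ⊔ Q = ⊤ := by
      rw [eq_top_iff, ← (Pi.basisFun (ZMod 2) V).span_eq, Submodule.span_le]
      rintro _ ⟨v, rfl⟩
      simp only [Pi.basisFun_apply, SetLike.mem_coe]
      have hj : Joined A v (Quotient.mk R v).out := (Quotient.mk_out (s := R) v).symm
      rw [← level_empty A] at hj
      have h5 : (Pi.single v 1 + Pi.single (Quotient.mk R v).out 1 : V → ZMod 2) ∈ S :=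
        ⟨_, hj.pairVec_mem, rfl⟩
      have h6 : (Pi.single (Quotient.mk R v).out 1 : V → ZMod 2) ∈ Q :=
        Submodule.subset_span ⟨_, rfl⟩
      have h7 := add_mem (Submodule.mem_sup_left (T := Q) h5) (Submodule.mem_sup_right (S := S) h6)
      rwa [add_assoc, pi_zmod_two_add_self, add_zero] at h7
    have h5 := Submodule.finrank_add_le_finrank_add_finrank S Q
    rw [htop, finrank_top, Module.finrank_fintype_fun_eq_card] at h5
    have h6 : Module.finrank (ZMod 2) S ≤ levelRank ∅ A := Submodule.finrank_map_le _ _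
    have h7 : Module.finrank (ZMod 2) Q ≤ Fintype.card (Quotient R) := finrank_range_le_card _
    omega
  have h5 : (Fintype.card V : ℝ) ≤ levelRank ∅ A + Fintype.card (Quotient R) := by
    exact_mod_cast h4
  rw [Finset.sum_sub_distrib, h3] at h2
  simp only [Finset.sum_const, Finset.card_univ, nsmul_eq_mul, mul_one] at h2
  linarith

/-- The rank of a complete graph is at most the number of its vertices minus one. -/
theorem levelRank_inner_le {𝒜 : Finset (Finset V)}
    (hchain : ∀ U ∈ 𝒜, ∀ W ∈ 𝒜, U ⊆ W ∨ W ⊆ U) (n : ℕ) :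
    ∀ Λ : Finset V, Λ.card = n + 1 → levelRank 𝒜 (inner Λ) ≤ n := by
  -- The level number: how many active cuts leave the vertex outside.
  set ℓ : V → ℕ := fun v => (𝒜.filter fun U => v ∉ U).card with hℓ
  have hord : ∀ u v, ℓ u ≤ ℓ v → ∀ U ∈ 𝒜, v ∈ U → u ∈ U := by
    intro u v huv U hU hv
    by_contra hu
    have : (𝒜.filter fun U => v ∉ U) ⊂ (𝒜.filter fun U => u ∉ U) := by
      rw [Finset.ssubset_iff_of_subset]
      · exact ⟨U, by simp [hU, hu], by simp [hv]⟩
      · intro W hW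
        simp only [Finset.mem_filter] at hW ⊢
        refine ⟨hW.1, fun huW => ?_⟩
        rcases hchain U hU W hW.1 with h | h
        · exact hW.2 (h hv)
        · exact hu (h huW)
    have := Finset.card_lt_card this
    simp only [hℓ] at huv
    omega
  induction n with
  | zero =>
    intro Λ hΛ
    obtain ⟨v, rfl⟩ := Finset.card_eq_one.1 hΛ
    have : inner ({v} : Finset V) = ∅ := by
      ext e
      obtain ⟨p, q, h, rfl⟩ := e.exists_rep
      rw [mkEdge_mem_inner]
      simp only [Finset.mem_singleton, Finset.notMem_empty, iff_false]
      rintro ⟨rfl, rfl⟩; exact h rfl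
    rw [levelRank, levelSpan, this]
    simp
  | succ n ih =>
    intro Λ hΛ
    obtain ⟨v, hv, hvmax⟩ := Finset.exists_max_image Λ ℓ (Finset.card_pos.1 (by omega))
    have hc : (Λ.erase v).card = n + 1 := by rw [Finset.card_erase_of_mem hv]; omega
    -- With `v` outermost and `u` next to it, the cuts crossed by an edge `wv` are those of `wu`
    -- and, disjointly, those of `uv`. Hence adding the vertex `v` adds at most the vector of `uv`
    -- to the span.
    obtain ⟨u, hu, humax⟩ := Finset.exists_max_image (Λ.erase v) ℓ (Finset.card_pos.1 (by omega))
    have huv : u ≠ v := (Finset.mem_erase.1 hu).1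
    have hle : levelSpan 𝒜 (inner Λ) ≤ levelSpan 𝒜 (inner (Λ.erase v)) ⊔
        Submodule.span (ZMod 2) {levelVec 𝒜 (mkEdge u v huv)} := by
      set T := levelSpan 𝒜 (inner (Λ.erase v)) ⊔
        Submodule.span (ZMod 2) {levelVec 𝒜 (mkEdge u v huv)} with hT
      have huvT : levelVec 𝒜 (mkEdge u v huv) ∈ T :=
        Submodule.mem_sup_right (Submodule.mem_span_singleton_self _)
      have hinT : ∀ e ∈ inner (Λ.erase v), levelVec 𝒜 e ∈ T := fun e he =>
        Submodule.mem_sup_left (levelVec_mem he)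
      have key : ∀ w ∈ Λ.erase v, ∀ hwv : w ≠ v, levelVec 𝒜 (mkEdge w v hwv) ∈ T := by
        intro w hw hwv
        by_cases hwu : w = u
        · subst hwu; exact huvT
        have hwuT := hinT (mkEdge w u hwu) (mkEdge_mem_inner.2 ⟨hw, hu⟩)
        have o1 := hord w u (humax w hw)
        have o2 := hord u v (hvmax u (Finset.mem_of_mem_erase hu))
        have hunion : crossing 𝒜 (mkEdge w v hwv) =
            crossing 𝒜 (mkEdge w u hwu) ∪ crossing 𝒜 (mkEdge u v huv) := by
          ext U
          simp only [Finset.mem_union, mem_crossing, mkEdge_mem_cut]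
          have := o1 U; have := o2 U
          tauto
        have hdisj : Disjoint (crossing 𝒜 (mkEdge w u hwu)) (crossing 𝒜 (mkEdge u v huv)) := by
          rw [Finset.disjoint_left]
          intro U
          simp only [mem_crossing, mkEdge_mem_cut]
          have := o1 U; have := o2 U
          tauto
        have hcard := congrArg Finset.card hunion
        rw [Finset.card_union_of_disjoint hdisj] at hcard
        rcases Nat.eq_zero_or_pos (crossing 𝒜 (mkEdge w u hwu)).card with h0 | h0
        · rw [Finset.card_eq_zero] at h0
          rw [h0, Finset.empty_union] at hunion
          by_cases h1 : crossing 𝒜 (mkEdge u v huv) = ∅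
          · rw [levelVec_of_empty (hunion.trans h1), ← pairVec_add w u v]
            rw [levelVec_of_empty h0] at hwuT
            rw [levelVec_of_empty h1] at huvT
            exact add_mem hwuT huvT
          · have h2 : (crossing 𝒜 (mkEdge u v huv)).card ≠ 0 := by simpa using h1
            have : levelVec 𝒜 (mkEdge w v hwv) = levelVec 𝒜 (mkEdge u v huv) := by
              simp only [levelVec, hunion, h2, if_false]
            rw [this]; exact huvT
        · rcases Nat.eq_zero_or_pos (crossing 𝒜 (mkEdge u v huv)).card with h1 | h1
          · have h1' := Finset.card_eq_zero.1 h1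
            rw [h1', Finset.union_empty] at hunion
            have h2 : (crossing 𝒜 (mkEdge w u hwu)).card ≠ 0 := h0.ne'
            have : levelVec 𝒜 (mkEdge w v hwv) = levelVec 𝒜 (mkEdge w u hwu) := by
              simp only [levelVec, hunion, h2, if_false]
            rw [this]; exact hwuT
          -- Both parts cross a cut, so `wv` crosses at least two and its vector is zero.
          · have h2 : (crossing 𝒜 (mkEdge w v hwv)).card ≠ 0 := by omega
            have h3 : (crossing 𝒜 (mkEdge w v hwv)).card ≠ 1 := by omega
            simp only [levelVec, h2, h3, if_false]
            exact zero_mem _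
      rw [levelSpan, Submodule.span_le]
      rintro _ ⟨e, he, rfl⟩
      obtain ⟨p, q, hpq, rfl⟩ := e.exists_rep
      obtain ⟨hp, hq⟩ := mkEdge_mem_inner.1 he
      by_cases hpv : p = v
      · subst hpv
        rw [mkEdge_comm]
        exact key q (Finset.mem_erase.2 ⟨hpq.symm, hq⟩) _
      · by_cases hqv : q = v
        · subst hqv
          exact key p (Finset.mem_erase.2 ⟨hpq, hp⟩) _
        · exact hinT _ (mkEdge_mem_inner.2
            ⟨Finset.mem_erase.2 ⟨hpv, hp⟩, Finset.mem_erase.2 ⟨hqv, hq⟩⟩)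
    have h1 := Submodule.finrank_mono hle
    have h2 := Submodule.finrank_add_le_finrank_add_finrank (levelSpan 𝒜 (inner (Λ.erase v)))
      (Submodule.span (ZMod 2) {levelVec 𝒜 (mkEdge u v huv)})
    have h3 := finrank_span_le_card (R := ZMod 2)
      ({levelVec 𝒜 (mkEdge u v huv)} : Set ((V → ZMod 2) × (Finset V → ZMod 2)))
    have h4 := ih _ hc
    simp only [Set.toFinset_singleton, Finset.card_singleton] at h3
    simp only [levelRank] at h4 ⊢
    omega

end Rank

end PathTSP

namespace PathTSP

/-! ### The averaged rank and the structure of a minimal violator -/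

section Polymatroid

variable {V : Type*} [Fintype V] [DecidableEq V]

/-- The vertices in the same level as `u`. -/
def levelOf (𝒜 : Finset (Finset V)) (u : V) : Finset V :=
  Finset.univ.filter fun v => ∀ U ∈ 𝒜, v ∈ U ↔ u ∈ U

theorem mem_levelOf {𝒜 : Finset (Finset V)} {u v : V} :
    v ∈ levelOf 𝒜 u ↔ ∀ U ∈ 𝒜, v ∈ U ↔ u ∈ U := by simp [levelOf]

/-- In a chain the level of `u` lies between the largest member missing `u` and the smallest one
containing it, with `∅` and `V` as defaults. -/
theorem exists_levelOf_eq_sdiff {𝒜 : Finset (Finset V)}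
    (hchain : ∀ U ∈ 𝒜, ∀ W ∈ 𝒜, U ⊆ W ∨ W ⊆ U) (u : V) :
    ∃ a b : Finset V, (a = ∅ ∨ a ∈ 𝒜) ∧ (b = Finset.univ ∨ b ∈ 𝒜) ∧ a ⊆ b ∧
      levelOf 𝒜 u = b \ a := by
  obtain ⟨a, ha, hua, hamax⟩ : ∃ a : Finset V, (a = ∅ ∨ a ∈ 𝒜) ∧ u ∉ a ∧
      ∀ U ∈ 𝒜, u ∉ U → U ⊆ a := by
    by_cases hne : (𝒜.filter fun U => u ∉ U).Nonempty
    · obtain ⟨a, ha, hmax⟩ := Finset.exists_max_image _ Finset.card hne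
      rw [Finset.mem_filter] at ha
      refine ⟨a, Or.inr ha.1, ha.2, fun U hU hu => ?_⟩
      rcases hchain U hU a ha.1 with h | h
      · exact h
      · rw [Finset.eq_of_subset_of_card_le h (hmax U (Finset.mem_filter.2 ⟨hU, hu⟩))]
    · refine ⟨∅, Or.inl rfl, by simp, fun U hU hu => ?_⟩
      exact absurd ⟨U, Finset.mem_filter.2 ⟨hU, hu⟩⟩ hne
  obtain ⟨b, hb, hub, hbmin⟩ : ∃ b : Finset V, (b = Finset.univ ∨ b ∈ 𝒜) ∧ u ∈ b ∧
      ∀ U ∈ 𝒜, u ∈ U → b ⊆ U := by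
    by_cases hne : (𝒜.filter fun U => u ∈ U).Nonempty
    · obtain ⟨b, hb, hmin⟩ := Finset.exists_min_image _ Finset.card hne
      rw [Finset.mem_filter] at hb
      refine ⟨b, Or.inr hb.1, hb.2, fun U hU hu => ?_⟩
      rcases hchain b hb.1 U hU with h | h
      · exact h
      · rw [Finset.eq_of_subset_of_card_le h (hmin U (Finset.mem_filter.2 ⟨hU, hu⟩))]
    · refine ⟨Finset.univ, Or.inl rfl, by simp, fun U hU hu => ?_⟩
      exact absurd ⟨U, Finset.mem_filter.2 ⟨hU, hu⟩⟩ hne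
  refine ⟨a, b, ha, hb, ?_, ?_⟩
  · rcases ha with rfl | ha
    · simp
    · rcases hb with rfl | hb
      · simp
      · rcases hchain a ha b hb with h | h
        · exact h
        · exact absurd (h hub) hua
  · ext v
    rw [mem_levelOf, Finset.mem_sdiff]
    constructor
    · intro h
      constructor
      · rcases hb with rfl | hb
        · simp
        · exact (h b hb).2 hub
      · rcases ha with rfl | ha
        · simp
        · exact fun hv => hua ((h a ha).1 hv)
    · rintro ⟨h1, h2⟩ U hU
      exact ⟨fun hv => by_contra fun hu => h2 (hamax U hU hu hv), fun hu => hbmin U hU hu h1⟩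

/-- Weights on thresholds such that the weights beyond a deficiency `y` sum up to `1 - y`. -/
structure LevelWeights (s t : V) (x : Edge V → ℝ) where
  support : Finset ℝ
  weight : ℝ → ℝ
  pos : ∀ θ ∈ support, 0 < θ
  nonneg : ∀ θ ∈ support, 0 ≤ weight θ
  tail : ∀ y, (y = 0 ∨ ∃ U ∈ narrowCuts s t x, y = deficiency x U) →
    ∑ θ ∈ support.filter (fun θ => y < θ), weight θ = 1 - y

open Classical in
/-- The cuts that are active at the threshold `θ`. -/
noncomputable def activeCuts (x : Edge V → ℝ) (𝒞 : Finset (Finset V)) (θ : ℝ) :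
    Finset (Finset V) := 𝒞.filter fun U => θ ≤ deficiency x U

theorem mem_activeCuts {x : Edge V → ℝ} {𝒞 : Finset (Finset V)} {θ : ℝ} {U : Finset V} :
    U ∈ activeCuts x 𝒞 θ ↔ U ∈ 𝒞 ∧ θ ≤ deficiency x U := by simp [activeCuts]

variable {s t : V} {x : Edge V → ℝ}

/-- The weighted average of the ranks of an edge set over all thresholds. -/
noncomputable def LevelWeights.rank (W : LevelWeights s t x) (𝒞 : Finset (Finset V))
    (A : Finset (Edge V)) : ℝ :=
  ∑ θ ∈ W.support, W.weight θ * levelRank (activeCuts x 𝒞 θ) A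

/-- The thresholds beyond `y` have total weight `1 - y`, so a gain of one at each of them amounts to
`1 - y` on average. -/
theorem LevelWeights.sum_add_tail_le (W : LevelWeights s t x) {a b : ℝ → ℝ} {y : ℝ}
    (hy : y = 0 ∨ ∃ U ∈ narrowCuts s t x, y = deficiency x U)
    (h : ∀ θ ∈ W.support, a θ + (if y < θ then 1 else 0) ≤ b θ) :
    ∑ θ ∈ W.support, W.weight θ * a θ + (1 - y) ≤ ∑ θ ∈ W.support, W.weight θ * b θ := by
  rw [← W.tail y hy, Finset.sum_filter, ← Finset.sum_add_distrib]
  refine Finset.sum_le_sum fun θ hθ => ?_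
  have := mul_le_mul_of_nonneg_left (h θ hθ) (W.nonneg θ hθ)
  calc W.weight θ * a θ + (if y < θ then W.weight θ else 0)
      = W.weight θ * (a θ + if y < θ then 1 else 0) := by split_ifs <;> ring
    _ ≤ _ := this

theorem LevelWeights.sum_weight (W : LevelWeights s t x) : ∑ θ ∈ W.support, W.weight θ = 1 := by
  have := W.tail 0 (Or.inl rfl)
  rw [Finset.filter_true_of_mem W.pos] at this
  linarith

/-- An inclusionwise maximal edge set violating the rank inequality, for a minimal set of cuts. -/
structure Violator (W : LevelWeights s t x) (𝒞 : Finset (Finset V)) (A : Finset (Edge V)) :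
    Prop where
  feasible : IsFeasible s t x
  ne : s ≠ t
  narrow : 𝒞 ⊆ narrowCuts s t x
  rank_lt : W.rank 𝒞 A < vecSum x A
  crosses : ∀ U ∈ 𝒞, (A ∩ cut U).Nonempty
  le_of_not_cross : ∀ B, (∃ U ∈ 𝒞, B ∩ cut U = ∅) → vecSum x B ≤ W.rank 𝒞 B
  maximal : ∀ B, A ⊆ B → A ≠ B → vecSum x B ≤ W.rank 𝒞 B

namespace Violator

variable {W : LevelWeights s t x} {𝒞 : Finset (Finset V)} {A : Finset (Edge V)}

theorem chain (h : Violator W 𝒞 A) : ∀ U ∈ 𝒞, ∀ U' ∈ 𝒞, U ⊆ U' ∨ U' ⊆ U :=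
  fun _ hU _ hU' => h.feasible.narrow_chain (h.narrow hU) (h.narrow hU')

/-- Uncross `A` with the complete graph `B` on a level `Λ`. Its averaged rank is at most `|Λ| - 1`,
and `x(B) ≥ |Λ| - 2 + ψ` because the bounding cuts have deficiency at least `ψ`. A gain at all `θ >
ψ` improves averaged submodularity by `1 - ψ`, just enough to compensate. So the violation at `A`
passes on to `A ∪ B`, which is strictly larger, or to `A ∩ B`, which misses a cut; both are
excluded. -/
theorem no_gain (h : Violator W 𝒞 A) {𝒜 : Finset (Finset V)} (h𝒜 : 𝒜 ⊆ 𝒞) (hne : 𝒜.Nonempty)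
    {ψ : ℝ} (hψ : ψ = 0 ∨ ∃ U ∈ narrowCuts s t x, ψ = deficiency x U)
    (hψ' : ∀ U ∈ 𝒜, ψ ≤ deficiency x U) (u : V) {e : Edge V} (he : e ∈ inner (levelOf 𝒜 u))
    (heA : e ∉ A)
    (hgain : ∀ θ ∈ W.support, ψ < θ → ∃ w ∈ levelSpan (activeCuts x 𝒞 θ) A,
      w ∈ levelSpan (activeCuts x 𝒞 θ) (inner (levelOf 𝒜 u)) ∧
      w ∉ levelSpan (activeCuts x 𝒞 θ) (A ∩ inner (levelOf 𝒜 u))) : False := by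
  set B := inner (levelOf 𝒜 u) with hB
  obtain ⟨U₀, hU₀⟩ := hne
  have hψ1 : ψ ≤ 1 := (hψ' U₀ hU₀).trans (h.feasible.deficiency_le_one (h.narrow (h𝒜 hU₀)))
  obtain ⟨a, b, ha, hb, hab, hΛ⟩ := exists_levelOf_eq_sdiff (𝒜 := 𝒜)
    (fun U hU U' hU' => h.chain U (h𝒜 hU) U' (h𝒜 hU')) u
  have hza : ψ ≤ deficiency x a := by
    rcases ha with rfl | ha
    · rwa [deficiency_empty]
    · exact hψ' a ha
  have hzb : ψ ≤ deficiency x b := by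
    rcases hb with rfl | hb
    · rwa [deficiency_univ]
    · exact hψ' b hb
  have hslack := h.feasible.le_inner_sdiff h.ne (ha.imp_right fun h' => h.narrow (h𝒜 h'))
    (hb.imp_right fun h' => h.narrow (h𝒜 h')) hab
  rw [← hΛ] at hslack
  have hu : u ∈ levelOf 𝒜 u := mem_levelOf.2 fun _ _ => Iff.rfl
  have hcard : 0 < (levelOf 𝒜 u).card := Finset.card_pos.2 ⟨u, hu⟩
  have hrB : W.rank 𝒞 B ≤ (levelOf 𝒜 u).card - 1 := by
    have h1 : ∀ θ ∈ W.support, W.weight θ * levelRank (activeCuts x 𝒞 θ) B ≤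
        W.weight θ * ((levelOf 𝒜 u).card - 1) := by
      intro θ hθ
      refine mul_le_mul_of_nonneg_left ?_ (W.nonneg θ hθ)
      have h2 := levelRank_inner_le (𝒜 := activeCuts x 𝒞 θ)
        (fun U hU U' hU' => h.chain U (mem_activeCuts.1 hU).1 U' (mem_activeCuts.1 hU').1)
        ((levelOf 𝒜 u).card - 1) (levelOf 𝒜 u) (by omega)
      have h3 : ((levelRank (activeCuts x 𝒞 θ) B : ℕ) : ℝ) ≤ ((levelOf 𝒜 u).card - 1 : ℕ) := by
        exact_mod_cast h2
      rwa [Nat.cast_sub hcard, Nat.cast_one] at h3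
    refine (Finset.sum_le_sum h1).trans ?_
    rw [← Finset.sum_mul, W.sum_weight, one_mul]
  have hsub : W.rank 𝒞 (A ∪ B) + W.rank 𝒞 (A ∩ B) + (1 - ψ) ≤ W.rank 𝒞 A + W.rank 𝒞 B := by
    have := W.sum_add_tail_le hψ
      (a := fun θ => levelRank (activeCuts x 𝒞 θ) (A ∪ B) + levelRank (activeCuts x 𝒞 θ) (A ∩ B))
      (b := fun θ => levelRank (activeCuts x 𝒞 θ) A + levelRank (activeCuts x 𝒞 θ) B) (by
        intro θ hθ
        split_ifs with hlt
        · obtain ⟨w, hw1, hw2, hw3⟩ := hgain θ hθ hlt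
          exact_mod_cast levelRank_submodular_gain hw1 hw2 hw3
        · rw [add_zero]
          exact_mod_cast levelRank_submodular _ A B)
    simp only [mul_add, Finset.sum_add_distrib] at this
    exact this
  have hmod : vecSum x (A ∪ B) + vecSum x (A ∩ B) = vecSum x A + vecSum x B :=
    Finset.sum_union_inter
  have hint : vecSum x (A ∩ B) ≤ W.rank 𝒞 (A ∩ B) := by
    refine h.le_of_not_cross _ ⟨U₀, h𝒜 hU₀, ?_⟩
    rw [Finset.eq_empty_iff_forall_notMem]
    intro f hf
    obtain ⟨hf1, hf2⟩ := Finset.mem_inter.1 hf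
    obtain ⟨p, q, hpq, rfl⟩ := f.exists_rep
    obtain ⟨hp, hq⟩ := mkEdge_mem_inner.1 (Finset.mem_inter.1 hf1).2
    rw [mem_levelOf] at hp hq
    have hp' := hp U₀ hU₀
    have hq' := hq U₀ hU₀
    rw [mkEdge_mem_cut] at hf2
    tauto
  have hmax := h.maximal (A ∪ B) Finset.subset_union_left (fun heq => heA (by
    rw [heq]; exact Finset.mem_union_right _ he))
  have := h.rank_lt
  linarith

theorem mem_level_of_inner {𝒜 : Finset (Finset V)} {u : V} {f : Edge V}
    (hf : f ∈ inner (levelOf 𝒜 u)) : ∀ U ∈ 𝒜, f ∉ cut U := by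
  intro U hU hcut
  obtain ⟨p, q, hpq, rfl⟩ := f.exists_rep
  obtain ⟨hp, hq⟩ := mkEdge_mem_inner.1 hf
  have hp' := mem_levelOf.1 hp U hU
  have hq' := mem_levelOf.1 hq U hU
  rw [mkEdge_mem_cut] at hcut
  tauto

/-- Vertices of the same level that are joined by `A` are joined inside the level. -/
theorem joined_level (h : Violator W 𝒞 A) {u v : V} (huv : Joined A u v) (θ : ℝ)
    (hlev : ∀ U ∈ activeCuts x 𝒞 θ, v ∈ U ↔ u ∈ U) :
    Joined (level (activeCuts x 𝒞 θ) A) u v := by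
  classical
  -- it suffices to consider the deficiencies as thresholds
  have key : ∀ U₁ ∈ 𝒞, (∀ U ∈ activeCuts x 𝒞 (deficiency x U₁), v ∈ U ↔ u ∈ U) →
      Joined (level (activeCuts x 𝒞 (deficiency x U₁)) A) u v := by
    by_contra! hcon
    obtain ⟨U₁, hU₁, hlev₁, hbad₁⟩ := hcon
    -- Take the largest deficiency `η` at which the claim fails. Above `η` the set `A` joins `u` and
    -- `v` inside their level, but the edges of `A` within the level at `η` do not. So `pairVec u v`
    -- is a gain at every threshold above `η`.
    obtain ⟨U₀, hU₀, hmax⟩ := Finset.exists_max_image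
      (𝒞.filter fun U₁ => (∀ U ∈ activeCuts x 𝒞 (deficiency x U₁), v ∈ U ↔ u ∈ U) ∧
        ¬ Joined (level (activeCuts x 𝒞 (deficiency x U₁)) A) u v) (deficiency x)
      ⟨U₁, Finset.mem_filter.2 ⟨hU₁, hlev₁, hbad₁⟩⟩
    obtain ⟨hU₀C, hlev₀, hbad₀⟩ := Finset.mem_filter.1 hU₀
    set η := deficiency x U₀ with hη
    have hne : u ≠ v := fun h' => hbad₀ (h' ▸ Joined.refl _ _)
    have hcr : ∀ U ∈ activeCuts x 𝒞 η, mkEdge u v hne ∉ cut U := by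
      intro U hU hcut
      have := hlev₀ U hU
      rw [mkEdge_mem_cut] at hcut
      tauto
    have hinner : mkEdge u v hne ∈ inner (levelOf (activeCuts x 𝒞 η) u) :=
      mkEdge_mem_inner.2 ⟨mem_levelOf.2 fun _ _ => Iff.rfl, mem_levelOf.2 hlev₀⟩
    refine h.no_gain (𝒜 := activeCuts x 𝒞 η) (fun U hU => (mem_activeCuts.1 hU).1)
      ⟨U₀, mem_activeCuts.2 ⟨hU₀C, le_rfl⟩⟩ (ψ := η) (Or.inr ⟨U₀, h.narrow hU₀C, rfl⟩)
      (fun U hU => (mem_activeCuts.1 hU).2) u hinner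
      (fun hA => hbad₀ (Joined.of_mem (h := hne) (mem_level.2 ⟨hA, hcr⟩))) ?_
    intro θ' _ hlt
    have hsub : activeCuts x 𝒞 θ' ⊆ activeCuts x 𝒞 η := fun U hU =>
      mem_activeCuts.2 ⟨(mem_activeCuts.1 hU).1, hlt.le.trans (mem_activeCuts.1 hU).2⟩
    refine ⟨pairVec u v, ?_, ?_, ?_⟩
    -- The active set depends only on the smallest deficiency at or above the threshold, so
    -- maximality applies to that one. If no cut is active, being joined by `A` is enough.
    · by_cases hemp : (activeCuts x 𝒞 θ').Nonempty
      · obtain ⟨U₂, hU₂, hmin⟩ := Finset.exists_min_image _ (deficiency x) hemp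
        have heq : activeCuts x 𝒞 θ' = activeCuts x 𝒞 (deficiency x U₂) := by
          ext U
          constructor
          · intro hU
            exact mem_activeCuts.2 ⟨(mem_activeCuts.1 hU).1, hmin U hU⟩
          · intro hU
            exact mem_activeCuts.2 ⟨(mem_activeCuts.1 hU).1,
              (mem_activeCuts.1 hU₂).2.trans (mem_activeCuts.1 hU).2⟩
        refine Joined.pairVec_mem ?_
        by_contra hbad
        rw [heq] at hbad
        have := hmax U₂ (Finset.mem_filter.2 ⟨(mem_activeCuts.1 hU₂).1,
          fun U hU => hlev₀ U (hsub (heq ▸ hU)), hbad⟩)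
        have h2 := (mem_activeCuts.1 hU₂).2
        linarith
      · rw [Finset.not_nonempty_iff_eq_empty] at hemp
        rw [hemp]
        exact Joined.pairVec_mem (by rwa [level_empty])
    · rw [← levelVec_of_empty (𝒜 := activeCuts x 𝒞 θ') (h := hne)
        (crossing_eq_empty.2 fun U hU => hcr U (hsub hU))]
      exact levelVec_mem hinner
    · intro hmem
      refine hbad₀ ((joined_of_pairVec_mem hmem).mono ?_)
      intro f hf
      obtain ⟨hfA, hfB⟩ := Finset.mem_inter.1 (mem_level.1 hf).1
      exact mem_level.2 ⟨hfA, mem_level_of_inner hfB⟩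
  by_cases hemp : (activeCuts x 𝒞 θ).Nonempty
  · obtain ⟨U₂, hU₂, hmin⟩ := Finset.exists_min_image _ (deficiency x) hemp
    have heq : activeCuts x 𝒞 θ = activeCuts x 𝒞 (deficiency x U₂) := by
      ext U
      constructor
      · intro hU
        exact mem_activeCuts.2 ⟨(mem_activeCuts.1 hU).1, hmin U hU⟩
      · intro hU
        exact mem_activeCuts.2 ⟨(mem_activeCuts.1 hU).1,
          (mem_activeCuts.1 hU₂).2.trans (mem_activeCuts.1 hU).2⟩
    rw [heq] at hlev ⊢
    exact key U₂ (mem_activeCuts.1 hU₂).1 hlev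
  · rw [Finset.not_nonempty_iff_eq_empty] at hemp
    rwa [hemp, level_empty]

/-- The threshold `ψ` above which some edge of `A` crosses only the cut `j`. -/
theorem exists_threshold (h : Violator W 𝒞 A) {j : Finset V} (hj : j ∈ 𝒞) :
    ∃ ψ : ℝ, (ψ = 0 ∨ ∃ U ∈ narrowCuts s t x, ψ = deficiency x U) ∧ ψ ≤ deficiency x j ∧
      (∀ θ, ψ < θ → θ ≤ deficiency x j → ∃ e ∈ A, crossing (activeCuts x 𝒞 θ) e = {j}) ∧
      ((ψ = 0 ∧ ∃ e ∈ A, crossing 𝒞 e = {j}) ∨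
        (0 < ψ ∧ ∀ e ∈ A ∩ cut j, ∃ i ∈ 𝒞, i ≠ j ∧ e ∈ cut i ∧ ψ ≤ deficiency x i)) := by
  classical
  by_cases hgap : ∃ e ∈ A, crossing 𝒞 e = {j}
  · refine ⟨0, Or.inl rfl, (deficiency_pos (h.narrow hj)).le, ?_, Or.inl ⟨rfl, hgap⟩⟩
    obtain ⟨e, he, hc⟩ := hgap
    intro θ _ hθ
    refine ⟨e, he, ?_⟩
    ext U
    rw [mem_crossing, mem_activeCuts, Finset.mem_singleton]
    constructor
    · rintro ⟨⟨h1, -⟩, h2⟩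
      have : U ∈ crossing 𝒞 e := mem_crossing.2 ⟨h1, h2⟩
      rwa [hc, Finset.mem_singleton] at this
    · rintro rfl
      have : U ∈ crossing 𝒞 e := by rw [hc]; simp
      exact ⟨⟨hj, hθ⟩, (mem_crossing.1 this).2⟩
  · push Not at hgap
    have hother : ∀ e ∈ A ∩ cut j, ∃ i ∈ (crossing 𝒞 e).erase j,
        ∀ i' ∈ (crossing 𝒞 e).erase j, deficiency x i' ≤ deficiency x i := by
      intro e he
      obtain ⟨he1, he2⟩ := Finset.mem_inter.1 he
      refine Finset.exists_max_image _ (deficiency x) ?_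
      rw [Finset.nonempty_iff_ne_empty]
      intro hemp
      refine hgap e he1 ?_
      have hmem : j ∈ crossing 𝒞 e := mem_crossing.2 ⟨hj, he2⟩
      rw [← Finset.insert_erase hmem, hemp]; rfl
    -- Among the cuts other than `j` crossed by `e`, `φ e` has largest deficiency; once the
    -- threshold exceeds it, `e` crosses no other active cut. The edge `e₀` reaches this earliest.
    -- Capping by the deficiency of `j` keeps `ψ` in range.
    choose! φ hφ1 hφ2 using hother
    obtain ⟨e₀, he₀, hmin⟩ := Finset.exists_min_image (A ∩ cut j) (fun e => deficiency x (φ e))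
      (h.crosses j hj)
    have hφ : ∀ e ∈ A ∩ cut j, φ e ∈ 𝒞 ∧ φ e ≠ j ∧ e ∈ cut (φ e) := by
      intro e he
      have h1 := Finset.mem_erase.1 (hφ1 e he)
      exact ⟨(mem_crossing.1 h1.2).1, h1.1, (mem_crossing.1 h1.2).2⟩
    refine ⟨min (deficiency x (φ e₀)) (deficiency x j), Or.inr ?_, min_le_right _ _, ?_,
      Or.inr ⟨lt_min (deficiency_pos (h.narrow (hφ e₀ he₀).1)) (deficiency_pos (h.narrow hj)), ?_⟩⟩
    · rcases min_choice (deficiency x (φ e₀)) (deficiency x j) with h1 | h1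
      · exact ⟨_, h.narrow (hφ e₀ he₀).1, h1⟩
      · exact ⟨_, h.narrow hj, h1⟩
    · intro θ h1 h2
      refine ⟨e₀, (Finset.mem_inter.1 he₀).1, ?_⟩
      have h3 : deficiency x (φ e₀) < θ := by
        rcases min_lt_iff.1 h1 with h3 | h3
        · exact h3
        · linarith
      ext U
      rw [mem_crossing, mem_activeCuts, Finset.mem_singleton]
      constructor
      · rintro ⟨⟨h4, h5⟩, h6⟩
        by_contra hUj
        have := hφ2 e₀ he₀ U (Finset.mem_erase.2 ⟨hUj, mem_crossing.2 ⟨h4, h6⟩⟩)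
        linarith
      · rintro rfl
        exact ⟨⟨hj, h2⟩, (Finset.mem_inter.1 he₀).2⟩
    · intro e he
      obtain ⟨h1, h2, h3⟩ := hφ e he
      exact ⟨φ e, h1, h2, h3, (min_le_left _ _).trans (hmin e he)⟩

/-- A representative of an edge of the cut `δ(j)` starting inside `j`. -/
theorem exists_rep_of_mem_cut {j : Finset V} {e : Edge V} (he : e ∈ cut j) :
    ∃ p ∈ j, ∃ q, q ∉ j ∧ ∃ hpq : p ≠ q, e = mkEdge p q hpq := by
  obtain ⟨p, q, hpq, rfl⟩ := e.exists_rep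
  rcases mkEdge_mem_cut.1 he with ⟨h1, h2⟩ | ⟨h1, h2⟩
  · exact ⟨p, h1, q, h2, hpq, rfl⟩
  · exact ⟨q, h1, p, h2, hpq.symm, mkEdge_comm _ _ _⟩

/-- Every edge of `A` in `δ(j)` crosses a second cut of deficiency at least `ψ`. If one such cut
meets them all, `IsFeasible.cut_inter_le` gives the first bound. Otherwise the nearest such cuts `a`
below and `b` above `j` cover these edges jointly, and the two intersections add up to the second
bound. An edge missing `δ(a)` and one missing `δ(b)` then supply `u` in `j \ a` and `v` in `b \ j`,
which only `j` separates. -/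
theorem gap_cases (h : Violator W 𝒞 A) {j : Finset V} (hj : j ∈ 𝒞) {ψ : ℝ}
    (hψj : ψ ≤ deficiency x j)
    (hψ : ∀ e ∈ A ∩ cut j, ∃ i ∈ 𝒞, i ≠ j ∧ e ∈ cut i ∧ ψ ≤ deficiency x i) :
    vecSum x (A ∩ cut j) ≤ 1 - ψ ∨
      vecSum x (A ∩ cut j) ≤ 2 - deficiency x j - ψ ∧
      ∃ u ∈ j, ∃ v, v ∉ j ∧
        (∃ q, q ∉ j ∧ ∃ hq : u ≠ q, mkEdge u q hq ∈ A) ∧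
        (∃ p ∈ j, ∃ hp : p ≠ v, mkEdge p v hp ∈ A) ∧
        ∀ U ∈ (activeCuts x 𝒞 ψ).erase j, v ∈ U ↔ u ∈ U := by
  classical
  have hbound : ∀ i ∈ (activeCuts x 𝒞 ψ).erase j,
      vecSum x (cut j ∩ cut i) ≤ 1 - (deficiency x j + ψ) / 2 := by
    intro i hi
    obtain ⟨h1, h2⟩ := Finset.mem_erase.1 hi
    have h3 := h.feasible.cut_inter_le (h.narrow hj) (h.narrow (mem_activeCuts.1 h2).1) h1.symm
    linarith [(mem_activeCuts.1 h2).2]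
  by_cases hone : ∃ i ∈ (activeCuts x 𝒞 ψ).erase j, A ∩ cut j ⊆ cut i
  · obtain ⟨i, hi, hsub⟩ := hone
    left
    have h1 : vecSum x (A ∩ cut j) ≤ vecSum x (cut j ∩ cut i) :=
      vecSum_mono h.feasible.nonneg (Finset.subset_inter Finset.inter_subset_right hsub)
    linarith [hbound i hi]
  right
  push Not at hone
  set 𝒜 := (activeCuts x 𝒞 ψ).erase j with h𝒜
  have hmem𝒜 : ∀ i ∈ 𝒜, i ∈ 𝒞 ∧ i ≠ j := fun i hi =>
    ⟨(mem_activeCuts.1 (Finset.mem_erase.1 hi).2).1, (Finset.mem_erase.1 hi).1⟩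
  have hcov : ∀ e ∈ A ∩ cut j, ∃ i ∈ 𝒜, e ∈ cut i := by
    intro e he
    obtain ⟨i, hi, hij, hei, hψi⟩ := hψ e he
    exact ⟨i, Finset.mem_erase.2 ⟨hij, mem_activeCuts.2 ⟨hi, hψi⟩⟩, hei⟩
  -- the nearest cut below `j`
  have hlow : (𝒜.filter fun i => i ⊆ j).Nonempty := by
    by_contra hemp
    rw [Finset.not_nonempty_iff_eq_empty, Finset.filter_eq_empty_iff] at hemp
    -- If no candidate cut lay below `j`, the lowest one above it would be crossed by all edges of
    -- `A` in `δ(j)`, contrary to `hone`.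
    have habove : ∀ i ∈ 𝒜, j ⊆ i := fun i hi =>
      (h.chain i (hmem𝒜 i hi).1 j hj).resolve_left (hemp hi)
    obtain ⟨e, he⟩ := h.crosses j hj
    obtain ⟨i₀, hi₀, -⟩ := hcov e he
    obtain ⟨b, hb, hbmin⟩ := Finset.exists_min_image 𝒜 Finset.card ⟨i₀, hi₀⟩
    apply hone b hb
    intro f hf
    obtain ⟨i, hi, hfi⟩ := hcov f hf
    obtain ⟨p, hp, q, hq, hpq, rfl⟩ := exists_rep_of_mem_cut (Finset.mem_inter.1 hf).2
    have hbi : b ⊆ i := by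
      rcases h.chain b (hmem𝒜 b hb).1 i (hmem𝒜 i hi).1 with h1 | h1
      · exact h1
      · rw [Finset.eq_of_subset_of_card_le h1 (hbmin i hi)]
    have hpi := habove i hi hp
    have hpb := habove b hb hp
    rw [mkEdge_mem_cut] at hfi ⊢
    have := @hbi q
    tauto
  have hhigh : (𝒜.filter fun i => j ⊆ i).Nonempty := by
    by_contra hemp
    rw [Finset.not_nonempty_iff_eq_empty, Finset.filter_eq_empty_iff] at hemp
    have hbelow : ∀ i ∈ 𝒜, i ⊆ j := fun i hi =>
      (h.chain i (hmem𝒜 i hi).1 j hj).resolve_right (hemp hi)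
    obtain ⟨e, he⟩ := h.crosses j hj
    obtain ⟨i₀, hi₀, -⟩ := hcov e he
    obtain ⟨b, hb, hbmax⟩ := Finset.exists_max_image 𝒜 Finset.card ⟨i₀, hi₀⟩
    apply hone b hb
    intro f hf
    obtain ⟨i, hi, hfi⟩ := hcov f hf
    obtain ⟨p, hp, q, hq, hpq, rfl⟩ := exists_rep_of_mem_cut (Finset.mem_inter.1 hf).2
    have hbi : i ⊆ b := by
      rcases h.chain i (hmem𝒜 i hi).1 b (hmem𝒜 b hb).1 with h1 | h1
      · exact h1
      · rw [Finset.eq_of_subset_of_card_le h1 (hbmax i hi)]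
    have hqi := fun h' => hq (hbelow i hi h')
    have hqb := fun h' => hq (hbelow b hb h')
    rw [mkEdge_mem_cut] at hfi ⊢
    have := @hbi p
    tauto
  obtain ⟨a, ha, hamax⟩ := Finset.exists_max_image _ Finset.card hlow
  obtain ⟨b, hb, hbmin⟩ := Finset.exists_min_image _ Finset.card hhigh
  obtain ⟨ha𝒜, haj⟩ := Finset.mem_filter.1 ha
  obtain ⟨hb𝒜, hjb⟩ := Finset.mem_filter.1 hb
  have hia : ∀ i ∈ 𝒜, i ⊆ j → i ⊆ a := by
    intro i hi hij
    rcases h.chain i (hmem𝒜 i hi).1 a (hmem𝒜 a ha𝒜).1 with h1 | h1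
    · exact h1
    · rw [Finset.eq_of_subset_of_card_le h1 (hamax i (Finset.mem_filter.2 ⟨hi, hij⟩))]
  have hbi : ∀ i ∈ 𝒜, j ⊆ i → b ⊆ i := by
    intro i hi hij
    rcases h.chain b (hmem𝒜 b hb𝒜).1 i (hmem𝒜 i hi).1 with h1 | h1
    · exact h1
    · rw [Finset.eq_of_subset_of_card_le h1 (hbmin i (Finset.mem_filter.2 ⟨hi, hij⟩))]
  constructor
  · have hsub : A ∩ cut j ⊆ (cut j ∩ cut a) ∪ (cut j ∩ cut b) := by
      intro f hf
      obtain ⟨i, hi, hfi⟩ := hcov f hf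
      have hfj := (Finset.mem_inter.1 hf).2
      obtain ⟨p, hp, q, hq, hpq, rfl⟩ := exists_rep_of_mem_cut hfj
      rcases h.chain i (hmem𝒜 i hi).1 j hj with h1 | h1
      · refine Finset.mem_union_left _ (Finset.mem_inter.2 ⟨hfj, ?_⟩)
        have h2 := @hia i hi h1 p
        have h3 := fun h' => hq (h1 h')
        have h4 := fun h' => hq (haj h')
        rw [mkEdge_mem_cut] at hfi ⊢
        tauto
      · refine Finset.mem_union_right _ (Finset.mem_inter.2 ⟨hfj, ?_⟩)
        have h2 := @hbi i hi h1 q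
        have h3 := h1 hp
        have h4 := hjb hp
        rw [mkEdge_mem_cut] at hfi ⊢
        tauto
    have h1 := vecSum_mono h.feasible.nonneg hsub
    have h2 : vecSum x ((cut j ∩ cut a) ∪ (cut j ∩ cut b)) + vecSum x ((cut j ∩ cut a) ∩
        (cut j ∩ cut b)) = vecSum x (cut j ∩ cut a) + vecSum x (cut j ∩ cut b) :=
      Finset.sum_union_inter
    have h3 := vecSum_nonneg h.feasible.nonneg ((cut j ∩ cut a) ∩ (cut j ∩ cut b))
    have h4 := hbound a ha𝒜
    have h5 := hbound b hb𝒜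
    linarith
  · obtain ⟨e₁, he₁, he₁a⟩ := Finset.not_subset.1 (hone a ha𝒜)
    obtain ⟨e₂, he₂, he₂b⟩ := Finset.not_subset.1 (hone b hb𝒜)
    obtain ⟨he₁A, he₁j⟩ := Finset.mem_inter.1 he₁
    obtain ⟨he₂A, he₂j⟩ := Finset.mem_inter.1 he₂
    obtain ⟨u, hu, q, hq, huq, rfl⟩ := exists_rep_of_mem_cut he₁j
    obtain ⟨p, hp, v, hv, hpv, rfl⟩ := exists_rep_of_mem_cut he₂j
    refine ⟨u, hu, v, hv, ⟨q, hq, huq, he₁A⟩, ⟨p, hp, hpv, he₂A⟩, ?_⟩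
    have hua : u ∉ a := fun h1 => he₁a (mkEdge_mem_cut.2 (Or.inl ⟨h1, fun h2 => hq (haj h2)⟩))
    have hvb : v ∈ b := by
      by_contra h1
      exact he₂b (mkEdge_mem_cut.2 (Or.inl ⟨hjb hp, h1⟩))
    intro U hU
    rcases h.chain U (hmem𝒜 U hU).1 j hj with h1 | h1
    · exact ⟨fun h2 => absurd (h1 h2) hv, fun h2 => absurd (hia U hU h1 h2) hua⟩
    · exact ⟨fun _ => h1 hu, fun _ => hbi U hU h1 hvb⟩

end Violator

end Polymatroid

end PathTSP

namespace PathTSP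

/-! ### All cuts of a violator are good; the rank inequality -/

section Polymatroid

variable {V : Type*} [Fintype V] [DecidableEq V] {s t : V} {x : Edge V → ℝ}

namespace Violator

variable {W : LevelWeights s t x} {𝒞 : Finset (Finset V)} {A : Finset (Edge V)}

/-- Some edge of `A` crosses no cut but `j`, and all edges of `A` in `δ(j)` belong to the same
connected component. -/
def Good (𝒞 : Finset (Finset V)) (A : Finset (Edge V)) (j : Finset V) : Prop :=
  (∃ e ∈ A, crossing 𝒞 e = {j}) ∧
    ∀ p ∈ j, ∀ q, q ∉ j → ∀ p' ∈ j, ∀ q', q' ∉ j → EdgeRel A p q → EdgeRel A p' q' → Joined A p p'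

theorem Good.exists_edge {j : Finset V} (hj : Good 𝒞 A j) :
    ∃ r ∈ j, ∃ r', r' ∉ j ∧ EdgeRel A r r' ∧ ∀ U ∈ 𝒞, U ≠ j → (r ∈ U ↔ r' ∈ U) := by
  obtain ⟨e, he, hc⟩ := hj.1
  have hej : e ∈ cut j := (mem_crossing.1 (by rw [hc]; simp : j ∈ crossing 𝒞 e)).2
  obtain ⟨r, hr, r', hr', hne, rfl⟩ := exists_rep_of_mem_cut hej
  refine ⟨r, hr, r', hr', ⟨hne, he⟩, fun U hU hUj => ?_⟩
  by_contra hcon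
  have : U ∈ crossing 𝒞 (mkEdge r r' hne) := mem_crossing.2 ⟨hU, mkEdge_mem_cut.2 (by tauto)⟩
  rw [hc, Finset.mem_singleton] at this
  exact hUj this

/-- At a threshold above its deficiency, `j` is inactive and so splits a level. If `pq` crosses
active cuts inside `j`, the outermost of them is good, so its private edge lies in the component of
`p` and has an end `u` in `j` beyond all these cuts. The same argument outside `j` yields `v`. -/
theorem exists_level_reps (h : Violator W 𝒞 A) {j : Finset V} (hj : j ∈ 𝒞) {θ : ℝ}
    (hθ : deficiency x j < θ) (hgood : ∀ U ∈ activeCuts x 𝒞 θ, Good 𝒞 A U) {p q : V}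
    (hp : p ∈ j) (hq : q ∉ j) (hpq : EdgeRel A p q) :
    ∃ u ∈ j, ∃ v, v ∉ j ∧ Joined A p u ∧ Joined A p v ∧
      ∀ U ∈ activeCuts x 𝒞 θ, v ∈ U ↔ u ∈ U := by
  classical
  have hact : ∀ U ∈ activeCuts x 𝒞 θ, U ∈ 𝒞 ∧ U ≠ j := by
    intro U hU
    obtain ⟨h1, h2⟩ := mem_activeCuts.1 hU
    refine ⟨h1, ?_⟩
    rintro rfl
    linarith
  obtain ⟨u, hu, hju, hub⟩ : ∃ u ∈ j, Joined A p u ∧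
      ∀ U ∈ activeCuts x 𝒞 θ, U ⊆ j → u ∉ U := by
    by_cases hex : ∃ U ∈ activeCuts x 𝒞 θ, U ⊆ j ∧ p ∈ U
    · obtain ⟨U₀, hU₀, hU₀j, hpU₀⟩ := hex
      obtain ⟨a, ha, hamax⟩ := Finset.exists_max_image
        ((activeCuts x 𝒞 θ).filter fun U => U ⊆ j) Finset.card
        ⟨U₀, Finset.mem_filter.2 ⟨hU₀, hU₀j⟩⟩
      obtain ⟨ha1, ha2⟩ := Finset.mem_filter.1 ha
      have hsub : ∀ U ∈ activeCuts x 𝒞 θ, U ⊆ j → U ⊆ a := by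
        intro U hU hUj
        rcases h.chain U (hact U hU).1 a (hact a ha1).1 with h1 | h1
        · exact h1
        · rw [Finset.eq_of_subset_of_card_le h1 (hamax U (Finset.mem_filter.2 ⟨hU, hUj⟩))]
      obtain ⟨r, hr, r', hr', hrr, hsame⟩ := (hgood a ha1).exists_edge
      refine ⟨r', (hsame j hj (hact a ha1).2.symm).1 (ha2 hr), ?_, ?_⟩
      · refine Joined.trans ?_ (Relation.ReflTransGen.single hrr)
        exact (hgood a ha1).2 p (hsub U₀ hU₀ hU₀j hpU₀) q (fun h1 => hq (ha2 h1)) r hr r' hr'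
          hpq hrr
      · exact fun U hU hUj h1 => hr' (hsub U hU hUj h1)
    · push Not at hex
      exact ⟨p, hp, Joined.refl _ _, hex⟩
  obtain ⟨v, hv, hjv, hvb⟩ : ∃ v, v ∉ j ∧ Joined A p v ∧
      ∀ U ∈ activeCuts x 𝒞 θ, j ⊆ U → v ∈ U := by
    by_cases hex : ∃ U ∈ activeCuts x 𝒞 θ, j ⊆ U ∧ q ∉ U
    · obtain ⟨U₀, hU₀, hU₀j, hqU₀⟩ := hex
      obtain ⟨b, hb, hbmin⟩ := Finset.exists_min_image
        ((activeCuts x 𝒞 θ).filter fun U => j ⊆ U) Finset.card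
        ⟨U₀, Finset.mem_filter.2 ⟨hU₀, hU₀j⟩⟩
      obtain ⟨hb1, hb2⟩ := Finset.mem_filter.1 hb
      have hsub : ∀ U ∈ activeCuts x 𝒞 θ, j ⊆ U → b ⊆ U := by
        intro U hU hUj
        rcases h.chain b (hact b hb1).1 U (hact U hU).1 with h1 | h1
        · exact h1
        · rw [Finset.eq_of_subset_of_card_le h1 (hbmin U (Finset.mem_filter.2 ⟨hU, hUj⟩))]
      obtain ⟨r, hr, r', hr', hrr, hsame⟩ := (hgood b hb1).exists_edge
      refine ⟨r, fun h1 => ?_, ?_, ?_⟩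
      · exact hr' (hb2 ((hsame j hj (hact b hb1).2.symm).1 h1))
      · exact (hgood b hb1).2 p (hb2 hp) q (fun h1 => hqU₀ (hsub U₀ hU₀ hU₀j h1)) r hr r' hr'
          hpq hrr
      · exact fun U hU hUj => hsub U hU hUj hr
    · push Not at hex
      exact ⟨q, hq, Relation.ReflTransGen.single hpq, hex⟩
  refine ⟨u, hu, v, hv, hju, hjv, fun U hU => ?_⟩
  rcases h.chain U (hact U hU).1 j hj with h1 | h1
  · exact ⟨fun h2 => absurd (h1 h2) hv, fun h2 => absurd h2 (hub U hU h1)⟩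
  · exact ⟨fun _ => h1 hu, fun _ => hvb U hU h1⟩

/-- The set `A \ δ(j)` misses `j` and so satisfies the inequality; the violation must come from the
edges in `δ(j)`. -/
theorem lt_of_marginal (h : Violator W 𝒞 A) {j : Finset V} (hj : j ∈ 𝒞) {m : ℝ}
    (hm : W.rank 𝒞 (A \ cut j) + m ≤ W.rank 𝒞 A) : m < vecSum x (A ∩ cut j) := by
  have h1 := h.le_of_not_cross (A \ cut j) ⟨j, hj, Finset.sdiff_inter_self _ _⟩
  have h2 : vecSum x A = vecSum x (A \ cut j) + vecSum x (A ∩ cut j) := by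
    simp only [vecSum]
    rw [← Finset.sum_union (Finset.disjoint_sdiff_inter A _), Finset.sdiff_union_inter]
  have h3 := h.rank_lt
  linarith

theorem levelVec_mono_sdiff {𝒜 : Finset (Finset V)} {j : Finset V}
    (he : ∃ e ∈ A, crossing 𝒜 e = {j}) :
    levelRank 𝒜 (A \ cut j) + 1 ≤ levelRank 𝒜 A := by
  obtain ⟨e, heA, hc⟩ := he
  refine levelRank_add_one_le Finset.sdiff_subset (cutVec_mem heA hc) (cutVec_notMem ?_)
  intro f hf hfc
  have : j ∈ crossing 𝒜 f := by rw [hfc]; simp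
  exact (Finset.mem_sdiff.1 hf).2 (mem_crossing.1 this).2

/-- Induction step in order of descending deficiency. Each way for `j` to fail makes the removal of
`δ(j)` cost more rank than `x(A ∩ δ(j))` permits, or produces a gain forbidden by `no_gain`. -/
theorem good_of_good (h : Violator W 𝒞 A) {j : Finset V} (hj : j ∈ 𝒞)
    (hgood : ∀ U ∈ 𝒞, deficiency x j < deficiency x U → Good 𝒞 A U) : Good 𝒞 A j := by
  classical
  obtain ⟨ψ, hψY, hψj, hψe, hψc⟩ := h.exists_threshold hj
  have hjY : deficiency x j = 0 ∨ ∃ U ∈ narrowCuts s t x, deficiency x j = deficiency x U :=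
    Or.inr ⟨j, h.narrow hj, rfl⟩
  have hgoodθ : ∀ θ, deficiency x j < θ → ∀ U ∈ activeCuts x 𝒞 θ, Good 𝒞 A U := fun θ hθ U hU =>
    hgood U (mem_activeCuts.1 hU).1 (hθ.trans_le (mem_activeCuts.1 hU).2)
  have hcutj : vecSum x (cut j) = 2 - deficiency x j := by
    rw [deficiency_narrow (h.narrow hj)]; ring
  have hbound : vecSum x (A ∩ cut j) ≤ 2 - deficiency x j - ψ := by
    rcases hψc with ⟨h1, -⟩ | ⟨-, h1⟩
    · rw [h1, sub_zero, ← hcutj]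
      exact vecSum_mono h.feasible.nonneg Finset.inter_subset_right
    · rcases h.gap_cases hj hψj h1 with h2 | h2
      · linarith [h.feasible.deficiency_le_one (h.narrow hj)]
      · exact h2.1
  -- a single component
  have hsingle : ∀ p ∈ j, ∀ q, q ∉ j → ∀ p' ∈ j, ∀ q', q' ∉ j → EdgeRel A p q →
      EdgeRel A p' q' → Joined A p p' := by
    intro p hp q hq p' hp' q' hq' hpq hpq'
    by_contra hnot
    -- With two components, removing `δ(j)` costs rank two at thresholds above the deficiency of `j`
    -- and rank one between `ψ` and this deficiency. On average that is the upper bound on `x(A ∩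
    -- δ(j))`.
    refine absurd (h.lt_of_marginal hj (m := (1 - ψ) + (1 - deficiency x j)) ?_) (by linarith)
    have hmarg : ∀ θ ∈ W.support, ((levelRank (activeCuts x 𝒞 θ) (A \ cut j) : ℝ) +
        (if ψ < θ then 1 else 0)) + (if deficiency x j < θ then 1 else 0) ≤
          levelRank (activeCuts x 𝒞 θ) A := by
      intro θ _
      by_cases h1 : deficiency x j < θ
      · rw [if_pos h1, if_pos (hψj.trans_lt h1)]
        obtain ⟨u, hu, v, hv, hju, hjv, hlev⟩ :=
          h.exists_level_reps hj h1 (hgoodθ θ h1) hp hq hpq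
        obtain ⟨u', hu', v', hv', hju', hjv', hlev'⟩ :=
          h.exists_level_reps hj h1 (hgoodθ θ h1) hp' hq' hpq'
        have hw := (h.joined_level (hju.symm.trans hjv) θ hlev).pairVec_mem
        have hw' := (h.joined_level (hju'.symm.trans hjv') θ hlev').pairVec_mem
        -- The part inside `j` of a component of `A` is closed under the edges of `A \ δ(j)`. The
        -- resulting functionals for two components certify that the two pair vectors are
        -- independent modulo the remaining span.
        have hK : ∀ r : V, ∀ e ∈ level (activeCuts x 𝒞 θ) (A \ cut j),
            e ∉ cut (j.filter fun y => Joined A r y) := by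
          intro r e he hcut
          have heA := Finset.mem_sdiff.1 (mem_level.1 he).1
          obtain ⟨y, z, hyz, rfl⟩ := e.exists_rep
          have hj' : Joined A y z := Joined.of_mem heA.1
          rw [mkEdge_mem_cut, Finset.mem_filter, Finset.mem_filter] at hcut
          have h3 := heA.2
          rw [mkEdge_mem_cut] at h3
          rcases hcut with ⟨h4, h5⟩ | ⟨h4, h5⟩
          · exact h5 ⟨by_contra fun hz => h3 (Or.inl ⟨h4.1, hz⟩), h4.2.trans hj'⟩
          · exact h5 ⟨by_contra fun hz => h3 (Or.inr ⟨h4.1, hz⟩), h4.2.trans hj'.symm⟩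
        have hval : ∀ r y z : V, y ∈ j → z ∉ j → Joined A r y →
            vertexSum (j.filter fun y => Joined A r y) (pairVec y z) = 1 := by
          intro r y z hy hz hry
          rw [vertexSum_pairVec]
          simp [hy, hz, hry]
        have hval0 : ∀ r y z : V, y ∈ j → z ∉ j → ¬ Joined A r y →
            vertexSum (j.filter fun y => Joined A r y) (pairVec y z) = 0 := by
          intro r y z hy hz hry
          rw [vertexSum_pairVec]
          simp [hz, hry]
        have h2 := levelRank_add_two_le (B := A \ cut j) Finset.sdiff_subset hw hw' (by
            intro hmem
            have := vertexSum_eq_zero (hK p) hmem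
            rw [hval p u v hu hv hju] at this
            exact one_ne_zero this) (by
            intro hmem
            have hle : levelSpan (activeCuts x 𝒞 θ) (A \ cut j) ⊔
                Submodule.span (ZMod 2) {pairVec u v} ≤
                LinearMap.ker (vertexSum (j.filter fun y => Joined A p' y)) := by
              refine sup_le (fun w hw => vertexSum_eq_zero (hK p') hw) ?_
              rw [Submodule.span_singleton_le_iff_mem, LinearMap.mem_ker]
              exact hval0 p' u v hu hv fun h3 => hnot (hju.trans h3.symm)
            have := hle hmem
            rw [LinearMap.mem_ker, hval p' u' v' hu' hv' hju'] at this
            exact one_ne_zero this)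
        have h3 : ((levelRank (activeCuts x 𝒞 θ) (A \ cut j) + 2 : ℕ) : ℝ) ≤
            levelRank (activeCuts x 𝒞 θ) A := by exact_mod_cast h2
        push_cast at h3
        linarith
      · rw [if_neg h1, add_zero]
        by_cases h2 : ψ < θ
        · rw [if_pos h2]
          exact_mod_cast levelVec_mono_sdiff (hψe θ h2 (not_lt.1 h1))
        · rw [if_neg h2, add_zero]
          exact_mod_cast levelRank_mono Finset.sdiff_subset
    have h4 := W.sum_add_tail_le hjY hmarg
    have h5 := W.sum_add_tail_le hψY (a := fun θ => (levelRank (activeCuts x 𝒞 θ) (A \ cut j) : ℝ))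
      (b := fun θ => (levelRank (activeCuts x 𝒞 θ) (A \ cut j) : ℝ) + if ψ < θ then 1 else 0)
      fun θ _ => le_rfl
    simp only [LevelWeights.rank]
    linarith
  refine ⟨?_, hsingle⟩
  rcases hψc with ⟨-, h1⟩ | ⟨hpos, hψc⟩
  · exact h1
  exfalso
  rcases h.gap_cases hj hψj hψc with hle | ⟨-, u, hu, v, hv, ⟨q, hq, huq, huqA⟩,
    ⟨p, hp, hpv, hpvA⟩, hlev⟩
  -- At every threshold above `ψ` one unit of rank is lost: a pair vector when `j` is inactive, its
  -- cut vector otherwise.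
  · refine absurd (h.lt_of_marginal hj (m := 1 - ψ) ?_) (not_lt.2 hle)
    refine W.sum_add_tail_le hψY fun θ _ => ?_
    by_cases h2 : ψ < θ
    · rw [if_pos h2]
      by_cases h1 : deficiency x j < θ
      · obtain ⟨e, he⟩ := h.crosses j hj
        obtain ⟨heA, hej⟩ := Finset.mem_inter.1 he
        obtain ⟨p, hp, q, hq, hpq, rfl⟩ := exists_rep_of_mem_cut hej
        obtain ⟨u, hu, v, hv, hju, hjv, hlev⟩ :=
          h.exists_level_reps hj h1 (hgoodθ θ h1) hp hq ⟨hpq, heA⟩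
        have hw := (h.joined_level (hju.symm.trans hjv) θ hlev).pairVec_mem
        have h3 := levelRank_add_one_le (B := A \ cut j) Finset.sdiff_subset hw (by
          intro hmem
          have := vertexSum_eq_zero (K := j) (fun e he =>
            (Finset.mem_sdiff.1 (mem_level.1 he).1).2) hmem
          rw [vertexSum_pairVec] at this
          simp [hu, hv] at this)
        exact_mod_cast h3
      · exact_mod_cast levelVec_mono_sdiff (hψe θ h2 (not_lt.1 h1))
    · rw [if_neg h2, add_zero]
      exact_mod_cast levelRank_mono Finset.sdiff_subset
  · have hne : u ≠ v := fun h1 => hv (h1 ▸ hu)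
    -- Ignoring `j`, the vertices `u` and `v` share a level in which no edge of `A` crosses `j`.
    -- Completing this level gains `cutVec j` while `j` is active and `pairVec u v` at higher
    -- thresholds.
    set 𝒜 := (activeCuts x 𝒞 ψ).erase j with h𝒜
    have hcut𝒜 : ∀ U ∈ 𝒜, mkEdge u v hne ∉ cut U := by
      intro U hU hcut
      have h1 := hlev U hU
      rcases mkEdge_mem_cut.1 hcut with h2 | h2
      · exact h2.2 (h1.2 h2.1)
      · exact h2.2 (h1.1 h2.1)
    have hej : mkEdge u v hne ∈ cut j := mkEdge_mem_cut.2 (Or.inl ⟨hu, hv⟩)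
    have hcov : ∀ e ∈ A ∩ cut j, ∃ i ∈ 𝒜, e ∈ cut i := by
      intro e he
      obtain ⟨i, hi, hij, hei, hψi⟩ := hψc e he
      exact ⟨i, Finset.mem_erase.2 ⟨hij, mem_activeCuts.2 ⟨hi, hψi⟩⟩, hei⟩
    have hinner : mkEdge u v hne ∈ inner (levelOf 𝒜 u) :=
      mkEdge_mem_inner.2 ⟨mem_levelOf.2 fun _ _ => Iff.rfl, mem_levelOf.2 hlev⟩
    have hABj : ∀ e ∈ A ∩ inner (levelOf 𝒜 u), e ∉ cut j := by
      intro e he hcut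
      obtain ⟨heA, heB⟩ := Finset.mem_inter.1 he
      obtain ⟨i, hi, hei⟩ := hcov e (Finset.mem_inter.2 ⟨heA, hcut⟩)
      exact mem_level_of_inner heB i hi hei
    refine h.no_gain (𝒜 := 𝒜)
      (fun U hU => (mem_activeCuts.1 (Finset.mem_erase.1 hU).2).1) ?_ hψY
      (fun U hU => (mem_activeCuts.1 (Finset.mem_erase.1 hU).2).2) u hinner ?_ ?_
    · obtain ⟨e, he⟩ := h.crosses j hj
      obtain ⟨i, hi, -⟩ := hcov e he
      exact ⟨i, hi⟩
    · intro heA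
      obtain ⟨i, hi, hei⟩ := hcov _ (Finset.mem_inter.2 ⟨heA, hej⟩)
      exact hcut𝒜 i hi hei
    · intro θ _ hθ
      have hsub : ∀ U ∈ activeCuts x 𝒞 θ, U ≠ j → U ∈ 𝒜 := fun U hU hUj =>
        Finset.mem_erase.2 ⟨hUj, mem_activeCuts.2
          ⟨(mem_activeCuts.1 hU).1, hθ.le.trans (mem_activeCuts.1 hU).2⟩⟩
      by_cases h1 : θ ≤ deficiency x j
      · obtain ⟨e, heA, hc⟩ := hψe θ hθ h1
        refine ⟨cutVec j, cutVec_mem heA hc, cutVec_mem hinner ?_, cutVec_notMem ?_⟩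
        · ext U
          rw [mem_crossing, Finset.mem_singleton]
          constructor
          · rintro ⟨h2, h3⟩
            by_contra hUj
            exact hcut𝒜 U (hsub U h2 hUj) h3
          · rintro rfl
            exact ⟨mem_activeCuts.2 ⟨hj, h1⟩, hej⟩
        · intro f hf hfc
          have : j ∈ crossing (activeCuts x 𝒞 θ) f := by rw [hfc]; simp
          exact hABj f hf (mem_crossing.1 this).2
      · have hjnot : ∀ U ∈ activeCuts x 𝒞 θ, U ∈ 𝒜 := by
          intro U hU
          refine hsub U hU ?_
          rintro rfl
          exact h1 (mem_activeCuts.1 hU).2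
        have huv : Joined A u v :=
          (hsingle u hu q hq p hp v hv ⟨huq, huqA⟩ ⟨hpv, hpvA⟩).trans (Joined.of_mem hpvA)
        refine ⟨pairVec u v,
          (h.joined_level huv θ fun U hU => hlev U (hjnot U hU)).pairVec_mem, ?_, ?_⟩
        · rw [← levelVec_of_empty (𝒜 := activeCuts x 𝒞 θ) (h := hne)
            (crossing_eq_empty.2 fun U hU => hcut𝒜 U (hjnot U hU))]
          exact levelVec_mem hinner
        · intro hmem
          have := vertexSum_eq_zero (K := j) (fun e he => hABj e (mem_level.1 he).1) hmem
          rw [vertexSum_pairVec] at this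
          simp [hu, hv] at this

theorem all_good (h : Violator W 𝒞 A) : ∀ j ∈ 𝒞, Good 𝒞 A j := by
  classical
  by_contra! hcon
  obtain ⟨j₀, hj₀, hbad₀⟩ := hcon
  obtain ⟨j, hj, hmax⟩ := Finset.exists_max_image (𝒞.filter fun j => ¬ Good 𝒞 A j) (deficiency x)
    ⟨j₀, Finset.mem_filter.2 ⟨hj₀, hbad₀⟩⟩
  obtain ⟨hj1, hj2⟩ := Finset.mem_filter.1 hj
  refine hj2 (h.good_of_good hj1 fun U hU hlt => ?_)
  by_contra hU'
  exact absurd (hmax U (Finset.mem_filter.2 ⟨hU, hU'⟩)) (not_le.2 hlt)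

/-- Pick for each active cut an edge of `A` crossing it alone. These edges and the level edges of
`A` connect everything that `A` connects. A linear map sending each cut vector to the graphic vector
of its chosen edge therefore maps the level span of `A` onto a space containing the graphic one. -/
theorem levelRank_empty_le (h : Violator W 𝒞 A) (θ : ℝ) :
    levelRank ∅ A ≤ levelRank (activeCuts x 𝒞 θ) A := by
  classical
  set 𝒜 := activeCuts x 𝒞 θ with h𝒜
  have h𝒜C : ∀ U ∈ 𝒜, U ∈ 𝒞 := fun U hU => (mem_activeCuts.1 hU).1
  have hgood := h.all_good
  have hex : ∀ U ∈ 𝒞, ∃ e ∈ A, crossing 𝒞 e = {U} := fun U hU => (hgood U hU).1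
  -- The choice function `ed` needs some edge as default value outside `𝒞`.
  rcases isEmpty_or_nonempty (Edge V) with hE | hE
  · rw [Finset.eq_empty_of_isEmpty A, levelRank, levelSpan, Finset.coe_empty, Set.image_empty,
      Submodule.span_empty, finrank_bot]
    exact Nat.zero_le _
  choose! ed hedA hedc using hex
  set D : Finset (Edge V) := level 𝒜 A ∪ 𝒜.image ed with hD
  -- Induction on the number of active cuts separating `p` and `q`. Detour through the chosen edge
  -- of such a cut `U`: by goodness it lies in the same component of `A`, and `p` and `r`, as well
  -- as `r'` and `q`, are separated by fewer cuts.
  have hjoin : ∀ n : ℕ, ∀ p q, (𝒜.filter fun U => ¬ (p ∈ U ↔ q ∈ U)).card = n → Joined A p q →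
      Joined D p q := by
    intro n
    induction n using Nat.strong_induction_on with
    | _ n ih =>
      have main : ∀ p q, (𝒜.filter fun U => ¬ (p ∈ U ↔ q ∈ U)).card = n → Joined A p q →
          ∀ U ∈ 𝒜, p ∈ U → q ∉ U → Joined D p q := by
        intro p q hn hpq U hU hpU hqU
        have hUC := h𝒜C U hU
        obtain ⟨y, hy, y', hy', hyy, hpy⟩ := hpq.exists_crossing hpU hqU
        have hUe : ed U ∈ cut U :=
          (mem_crossing.1 (by rw [hedc U hUC]; simp : U ∈ crossing 𝒞 (ed U))).2
        obtain ⟨r, hr, r', hr', hne, hrep⟩ := exists_rep_of_mem_cut hUe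
        have hrA : EdgeRel A r r' := ⟨hne, hrep ▸ hedA U hUC⟩
        have hrD : Joined D r r' := Joined.of_mem (h := hne) (by
          rw [← hrep]
          exact Finset.mem_union_right _ (Finset.mem_image_of_mem _ hU))
        have hsame : ∀ U' ∈ 𝒜, U' ≠ U → (r ∈ U' ↔ r' ∈ U') := by
          intro U' hU' hne'
          by_contra hcon
          have : U' ∈ crossing 𝒞 (ed U) := mem_crossing.2 ⟨h𝒜C U' hU', by
            rw [hrep]; exact mkEdge_mem_cut.2 (by tauto)⟩
          rw [hedc U hUC, Finset.mem_singleton] at this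
          exact hne' this
        have hpr : Joined A p r := hpy.trans ((hgood U hUC).2 y hy y' hy' r hr r' hr' hyy hrA)
        have hrr : Joined A r r' := Relation.ReflTransGen.single hrA
        have hr'q : Joined A r' q := (hrr.symm.trans hpr.symm).trans hpq
        have hUmem : U ∈ 𝒜.filter fun U => ¬ (p ∈ U ↔ q ∈ U) :=
          Finset.mem_filter.2 ⟨hU, by tauto⟩
        have h1 : (𝒜.filter fun U => ¬ (p ∈ U ↔ r ∈ U)).card < n := by
          rw [← hn]
          refine Finset.card_lt_card ((Finset.ssubset_iff_of_subset ?_).2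
            ⟨U, hUmem, fun h1 => (Finset.mem_filter.1 h1).2 (by tauto)⟩)
          intro U' hU'
          obtain ⟨h2, h3⟩ := Finset.mem_filter.1 hU'
          have hne' : U' ≠ U := by rintro rfl; tauto
          have h4 := hsame U' h2 hne'
          refine Finset.mem_filter.2 ⟨h2, ?_⟩
          rcases h.chain U' (h𝒜C U' h2) U hUC with h5 | h5
          · have := @h5 r'; have := @h5 q; tauto
          · have := h5 hpU; have := h5 hr; tauto
        have h2 : (𝒜.filter fun U => ¬ (r' ∈ U ↔ q ∈ U)).card < n := by
          rw [← hn]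
          refine Finset.card_lt_card ((Finset.ssubset_iff_of_subset ?_).2
            ⟨U, hUmem, fun h1 => (Finset.mem_filter.1 h1).2 (by tauto)⟩)
          intro U' hU'
          obtain ⟨h2, h3⟩ := Finset.mem_filter.1 hU'
          have hne' : U' ≠ U := by rintro rfl; tauto
          have h4 := hsame U' h2 hne'
          refine Finset.mem_filter.2 ⟨h2, ?_⟩
          rcases h.chain U' (h𝒜C U' h2) U hUC with h5 | h5
          · have := @h5 r'; have := @h5 q; tauto
          · have := h5 hpU; have := h5 hr; tauto
        exact ((ih _ h1 p r rfl hpr).trans hrD).trans (ih _ h2 r' q rfl hr'q)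
      intro p q hn hpq
      by_cases hall : ∀ U ∈ 𝒜, p ∈ U ↔ q ∈ U
      · exact (h.joined_level hpq θ fun U hU => (hall U hU).symm).mono Finset.subset_union_left
      · push Not at hall
        obtain ⟨U, hU, hcase⟩ := hall
        rcases hcase with ⟨h1, h2⟩ | ⟨h1, h2⟩
        · exact main p q hn hpq U hU h1 h2
        · refine (main q p ?_ hpq.symm U hU h2 h1).symm
          rw [← hn]
          congr 1
          refine Finset.filter_congr fun U' _ => ?_
          tauto
  -- the linear map that sends the vector of a cut to the vector of its edge
  set T : (V → ZMod 2) × (Finset V → ZMod 2) →ₗ[ZMod 2] (V → ZMod 2) × (Finset V → ZMod 2) :=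
    LinearMap.inl _ _ _ ∘ₗ (LinearMap.fst _ _ _ +
      (∑ U ∈ 𝒜, LinearMap.toSpanSingleton (ZMod 2) (V → ZMod 2) (chi (ed U)) ∘ₗ
        LinearMap.proj U) ∘ₗ LinearMap.snd _ _ _) with hT
  have hTcut : ∀ U ∈ 𝒜, T (cutVec U) = levelVec ∅ (ed U) := by
    intro U hU
    have h1 : levelVec ∅ (ed U) = (chi (ed U), 0) := by simp [levelVec, crossing]
    rw [h1]
    simp only [hT, LinearMap.comp_apply, LinearMap.add_apply, LinearMap.fst_apply,
      LinearMap.snd_apply, LinearMap.sum_apply, LinearMap.proj_apply,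
      LinearMap.toSpanSingleton_apply, cutVec, LinearMap.inl_apply, zero_add]
    rw [Finset.sum_eq_single U]
    · simp
    · intro U' _ hne
      simp [hne]
    · intro h2; exact absurd hU h2
  have hTlev : ∀ e ∈ level 𝒜 A, T (levelVec 𝒜 e) = levelVec ∅ e := by
    intro e he
    have h0 : crossing 𝒜 e = ∅ := (Finset.mem_filter.1 he).2
    have h1 : levelVec 𝒜 e = (chi e, 0) := by simp [levelVec, h0]
    have h2 : levelVec ∅ e = (chi e, 0) := by simp [levelVec, crossing]
    rw [h1, h2]
    simp [hT]
  have hDT : levelSpan ∅ D ≤ (levelSpan 𝒜 A).map T := by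
    rw [levelSpan, Submodule.span_le]
    rintro _ ⟨e, he, rfl⟩
    rcases Finset.mem_union.1 he with he | he
    · exact ⟨levelVec 𝒜 e, levelVec_mem (Finset.mem_filter.1 he).1, hTlev e he⟩
    · obtain ⟨U, hU, rfl⟩ := Finset.mem_image.1 he
      refine ⟨cutVec U, cutVec_mem (hedA U (h𝒜C U hU)) ?_, hTcut U hU⟩
      ext U'
      rw [mem_crossing, Finset.mem_singleton]
      constructor
      · rintro ⟨h1, h2⟩
        have : U' ∈ crossing 𝒞 (ed U) := mem_crossing.2 ⟨h𝒜C U' h1, h2⟩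
        rwa [hedc U (h𝒜C U hU), Finset.mem_singleton] at this
      · rintro rfl
        exact ⟨hU, (mem_crossing.1 (by rw [hedc U' (h𝒜C U' hU)]; simp :
          U' ∈ crossing 𝒞 (ed U'))).2⟩
  have hAD : levelSpan ∅ A ≤ levelSpan ∅ D := by
    rw [levelSpan, Submodule.span_le]
    rintro _ ⟨e, he, rfl⟩
    obtain ⟨p, q, hpq, rfl⟩ := e.exists_rep
    rw [levelVec_of_empty (by simp [crossing])]
    refine Joined.pairVec_mem ?_
    rw [level_empty]
    exact hjoin _ p q rfl (Joined.of_mem he)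
  exact (Submodule.finrank_mono (hAD.trans hDT)).trans (Submodule.finrank_map_le _ _)

theorem false (h : Violator W 𝒞 A) : False := by
  have h1 : vecSum x A ≤ levelRank ∅ A := vecSum_le_levelRank h.feasible.nonneg
    (fun U hU => h.feasible.inner_le h.ne hU) A
  have h2 : (levelRank ∅ A : ℝ) ≤ W.rank 𝒞 A := by
    calc (levelRank ∅ A : ℝ) = ∑ θ ∈ W.support, W.weight θ * levelRank ∅ A := by
          rw [← Finset.sum_mul, W.sum_weight, one_mul]
      _ ≤ W.rank 𝒞 A := Finset.sum_le_sum fun θ hθ => mul_le_mul_of_nonneg_left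
          (by exact_mod_cast h.levelRank_empty_le θ) (W.nonneg θ hθ)
  have := h.rank_lt
  linarith

end Violator

/-- The rank inequality: `x` belongs to the polymatroid of the averaged rank function. -/
theorem LevelWeights.vecSum_le_rank (W : LevelWeights s t x) (hx : IsFeasible s t x) (hst : s ≠ t)
    (n : ℕ) : ∀ 𝒞 : Finset (Finset V), 𝒞 ⊆ narrowCuts s t x → 𝒞.card = n →
      ∀ A, vecSum x A ≤ W.rank 𝒞 A := by
  classical
  induction n using Nat.strong_induction_on with
  | _ n ih =>
    intro 𝒞 h𝒞 hcard
    -- A cut that `B` does not meet has no influence on the vectors of `B` and can be dropped; the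
    -- weights refer to all narrow cuts and need not change.
    have hmiss : ∀ B, (∃ U ∈ 𝒞, B ∩ cut U = ∅) → vecSum x B ≤ W.rank 𝒞 B := by
      rintro B ⟨U, hU, hB⟩
      have hlt : (𝒞.erase U).card < n := by
        rw [← hcard]; exact Finset.card_erase_lt_of_mem hU
      have h1 := ih _ hlt (𝒞.erase U) ((Finset.erase_subset _ _).trans h𝒞) rfl B
      have h2 : W.rank 𝒞 B = W.rank (𝒞.erase U) B := by
        refine Finset.sum_congr rfl fun θ _ => ?_
        congr 2
        refine levelRank_congr fun e he => ?_
        ext U'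
        simp only [mem_crossing, mem_activeCuts, Finset.mem_erase]
        constructor
        · rintro ⟨⟨h3, h4⟩, h5⟩
          refine ⟨⟨⟨?_, h3⟩, h4⟩, h5⟩
          rintro rfl
          have : e ∈ B ∩ cut U' := Finset.mem_inter.2 ⟨he, h5⟩
          rw [hB] at this
          simp at this
        · rintro ⟨⟨⟨-, h3⟩, h4⟩, h5⟩
          exact ⟨⟨h3, h4⟩, h5⟩
      rwa [h2]
    by_contra! hcon
    obtain ⟨A₀, hA₀⟩ := hcon
    obtain ⟨A, hA, hmax⟩ := Finset.exists_max_image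
      (Finset.univ.filter fun A => W.rank 𝒞 A < vecSum x A) Finset.card
      ⟨A₀, by simpa using hA₀⟩
    simp only [Finset.mem_filter, Finset.mem_univ, true_and] at hA hmax
    refine Violator.false (W := W) (𝒞 := 𝒞) (A := A) ⟨hx, hst, h𝒞, hA, ?_, hmiss, ?_⟩
    · intro U hU
      by_contra hemp
      rw [Finset.not_nonempty_iff_eq_empty] at hemp
      exact absurd (hmiss A ⟨U, hU, hemp⟩) (not_le.2 hA)
    · intro B hAB hne
      by_contra hB
      have h1 := hmax B (not_le.1 hB)
      exact hne (Finset.eq_of_subset_of_card_le hAB h1)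

end Polymatroid

end PathTSP

namespace PathTSP

/-! ### Threshold weights and greedy bases -/

section Greedy

variable {V : Type*} [Fintype V] [DecidableEq V]

/-- Let `γ θ` be the distance from `θ` to its predecessor in `Θ ∪ {0}`; the partial sums telescope.
The total is carried along because it is the predecessor of the next element. -/
theorem exists_increments (Θ : Finset ℝ) (hΘ : ∀ θ ∈ Θ, 0 < θ) :
    ∃ γ : ℝ → ℝ, (∀ θ ∈ Θ, 0 ≤ γ θ) ∧ (∃ m ∈ insert 0 Θ, ∑ θ ∈ Θ, γ θ = m) ∧
      ∀ y ∈ insert 0 Θ, ∑ θ ∈ Θ.filter (fun θ => θ ≤ y), γ θ = y := by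
  induction Θ using Finset.induction_on_max with
  | empty => exact ⟨0, by simp, ⟨0, by simp⟩, by simp⟩
  | insert a Θ ha ih =>
    obtain ⟨γ, h0, ⟨m, hm, hsum⟩, h1⟩ := ih fun θ hθ => hΘ θ (Finset.mem_insert_of_mem hθ)
    have haΘ : a ∉ Θ := fun h => lt_irrefl _ (ha a h)
    have hapos : 0 < a := hΘ a (Finset.mem_insert_self _ _)
    have hle : ∀ y ∈ insert 0 Θ, y < a := by
      intro y hy
      rcases Finset.mem_insert.1 hy with rfl | hy
      · exact hapos
      · exact ha y hy
    have hsame : ∀ θ ∈ Θ, Function.update γ a (a - m) θ = γ θ := fun θ hθ =>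
      Function.update_of_ne (by rintro rfl; exact haΘ hθ) _ _
    have htot : ∑ θ ∈ insert a Θ, Function.update γ a (a - m) θ = a := by
      rw [Finset.sum_insert haΘ, Finset.sum_congr rfl hsame, hsum, Function.update_self]
      ring
    refine ⟨Function.update γ a (a - m), ?_, ⟨a, by simp, htot⟩, ?_⟩
    · intro θ hθ
      rcases Finset.mem_insert.1 hθ with rfl | hθ
      · rw [Function.update_self]; linarith [hle m hm]
      · rw [hsame θ hθ]; exact h0 θ hθ
    · intro y hy
      by_cases hya : y = a
      · subst hya
        rw [Finset.filter_true_of_mem, htot]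
        intro θ hθ
        rcases Finset.mem_insert.1 hθ with rfl | hθ
        · exact le_rfl
        · exact (ha θ hθ).le
      · have hy' : y ∈ insert 0 Θ := by
          simp only [Finset.mem_insert] at hy ⊢; tauto
        rw [Finset.filter_insert, if_neg (not_le.2 (hle y hy')),
          Finset.sum_congr rfl fun θ hθ => hsame θ (Finset.mem_filter.1 hθ).1]
        exact h1 y hy'

theorem IsFeasible.exists_levelWeights {s t : V} {x : Edge V → ℝ} (hx : IsFeasible s t x) :
    Nonempty (LevelWeights s t x) := by
  classical
  -- Including 1 makes the total weight one even if no deficiency reaches it.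
  set Θ : Finset ℝ := insert 1 ((narrowCuts s t x).image (deficiency x)) with hΘ
  have hpos : ∀ θ ∈ Θ, 0 < θ := by
    intro θ hθ
    rcases Finset.mem_insert.1 hθ with rfl | hθ
    · exact one_pos
    · obtain ⟨U, hU, rfl⟩ := Finset.mem_image.1 hθ
      exact deficiency_pos hU
  have hle : ∀ θ ∈ Θ, θ ≤ 1 := by
    intro θ hθ
    rcases Finset.mem_insert.1 hθ with rfl | hθ
    · exact le_rfl
    · obtain ⟨U, hU, rfl⟩ := Finset.mem_image.1 hθ
      exact hx.deficiency_le_one hU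
  obtain ⟨γ, h0, -, h1⟩ := exists_increments Θ hpos
  refine ⟨⟨Θ, γ, hpos, h0, fun y hy => ?_⟩⟩
  have hyΘ : y ∈ insert 0 Θ := by
    rcases hy with rfl | ⟨U, hU, rfl⟩
    · exact Finset.mem_insert_self _ _
    · exact Finset.mem_insert_of_mem (Finset.mem_insert_of_mem (Finset.mem_image_of_mem _ hU))
  have h2 := h1 y hyΘ
  have h3 := h1 1 (by simp [hΘ])
  rw [Finset.filter_true_of_mem hle] at h3
  have h4 := Finset.sum_filter_add_sum_filter_not Θ (fun θ => θ ≤ y) γ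
  simp only [not_le] at h4
  linarith

/-- The first `k` edges of an enumeration. -/
def initial {m : ℕ} (r : Edge V ≃ Fin m) (k : ℕ) : Finset (Edge V) :=
  Finset.univ.filter fun e => (r e : ℕ) < k

open Classical in
/-- The greedy basis along an enumeration of the edges. -/
noncomputable def greedy (𝒜 : Finset (Finset V)) {m : ℕ} (r : Edge V ≃ Fin m) :
    Finset (Edge V) :=
  Finset.univ.filter fun e => levelVec 𝒜 e ∉ levelSpan 𝒜 (initial r (r e))

variable {𝒜 : Finset (Finset V)} {m : ℕ} {r : Edge V ≃ Fin m}

theorem mem_initial {k : ℕ} {e : Edge V} : e ∈ initial r k ↔ (r e : ℕ) < k := by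
  simp [initial]

theorem mem_greedy {e : Edge V} :
    e ∈ greedy 𝒜 r ↔ levelVec 𝒜 e ∉ levelSpan 𝒜 (initial r (r e)) := by simp [greedy]

theorem initial_eq_univ : initial r m = Finset.univ := by
  ext e; simp [mem_initial]

theorem initial_succ {k : ℕ} (hk : k < m) :
    initial r (k + 1) = insert (r.symm ⟨k, hk⟩) (initial r k) := by
  ext e
  rw [Finset.mem_insert, mem_initial, mem_initial, Equiv.eq_symm_apply, Fin.ext_iff]
  simp only
  omega

theorem levelSpan_insert (A : Finset (Edge V)) (e : Edge V) :
    levelSpan 𝒜 (insert e A) = Submodule.span (ZMod 2) {levelVec 𝒜 e} ⊔ levelSpan 𝒜 A := by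
  rw [Finset.insert_eq, levelSpan_union]
  simp [levelSpan]

theorem levelRank_insert_le (A : Finset (Edge V)) (e : Edge V) :
    levelRank 𝒜 (insert e A) ≤ levelRank 𝒜 A + 1 := by
  rw [levelRank, levelSpan_insert]
  have h1 := Submodule.finrank_add_le_finrank_add_finrank
    (Submodule.span (ZMod 2) {levelVec 𝒜 e}) (levelSpan 𝒜 A)
  have h2 := finrank_span_le_card (R := ZMod 2) {levelVec 𝒜 e}
  rw [Set.toFinset_singleton, Finset.card_singleton] at h2
  rw [levelRank]
  omega

/-- The matroid greedy property for all prefixes at once: the later comparison with `x` is made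
prefix by prefix. -/
theorem greedy_initial (k : ℕ) (hk : k ≤ m) :
    levelSpan 𝒜 (greedy 𝒜 r ∩ initial r k) = levelSpan 𝒜 (initial r k) ∧
      (greedy 𝒜 r ∩ initial r k).card = levelRank 𝒜 (initial r k) := by
  induction k with
  | zero =>
    have : initial r 0 = ∅ := by ext e; simp [mem_initial]
    rw [this, Finset.inter_empty]
    refine ⟨rfl, ?_⟩
    rw [levelRank, levelSpan, Finset.coe_empty, Set.image_empty, Submodule.span_empty, finrank_bot,
      Finset.card_empty]
  | succ k ih =>
    obtain ⟨ih1, ih2⟩ := ih (by omega)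
    have hk' : k < m := hk
    set e := r.symm ⟨k, hk'⟩ with he
    have hre : (r e : ℕ) = k := by simp [he]
    have hei : e ∉ initial r k := by rw [mem_initial]; omega
    rw [initial_succ hk']
    by_cases hg : e ∈ greedy 𝒜 r
    · have h1 := mem_greedy.1 hg
      rw [hre] at h1
      rw [Finset.inter_insert_of_mem hg, levelSpan_insert, levelSpan_insert, ih1,
        Finset.card_insert_of_notMem fun h => hei (Finset.mem_inter.1 h).2, ih2]
      refine ⟨rfl, le_antisymm ?_ (levelRank_insert_le _ _)⟩
      exact levelRank_add_one_le (Finset.subset_insert _ _)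
        (levelVec_mem (Finset.mem_insert_self _ _)) h1
    · have h1 := mem_greedy.not.1 hg
      rw [hre, not_not] at h1
      have h2 : levelSpan 𝒜 (insert e (initial r k)) = levelSpan 𝒜 (initial r k) := by
        rw [levelSpan_insert]
        exact sup_eq_right.2 ((Submodule.span_singleton_le_iff_mem _ _).2 h1)
      rw [Finset.inter_insert_of_notMem hg, levelRank, h2]
      exact ⟨ih1, ih2⟩

theorem levelSpan_greedy : levelSpan 𝒜 (greedy 𝒜 r) = levelSpan 𝒜 Finset.univ := by
  have := (greedy_initial (𝒜 := 𝒜) (r := r) m le_rfl).1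
  rwa [initial_eq_univ, Finset.inter_univ] at this

theorem card_greedy : (greedy 𝒜 r).card = levelRank 𝒜 Finset.univ := by
  have := (greedy_initial (𝒜 := 𝒜) (r := r) m le_rfl).2
  rwa [initial_eq_univ, Finset.inter_univ] at this

theorem levelVec_ne_zero_of_mem_greedy {e : Edge V} (he : e ∈ greedy 𝒜 r) : levelVec 𝒜 e ≠ 0 :=
  fun h => mem_greedy.1 he (h ▸ zero_mem _)

theorem levelVec_injOn_greedy {e f : Edge V} (he : e ∈ greedy 𝒜 r) (hf : f ∈ greedy 𝒜 r)
    (h : levelVec 𝒜 e = levelVec 𝒜 f) : e = f := by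
  rcases lt_trichotomy (r e) (r f) with hlt | heq | hlt
  · exact absurd (h ▸ levelVec_mem (mem_initial.2 hlt)) (mem_greedy.1 hf)
  · exact r.injective heq
  · exact absurd (h ▸ levelVec_mem (mem_initial.2 hlt)) (mem_greedy.1 he)

/-- Between two levels that are neighbours at an active cut there is an edge crossing only this
cut. -/
theorem exists_edge_crossing_eq (hchain : ∀ U ∈ 𝒜, ∀ W ∈ 𝒜, U ⊆ W ∨ W ⊆ U) {U : Finset V}
    (hU : U ∈ 𝒜) (hne : U.Nonempty) (hne' : U ≠ Finset.univ) :
    ∃ e : Edge V, crossing 𝒜 e = {U} := by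
  set ℓ : V → ℕ := fun v => (𝒜.filter fun W => v ∉ W).card with hℓ
  have hlt : ∀ W ∈ 𝒜, ∀ a ∈ W, ∀ b, b ∉ W → ℓ a < ℓ b := by
    intro W hW a ha b hb
    refine Finset.card_lt_card ((Finset.ssubset_iff_of_subset ?_).2
      ⟨W, Finset.mem_filter.2 ⟨hW, hb⟩, fun h => (Finset.mem_filter.1 h).2 ha⟩)
    intro X hX
    obtain ⟨hX1, hX2⟩ := Finset.mem_filter.1 hX
    refine Finset.mem_filter.2 ⟨hX1, fun hbX => ?_⟩
    rcases hchain X hX1 W hW with h | h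
    · exact hb (h hbX)
    · exact hX2 (h ha)
  obtain ⟨u, hu, humax⟩ := Finset.exists_max_image U ℓ hne
  have hne'' : (Finset.univ \ U).Nonempty := by
    rw [Finset.sdiff_nonempty]
    exact fun h => hne' (Finset.eq_univ_iff_forall.2 fun v => h (Finset.mem_univ v))
  obtain ⟨v, hv, hvmin⟩ := Finset.exists_min_image (Finset.univ \ U) ℓ hne''
  have hvU : v ∉ U := (Finset.mem_sdiff.1 hv).2
  have huv : u ≠ v := by rintro rfl; exact hvU hu
  refine ⟨mkEdge u v huv, ?_⟩
  ext W
  rw [mem_crossing, Finset.mem_singleton, mkEdge_mem_cut]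
  constructor
  · rintro ⟨hW, hcr⟩
    by_contra hWU
    rcases hchain W hW U hU with h | h
    · obtain ⟨y, hy, hyW⟩ := Finset.exists_of_ssubset (lt_of_le_of_ne h hWU)
      have huW : u ∉ W := fun h' => absurd (humax y hy) (not_le.2 (hlt W hW u h' y hyW))
      have hvW : v ∉ W := fun h' => hvU (h h')
      tauto
    · obtain ⟨y, hy, hyU⟩ := Finset.exists_of_ssubset (lt_of_le_of_ne h (Ne.symm hWU))
      have hvW : v ∈ W := by
        by_contra h'
        exact absurd (hvmin y (by simp [hyU])) (not_le.2 (hlt W hW y hy v h'))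
      have huW := h hu
      tauto
  · rintro rfl
    exact ⟨hU, Or.inl ⟨hu, hvU⟩⟩

variable {B : Finset (Edge V)}

theorem exists_mem_crossing_eq (hB : levelSpan 𝒜 B = levelSpan 𝒜 Finset.univ)
    (hchain : ∀ U ∈ 𝒜, ∀ W ∈ 𝒜, U ⊆ W ∨ W ⊆ U) {U : Finset V} (hU : U ∈ 𝒜)
    (hne : U.Nonempty) (hne' : U ≠ Finset.univ) : ∃ e ∈ B, crossing 𝒜 e = {U} := by
  by_contra! hcon
  obtain ⟨e, he⟩ := exists_edge_crossing_eq hchain hU hne hne'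
  refine cutVec_notMem hcon ?_
  rw [hB]
  exact cutVec_mem (Finset.mem_univ e) he

/-- A spanning set connects each level internally and has, for each active cut, an edge crossing it
alone. Starting from `v` one crosses the cuts one by one towards the level of `s`. -/
theorem joined_of_levelSpan_eq {s t : V} (hB : levelSpan 𝒜 B = levelSpan 𝒜 Finset.univ)
    (hchain : ∀ U ∈ 𝒜, ∀ W ∈ 𝒜, U ⊆ W ∨ W ⊆ U) (hs : ∀ U ∈ 𝒜, s ∈ U) (ht : ∀ U ∈ 𝒜, t ∉ U)
    (v : V) : Joined B v s := by
  have hsame : ∀ u v, (∀ U ∈ 𝒜, u ∈ U ↔ v ∈ U) → Joined B u v := by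
    intro u v huv
    by_cases hne : u = v
    · rw [hne]; exact Joined.refl _ _
    have h1 : pairVec u v ∈ levelSpan 𝒜 B := by
      rw [hB]
      refine Joined.pairVec_mem (Joined.of_mem (h := hne) ?_)
      rw [mem_level]
      refine ⟨Finset.mem_univ _, fun U hU hc => ?_⟩
      have := huv U hU
      rw [mkEdge_mem_cut] at hc
      tauto
    exact (joined_of_pairVec_mem h1).mono (Finset.filter_subset _ _)
  suffices h : ∀ n : ℕ, ∀ v, (𝒜.filter fun U => v ∉ U).card = n → Joined B v s from h _ v rfl
  intro n
  induction n using Nat.strong_induction_on with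
  | _ n ih =>
    intro v hv
    by_cases hne : (𝒜.filter fun U => v ∉ U).Nonempty
    · obtain ⟨U, hU, hmax⟩ := Finset.exists_max_image _ Finset.card hne
      obtain ⟨hU𝒜, hvU⟩ := Finset.mem_filter.1 hU
      have hmax' : ∀ W ∈ 𝒜, v ∉ W → W ⊆ U := by
        intro W hW hvW
        rcases hchain W hW U hU𝒜 with h | h
        · exact h
        · exact (Finset.eq_of_subset_of_card_le h
            (hmax W (Finset.mem_filter.2 ⟨hW, hvW⟩))).symm.subset
      obtain ⟨e, heB, hec⟩ := exists_mem_crossing_eq hB hchain hU𝒜 ⟨s, hs U hU𝒜⟩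
        (fun h => ht U hU𝒜 (h ▸ Finset.mem_univ t))
      have heU : e ∈ cut U := (mem_crossing.1 (hec ▸ Finset.mem_singleton_self U)).2
      obtain ⟨a, ha, b, hb, hab, rfl⟩ := Violator.exists_rep_of_mem_cut heU
      have hother : ∀ W ∈ 𝒜, W ≠ U → (a ∈ W ↔ b ∈ W) := by
        intro W hW hWU
        by_contra hcon
        have : W ∈ crossing 𝒜 (mkEdge a b hab) :=
          mem_crossing.2 ⟨hW, mkEdge_mem_cut.2 (by tauto)⟩
        rw [hec, Finset.mem_singleton] at this
        exact hWU this
      have hvb : Joined B v b := by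
        refine hsame v b fun W hW => ?_
        constructor
        · intro hvW
          have hWU : W ≠ U := by rintro rfl; exact hvU hvW
          refine (hother W hW hWU).1 ?_
          rcases hchain W hW U hU𝒜 with h | h
          · exact absurd (h hvW) hvU
          · exact h ha
        · intro hbW
          by_contra hvW
          exact hb (hmax' W hW hvW hbW)
      refine (hvb.trans (Joined.of_mem heB).symm).trans (ih _ ?_ a rfl)
      rw [← hv]
      refine Finset.card_lt_card ((Finset.ssubset_iff_of_subset ?_).2
        ⟨U, hU, fun h => (Finset.mem_filter.1 h).2 ha⟩)
      intro W hW
      obtain ⟨hW1, hW2⟩ := Finset.mem_filter.1 hW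
      have hWU : W ≠ U := by rintro rfl; exact hW2 ha
      have hbW : b ∉ W := fun h => hW2 ((hother W hW1 hWU).2 h)
      refine Finset.mem_filter.2 ⟨hW1, fun hvW => ?_⟩
      rcases hchain W hW1 U hU𝒜 with h | h
      · exact hvU (h hvW)
      · exact hW2 (h ha)
    · refine hsame v s fun U hU => ⟨fun _ => hs U hU, fun _ => ?_⟩
      by_contra hvU
      exact hne ⟨U, Finset.mem_filter.2 ⟨hU, hvU⟩⟩

theorem card_edgeSet_edgeGraph (A : Finset (Edge V)) : Nat.card (edgeGraph A).edgeSet = A.card := by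
  have : (edgeGraph A).edgeSet = Subtype.val '' (A : Set (Edge V)) := by
    ext e
    simp only [edgeGraph, SimpleGraph.edgeSet_fromEdgeSet, Set.mem_sdiff, Set.mem_ofPred_eq,
      Set.mem_image, Finset.mem_coe, Sym2.mem_diagSet]
    constructor
    · rintro ⟨⟨a, ha, rfl⟩, -⟩
      exact ⟨a, ha, rfl⟩
    · rintro ⟨a, ha, rfl⟩
      exact ⟨⟨a, ha, rfl⟩, a.2⟩
  rw [this, Nat.card_image_of_injective Subtype.val_injective]
  simp

theorem isSpanningTree_iff [Nonempty V] {A : Finset (Edge V)} :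
    IsSpanningTree A ↔ (∀ u v, Joined A u v) ∧ A.card + 1 = Fintype.card V := by
  rw [IsSpanningTree, SimpleGraph.isTree_iff_connected_and_card, card_edgeSet_edgeGraph,
    edgeGraph_connected, Nat.card_eq_fintype_card]

theorem isSpanningTree_greedy {s t : V} (hchain : ∀ U ∈ 𝒜, ∀ W ∈ 𝒜, U ⊆ W ∨ W ⊆ U)
    (hs : ∀ U ∈ 𝒜, s ∈ U) (ht : ∀ U ∈ 𝒜, t ∉ U) : IsSpanningTree (greedy 𝒜 r) := by
  have : Nonempty V := ⟨s⟩
  have hconn : ∀ u v, Joined (greedy 𝒜 r) u v := fun u v =>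
    (joined_of_levelSpan_eq levelSpan_greedy hchain hs ht u).trans
      (joined_of_levelSpan_eq levelSpan_greedy hchain hs ht v).symm
  refine isSpanningTree_iff.2 ⟨hconn, le_antisymm ?_ ?_⟩
  · have hpos : 0 < Fintype.card V := Fintype.card_pos
    have := levelRank_inner_le hchain (Fintype.card V - 1) Finset.univ
      (by rw [Finset.card_univ]; omega)
    rw [inner_univ] at this
    rw [card_greedy]
    omega
  · have := (edgeGraph_connected.2 hconn).card_vert_le_card_edgeSet_add_one
    rwa [card_edgeSet_edgeGraph, Nat.card_eq_fintype_card] at this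

/-- An edge crossing two active cuts has vector zero and is never chosen. All edges crossing only
`U` share one nonzero vector, so exactly one of them is chosen. -/
theorem card_cut_inter_greedy {s t : V} (hchain : ∀ U ∈ 𝒜, ∀ W ∈ 𝒜, U ⊆ W ∨ W ⊆ U)
    (hs : ∀ U ∈ 𝒜, s ∈ U) (ht : ∀ U ∈ 𝒜, t ∉ U) {U : Finset V} (hU : U ∈ 𝒜) :
    (cut U ∩ greedy 𝒜 r).card = 1 := by
  have hvec : ∀ e ∈ cut U ∩ greedy 𝒜 r, crossing 𝒜 e = {U} := by
    intro e he
    obtain ⟨h1, h2⟩ := Finset.mem_inter.1 he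
    have h3 : U ∈ crossing 𝒜 e := mem_crossing.2 ⟨hU, h1⟩
    have h4 := levelVec_ne_zero_of_mem_greedy h2
    by_contra hne
    refine h4 ?_
    rw [levelVec, if_neg (fun h => by
      rw [Finset.card_eq_zero.1 h] at h3; simp at h3), if_neg]
    intro h
    obtain ⟨W, hW⟩ := Finset.card_eq_one.1 h
    rw [hW, Finset.mem_singleton] at h3
    exact hne (h3 ▸ hW)
  rw [Finset.card_eq_one]
  obtain ⟨e, he, hec⟩ := exists_mem_crossing_eq (levelSpan_greedy (𝒜 := 𝒜) (r := r)) hchain hU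
    ⟨s, hs U hU⟩ (fun h => ht U hU (h ▸ Finset.mem_univ t))
  have heU : e ∈ cut U := (mem_crossing.1 (hec ▸ Finset.mem_singleton_self U)).2
  refine ⟨e, Finset.eq_singleton_iff_unique_mem.2 ⟨Finset.mem_inter.2 ⟨heU, he⟩, fun f hf => ?_⟩⟩
  refine levelVec_injOn_greedy (Finset.mem_inter.1 hf).2 he ?_
  rw [levelVec_of_singleton (hvec f hf), levelVec_of_singleton hec]

end Greedy

end PathTSP

namespace PathTSP

/-! ### From the rank inequality to the tree decomposition -/

section Decomposition

variable {V : Type*} [Fintype V] [DecidableEq V] {s t : V} {x : Edge V → ℝ}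

/-- Summation by parts: all partial sums of `d` are nonnegative, the weights decrease, and the
boundary term vanishes because the total is zero. -/
theorem abel_nonneg {a d : ℕ → ℝ} {m : ℕ} (ha : ∀ i, i + 1 < m → a (i + 1) ≤ a i)
    (hd : ∀ k ≤ m, 0 ≤ ∑ i ∈ Finset.range k, d i) (h0 : ∑ i ∈ Finset.range m, d i = 0) :
    0 ≤ ∑ i ∈ Finset.range m, a i * d i := by
  cases m with
  | zero => simp
  | succ m =>
    have h : ∀ n ≤ m, a n * ∑ i ∈ Finset.range (n + 1), d i
        ≤ ∑ i ∈ Finset.range (n + 1), a i * d i := by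
      intro n hn
      induction n with
      | zero => simp
      | succ n ih =>
        have h1 := ih (by omega)
        have h2 := mul_le_mul_of_nonneg_right (ha n (by omega)) (hd (n + 1) (by omega))
        rw [Finset.sum_range_succ, Finset.sum_range_succ _ (n + 1), mul_add]
        linarith
    have := h m le_rfl
    rwa [h0, mul_zero] at this

theorem exists_antitone_enumeration (w : Edge V → ℝ) :
    ∃ (m : ℕ) (r : Edge V ≃ Fin m), ∀ i j : Fin m, i ≤ j → w (r.symm j) ≤ w (r.symm i) := by
  set r₀ := Fintype.equivFin (Edge V)
  set σ := Tuple.sort fun i => - w (r₀.symm i) with hσ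
  refine ⟨_, r₀.trans σ.symm, fun i j hij => ?_⟩
  have := Tuple.monotone_sort (fun i => - w (r₀.symm i)) hij
  simpa using this

theorem sum_initial {m : ℕ} (r : Edge V ≃ Fin m) (f : Edge V → ℝ) {k : ℕ} (hk : k ≤ m) :
    ∑ i ∈ Finset.range k, (if h : i < m then f (r.symm ⟨i, h⟩) else 0) = ∑ e ∈ initial r k, f e := by
  induction k with
  | zero => simp [initial]
  | succ k ih =>
    rw [Finset.sum_range_succ, ih (by omega), initial_succ hk, Finset.sum_insert,
      dif_pos (Nat.lt_of_succ_le hk), add_comm]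
    rw [mem_initial]
    simp

theorem IsFeasible.vecSum_univ (hx : IsFeasible s t x) (hst : s ≠ t) :
    vecSum x Finset.univ = Fintype.card V - 1 := by
  have := hx.sum_degree hst Finset.univ
  have h2 : cut (Finset.univ : Finset V) = ∅ := by
    ext e; simp [cut]
  rw [inner_univ, h2] at this
  simp [vecSum] at this ⊢
  linarith

/-- A spanning tree crossing every active cut exactly once. -/
def IsLevelTree (s t : V) (x : Edge V → ℝ) (θ : ℝ) (S : Finset (Edge V)) : Prop :=
  IsSpanningTree S ∧ ∀ U ∈ narrowCuts s t x, θ ≤ deficiency x U → (cut U ∩ S).card = 1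

/-- One ordering of the edges by decreasing `w` serves all thresholds. On each prefix the averaged
greedy trees attain the averaged rank, which dominates `x`, and both totals are `|V| - 1`. Summation
by parts concludes. -/
theorem LevelWeights.exists_levelTrees_le (W : LevelWeights s t x) (hx : IsFeasible s t x)
    (hst : s ≠ t) (w : Edge V → ℝ) :
    ∃ S : ℝ → Finset (Edge V), (∀ θ, IsLevelTree s t x θ (S θ)) ∧
      ∑ e, w e * x e ≤ ∑ e, w e * ∑ θ ∈ W.support, W.weight θ * if e ∈ S θ then 1 else 0 := by
  obtain ⟨m, r, hr⟩ := exists_antitone_enumeration w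
  set 𝒜 : ℝ → Finset (Finset V) := activeCuts x (narrowCuts s t x) with h𝒜
  have hchain : ∀ θ, ∀ U ∈ 𝒜 θ, ∀ U' ∈ 𝒜 θ, U ⊆ U' ∨ U' ⊆ U := fun θ U hU U' hU' =>
    hx.narrow_chain (mem_activeCuts.1 hU).1 (mem_activeCuts.1 hU').1
  have hs : ∀ θ, ∀ U ∈ 𝒜 θ, s ∈ U := fun θ U hU =>
    (mem_narrowCuts.1 (mem_activeCuts.1 hU).1).1
  have ht : ∀ θ, ∀ U ∈ 𝒜 θ, t ∉ U := fun θ U hU =>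
    (mem_narrowCuts.1 (mem_activeCuts.1 hU).1).2.1
  refine ⟨fun θ => greedy (𝒜 θ) r, fun θ => ⟨isSpanningTree_greedy (hchain θ) (hs θ) (ht θ),
    fun U hU hθ => card_cut_inter_greedy (hchain θ) (hs θ) (ht θ) (mem_activeCuts.2 ⟨hU, hθ⟩)⟩, ?_⟩
  set y : Edge V → ℝ := fun e => ∑ θ ∈ W.support, W.weight θ * if e ∈ greedy (𝒜 θ) r then 1 else 0
    with hy
  have hprefix : ∀ k ≤ m, ∑ e ∈ initial r k, y e = W.rank (narrowCuts s t x) (initial r k) := by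
    intro k hk
    rw [hy, Finset.sum_comm, LevelWeights.rank]
    refine Finset.sum_congr rfl fun θ _ => ?_
    rw [← Finset.mul_sum, Finset.sum_ite_mem, Finset.sum_const, nsmul_eq_mul, mul_one,
      Finset.inter_comm, (greedy_initial k hk).2]
  have hle := fun A => W.vecSum_le_rank hx hst _ (narrowCuts s t x) le_rfl rfl A
  have hD : ∀ k ≤ m, 0 ≤ ∑ e ∈ initial r k, (y e - x e) := by
    intro k hk
    rw [Finset.sum_sub_distrib, hprefix k hk]
    exact sub_nonneg.2 (hle _)
  have hD0 : ∑ e ∈ initial r m, (y e - x e) = 0 := by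
    refine le_antisymm ?_ (hD m le_rfl)
    rw [Finset.sum_sub_distrib, hprefix m le_rfl, initial_eq_univ, sub_nonpos]
    have h1 := hx.vecSum_univ hst
    rw [vecSum] at h1
    rw [h1, LevelWeights.rank]
    have hpos : 0 < Fintype.card V := Fintype.card_pos_iff.2 ⟨s⟩
    calc ∑ θ ∈ W.support, W.weight θ * (levelRank (𝒜 θ) Finset.univ : ℝ)
        ≤ ∑ θ ∈ W.support, W.weight θ * ((Fintype.card V : ℝ) - 1) := by
          refine Finset.sum_le_sum fun θ hθ => mul_le_mul_of_nonneg_left ?_ (W.nonneg θ hθ)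
          have := levelRank_inner_le (hchain θ) (Fintype.card V - 1) Finset.univ
            (by rw [Finset.card_univ]; omega)
          rw [inner_univ] at this
          have h3 : levelRank (𝒜 θ) Finset.univ + 1 ≤ Fintype.card V := by omega
          have h4 : ((levelRank (𝒜 θ) Finset.univ : ℕ) : ℝ) + 1 ≤ Fintype.card V := by
            exact_mod_cast h3
          linarith
      _ = (Fintype.card V : ℝ) - 1 := by rw [← Finset.sum_mul, W.sum_weight, one_mul]
  have key := abel_nonneg (m := m) (a := fun i => if h : i < m then w (r.symm ⟨i, h⟩) else 0)
    (d := fun i => if h : i < m then (fun e => y e - x e) (r.symm ⟨i, h⟩) else 0)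
    (by
      intro i hi
      rw [dif_pos hi, dif_pos (by omega : i < m)]
      exact hr _ _ (by simp [Fin.le_def]))
    (by
      intro k hk
      rw [sum_initial r (fun e => y e - x e) hk]
      exact hD k hk)
    (by rw [sum_initial r (fun e => y e - x e) le_rfl]; exact hD0)
  have h5 : ∑ i ∈ Finset.range m, (if h : i < m then w (r.symm ⟨i, h⟩) else 0)
        * (if h : i < m then (fun e => y e - x e) (r.symm ⟨i, h⟩) else 0)
      = ∑ e, w e * (y e - x e) := by
    rw [← initial_eq_univ (r := r), ← sum_initial r (fun e => w e * (y e - x e)) le_rfl]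
    refine Finset.sum_congr rfl fun i hi => ?_
    rw [dif_pos (Finset.mem_range.1 hi), dif_pos (Finset.mem_range.1 hi),
      dif_pos (Finset.mem_range.1 hi)]
  rw [h5] at key
  simp only [mul_sub, Finset.sum_sub_distrib] at key
  exact sub_nonneg.1 key

/-- A hyperplane strictly separating `x` from these averages would contradict `exists_levelTrees_le`
for its coefficient vector. -/
theorem LevelWeights.mem_convexHull (W : LevelWeights s t x) (hx : IsFeasible s t x)
    (hst : s ≠ t) :
    x ∈ convexHull ℝ {y : Edge V → ℝ | ∃ S : W.support → Finset (Edge V),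
      (∀ θ : W.support, IsLevelTree s t x θ (S θ)) ∧
        y = fun e => ∑ θ : W.support, W.weight θ * if e ∈ S θ then 1 else 0} := by
  set Q := {y : Edge V → ℝ | ∃ S : W.support → Finset (Edge V),
      (∀ θ : W.support, IsLevelTree s t x θ (S θ)) ∧
        y = fun e => ∑ θ : W.support, W.weight θ * if e ∈ S θ then 1 else 0} with hQ
  have hfin : Q.Finite := by
    refine (Set.finite_range fun (S : W.support → Finset (Edge V)) => fun e : Edge V =>
      ∑ θ : W.support, W.weight θ * if e ∈ S θ then (1 : ℝ) else 0).subset ?_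
    rintro y ⟨S, -, rfl⟩
    exact ⟨S, rfl⟩
  by_contra hcon
  obtain ⟨f, u, hf, hfx⟩ := geometric_hahn_banach_closed_point (convex_convexHull ℝ Q)
    (hfin.isClosed_convexHull ℝ) hcon
  have hfw : ∀ y : Edge V → ℝ, f y = ∑ e, f (Pi.single e 1) * y e := by
    intro y
    conv_lhs => rw [← Finset.univ_sum_single y]
    rw [map_sum]
    refine Finset.sum_congr rfl fun e _ => ?_
    have : (Pi.single e (y e) : Edge V → ℝ) = y e • Pi.single e 1 := by
      rw [← Pi.single_smul, smul_eq_mul, mul_one]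
    rw [this, map_smul, smul_eq_mul, mul_comm]
  obtain ⟨S, hS, hle⟩ := W.exists_levelTrees_le hx hst fun e => f (Pi.single e 1)
  have h1 := hf _ (subset_convexHull ℝ Q ⟨fun θ => S θ, fun θ => hS θ, rfl⟩)
  rw [hfw] at h1 hfx
  have h2 : ∀ e : Edge V, ∑ θ : W.support, W.weight θ * (if e ∈ S θ then (1 : ℝ) else 0)
      = ∑ θ ∈ W.support, W.weight θ * if e ∈ S θ then (1 : ℝ) else 0 := fun e =>
    Finset.sum_coe_sort W.support fun θ => W.weight θ * if e ∈ S θ then (1 : ℝ) else 0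
  simp only [h2] at h1
  linarith

/-- Arranging a convex combination of trees by a key yields a decomposition. -/
theorem exists_treeDecomposition_of_key {ι : Type*} [Fintype ι] (p key : ι → ℝ)
    (S : ι → Finset (Edge V)) (tree : ∀ i, IsSpanningTree (S i)) (nonneg : ∀ i, 0 ≤ p i)
    (sum_eq_one : ∑ i, p i = 1) (eq_sum : ∀ e, x e = ∑ i, p i * (if e ∈ S i then 1 else 0))
    (sum_key : ∀ U ∈ narrowCuts s t x, ∑ i, (if key i ≤ deficiency x U then p i else 0)
      = deficiency x U)
    (card_eq : ∀ U ∈ narrowCuts s t x, ∀ i, key i ≤ deficiency x U → (cut U ∩ S i).card = 1) :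
    Nonempty (TreeDecomposition s t x) := by
  set r₀ := Fintype.equivFin ι
  set σ := Tuple.sort fun i => key (r₀.symm i) with hσ
  set r : Fin (Fintype.card ι) ≃ ι := σ.trans r₀.symm with hr
  have hmono : ∀ i j, i ≤ j → key (r i) ≤ key (r j) := fun i j hij =>
    Tuple.monotone_sort (fun i => key (r₀.symm i)) hij
  refine ⟨⟨_, fun i => p (r i), fun i => S (r i), fun i => tree _, fun i => nonneg _, ?_, ?_, ?_⟩⟩
  · rw [← sum_eq_one]; exact Equiv.sum_comp r p
  · intro e
    rw [eq_sum e]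
    exact (Equiv.sum_comp r fun i => p i * if e ∈ S i then 1 else 0).symm
  · intro U hU
    have h1 := sum_key U hU
    rw [← Equiv.sum_comp r, ← Finset.sum_filter] at h1
    have hne : (Finset.univ.filter fun i => key (r i) ≤ deficiency x U).Nonempty := by
      rw [Finset.nonempty_iff_ne_empty]
      intro h
      rw [h, Finset.sum_empty] at h1
      exact (deficiency_pos hU).ne h1
    -- After sorting, the trees with key at most the deficiency form an initial segment; it is
    -- nonempty because a deficiency is positive.
    refine ⟨Finset.max' _ hne, ?_, ?_⟩
    · rw [← deficiency_narrow hU]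
      refine Eq.trans ?_ h1
      refine Finset.sum_congr ?_ fun _ _ => rfl
      ext i
      rw [Finset.mem_Iic, Finset.mem_filter]
      constructor
      · intro hi
        exact ⟨Finset.mem_univ _, (hmono _ _ hi).trans
          (Finset.mem_filter.1 (Finset.max'_mem _ hne)).2⟩
      · intro hi
        exact Finset.le_max' _ _ (Finset.mem_filter.2 hi)
    · intro j hj
      exact card_eq U hU _ ((hmono _ _ hj).trans
        (Finset.mem_filter.1 (Finset.max'_mem _ hne)).2)

/-- Index the trees by a point of the convex combination and a threshold, with the product weight
and the threshold as key. Keys up to a deficiency `y` then weigh `y` in total. -/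
theorem IsFeasible.exists_treeDecomposition (hx : IsFeasible s t x) (hst : s ≠ t) :
    Nonempty (TreeDecomposition s t x) := by
  obtain ⟨W⟩ := hx.exists_levelWeights
  have hmem := W.mem_convexHull hx hst
  rw [convexHull_eq] at hmem
  obtain ⟨ι, T, lam, z, hl0, hl1, hz, hxe⟩ := hmem
  rw [Finset.centerMass_eq_of_sum_1 _ _ hl1] at hxe
  choose! S hS hzS using hz
  have hl1' : ∑ i : T, lam i = 1 := by
    rw [← hl1]; exact Finset.sum_coe_sort T lam
  have hw1 : ∑ θ : W.support, W.weight θ = 1 := by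
    rw [← W.sum_weight]; exact Finset.sum_coe_sort W.support W.weight
  refine exists_treeDecomposition_of_key (ι := T × W.support)
    (fun i => lam i.1 * W.weight i.2) (fun i => i.2) (fun i => S i.1 i.2)
    (fun i => (hS i.1 i.1.2 i.2).1) (fun i => mul_nonneg (hl0 i.1 i.1.2) (W.nonneg _ i.2.2)) ?_ ?_ ?_
    (fun U hU i hi => (hS i.1 i.1.2 i.2).2 U hU hi)
  · rw [Fintype.sum_prod_type]
    simp only [← Finset.mul_sum, hw1, mul_one, hl1']
  · intro e
    have hxe' := congrFun hxe e
    rw [Finset.sum_apply] at hxe'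
    rw [Fintype.sum_prod_type, ← hxe', ← Finset.sum_coe_sort]
    refine Finset.sum_congr rfl fun i _ => ?_
    rw [Pi.smul_apply, smul_eq_mul, hzS i i.2, Finset.mul_sum]
    exact Finset.sum_congr rfl fun θ _ => by ring
  · intro U hU
    rw [Fintype.sum_prod_type]
    have h2 : ∀ i : T, ∑ θ : W.support, (if (θ : ℝ) ≤ deficiency x U then lam i * W.weight θ else 0)
        = lam i * deficiency x U := by
      intro i
      have h3 := W.tail _ (Or.inr ⟨U, hU, rfl⟩)
      have h4 := Finset.sum_filter_add_sum_filter_not W.support (fun θ => θ ≤ deficiency x U)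
        W.weight
      simp only [not_le] at h4
      rw [h3, W.sum_weight] at h4
      rw [Finset.sum_coe_sort W.support
        fun θ => if (θ : ℝ) ≤ deficiency x U then lam i * W.weight θ else 0, ← Finset.sum_filter,
        ← Finset.mul_sum]
      congr 1
      linarith
    simp only [h2, ← Finset.sum_mul, hl1', one_mul]

end Decomposition

end PathTSP

namespace PathTSP

/-! ### Chains of cuts met by connected graphs -/

section Lonely

variable {V : Type*} [Fintype V] [DecidableEq V]

theorem IsSpanningTree.joined {A : Finset (Edge V)} (h : IsSpanningTree A) (u v : V) :
    Joined A u v := by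
  have : Nonempty V := ⟨u⟩
  exact (isSpanningTree_iff.1 h).1 u v

/-- A cut that contains exactly one edge of a connected graph is determined by this edge. -/
theorem eq_of_inter_cut_eq {A : Finset (Edge V)} (hA : ∀ u v, Joined A u v) {U W : Finset V}
    (h : cut U ∩ A = cut W ∩ A) {s : V} (hsU : s ∈ U) (hsW : s ∈ W) : U = W := by
  ext v
  by_contra hcon
  have hv : v ∈ symmDiff U W := by rw [Finset.mem_symmDiff]; tauto
  have hs : s ∉ symmDiff U W := by rw [Finset.mem_symmDiff]; tauto
  obtain ⟨y, hy, y', hy', ⟨hne, hm⟩, -⟩ := (hA v s).exists_crossing hv hs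
  have h1 : mkEdge y y' hne ∈ cut U ↔ mkEdge y y' hne ∈ cut W := by
    constructor
    · intro h2
      exact (Finset.mem_inter.1 (h ▸ Finset.mem_inter.2 ⟨h2, hm⟩)).1
    · intro h2
      exact (Finset.mem_inter.1 (h.symm ▸ Finset.mem_inter.2 ⟨h2, hm⟩)).1
  rw [Finset.mem_symmDiff] at hy hy'
  rw [mkEdge_mem_cut, mkEdge_mem_cut] at h1
  clear hcon hv hs
  tauto

theorem inter_cut_eq_singleton {A : Finset (Edge V)} {U : Finset V} (h : (cut U ∩ A).card = 1)
    {e : Edge V} (heU : e ∈ cut U) (heA : e ∈ A) : cut U ∩ A = {e} := by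
  obtain ⟨f, hf⟩ := Finset.card_eq_one.1 h
  have : e ∈ cut U ∩ A := Finset.mem_inter.2 ⟨heU, heA⟩
  rw [hf, Finset.mem_singleton] at this
  rw [this, hf]

open Classical in
theorem joined_of_oddVertices_eq {P : Finset (Edge V)} {u v : V}
    (h : oddVertices P = symmDiff {u} {v}) : Joined P u v := by
  by_contra hcon
  set K : Finset V := Finset.univ.filter fun w => Joined P u w
  obtain ⟨a, ha, b, hb, hne, hm⟩ := exists_mem_cut_of_parity (cutParity_of_join h (K := K)
    (Finset.mem_filter.2 ⟨Finset.mem_univ _, Joined.refl _ _⟩)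
    fun h => hcon (Finset.mem_filter.1 h).2)
  exact hb (Finset.mem_filter.2 ⟨Finset.mem_univ _,
    (Finset.mem_filter.1 ha).2.trans (Joined.of_mem hm)⟩)

/-- The edges of a connected graph crossing a chain of cuts are at least as many as the cuts. -/
theorem card_le_card_crossing {A : Finset (Edge V)} (hA : ∀ u v, Joined A u v)
    {𝒦 : Finset (Finset V)} (hchain : ∀ U ∈ 𝒦, ∀ W ∈ 𝒦, U ⊆ W ∨ W ⊆ U) {s t : V}
    (hs : ∀ U ∈ 𝒦, s ∈ U) (ht : ∀ U ∈ 𝒦, t ∉ U) :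
    𝒦.card ≤ (𝒦.biUnion fun U => cut U ∩ A).card := by
  set X := 𝒦.biUnion fun U => cut U ∩ A with hX
  -- The restricted incidence map of cuts and edges. For `g` in its kernel, the potential adding up
  -- `g` over the cuts containing a vertex is constant along `A`, hence constant. An edge of the
  -- complete graph that crosses only `U` then gives `g U = 0`.
  let Φ : (𝒦 → ZMod 2) →ₗ[ZMod 2] (X → ZMod 2) :=
    { toFun := fun g e => ∑ U : 𝒦, if (e : Edge V) ∈ cut (U : Finset V) then g U else 0
      map_add' := by
        intro g g'
        ext e
        simp only [Pi.add_apply]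
        rw [← Finset.sum_add_distrib]
        refine Finset.sum_congr rfl fun U _ => ?_
        split_ifs <;> simp
      map_smul' := by
        intro a g
        ext e
        simp only [Pi.smul_apply, smul_eq_mul, RingHom.id_apply]
        rw [Finset.mul_sum]
        refine Finset.sum_congr rfl fun U _ => ?_
        split_ifs <;> simp }
  have hinj : Function.Injective Φ := by
    rw [← LinearMap.ker_eq_bot, LinearMap.ker_eq_bot']
    intro g hg
    set φ : V → ZMod 2 := fun v => ∑ U : 𝒦, if v ∈ (U : Finset V) then g U else 0 with hφ
    have hedge : ∀ u v, ∀ hne : u ≠ v, φ u + φ v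
        = ∑ U : 𝒦, if mkEdge u v hne ∈ cut (U : Finset V) then g U else 0 := by
      intro u v hne
      rw [hφ, ← Finset.sum_add_distrib]
      refine Finset.sum_congr rfl fun U _ => ?_
      simp only [mkEdge_mem_cut]
      by_cases h1 : u ∈ (U : Finset V) <;> by_cases h2 : v ∈ (U : Finset V) <;> simp [h1, h2]
      exact CharTwo.add_self_eq_zero _
    have hstep : ∀ u v, EdgeRel A u v → φ u = φ v := by
      rintro u v ⟨hne, hm⟩
      refine CharTwo.add_eq_zero.1 ?_
      rw [hedge u v hne]
      by_cases he : mkEdge u v hne ∈ X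
      · exact congrFun hg ⟨_, he⟩
      · refine Finset.sum_eq_zero fun U _ => if_neg fun h => he ?_
        exact Finset.mem_biUnion.2 ⟨U, U.2, Finset.mem_inter.2 ⟨h, hm⟩⟩
    have hconst : ∀ u v, φ u = φ v := by
      intro u v
      induction hA u v with
      | refl => rfl
      | tail _ hbc ih => exact ih.trans (hstep _ _ hbc)
    ext U
    obtain ⟨e, he⟩ := exists_edge_crossing_eq hchain U.2 ⟨s, hs U U.2⟩
      (fun h => ht U U.2 (h ▸ Finset.mem_univ t))
    obtain ⟨u, v, hne, rfl⟩ := e.exists_rep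
    have h1 := hedge u v hne
    rw [hconst u v, CharTwo.add_self_eq_zero] at h1
    rw [Pi.zero_apply, h1]
    have hmem : ∀ W : 𝒦, mkEdge u v hne ∈ cut (W : Finset V) ↔ W = U := by
      intro W
      have h2 : (W : Finset V) ∈ crossing 𝒦 (mkEdge u v hne) ↔ (W : Finset V) = U := by
        rw [he, Finset.mem_singleton]
      rw [mem_crossing] at h2
      rw [← Subtype.coe_inj, ← h2]
      exact ⟨fun h => ⟨W.2, h⟩, fun h => h.2⟩
    simp [hmem]
  have := LinearMap.finrank_le_finrank_of_injective hinj
  simpa using this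

/-- The weight of a chain of cuts is covered by the maximum weights seen by a connected graph. -/
theorem sum_le_sum_of_chain {A : Finset (Edge V)} (hA : ∀ u v, Joined A u v)
    {𝒦 : Finset (Finset V)} (hchain : ∀ U ∈ 𝒦, ∀ W ∈ 𝒦, U ⊆ W ∨ W ⊆ U) {s t : V}
    (hs : ∀ U ∈ 𝒦, s ∈ U) (ht : ∀ U ∈ 𝒦, t ∉ U) (a : Finset V → ℝ) (b : Edge V → ℝ)
    (hb : ∀ e, 0 ≤ b e) (hab : ∀ U ∈ 𝒦, ∀ e ∈ cut U, a U ≤ b e) :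
    ∑ U ∈ 𝒦, a U ≤ ∑ e ∈ A, b e := by
  classical
  -- Hall's condition holds because each subfamily is again a chain; this gives distinct
  -- representatives in `A` for the cuts.
  obtain ⟨f, hf, hfm⟩ := (Finset.all_card_le_biUnion_card_iff_exists_injective
    fun U : 𝒦 => cut (U : Finset V) ∩ A).1 (by
      intro 𝒦'
      have h1 := card_le_card_crossing hA (𝒦 := 𝒦'.map (Function.Embedding.subtype _))
        (by
          intro U hU W hW
          simp only [Finset.mem_map, Function.Embedding.coe_subtype, Subtype.exists, exists_and_right,
            exists_eq_right] at hU hW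
          exact hchain U hU.1 W hW.1)
        (s := s) (t := t)
        (by
          intro U hU
          simp only [Finset.mem_map, Function.Embedding.coe_subtype, Subtype.exists, exists_and_right,
            exists_eq_right] at hU
          exact hs U hU.1)
        (by
          intro U hU
          simp only [Finset.mem_map, Function.Embedding.coe_subtype, Subtype.exists, exists_and_right,
            exists_eq_right] at hU
          exact ht U hU.1)
      rw [Finset.card_map] at h1
      refine h1.trans (Finset.card_le_card ?_)
      intro e he
      obtain ⟨U, hU, heU⟩ := Finset.mem_biUnion.1 he
      obtain ⟨U', hU', rfl⟩ := Finset.mem_map.1 hU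
      exact Finset.mem_biUnion.2 ⟨U', hU', heU⟩)
  calc ∑ U ∈ 𝒦, a U = ∑ U : 𝒦, a U := (Finset.sum_coe_sort 𝒦 a).symm
    _ ≤ ∑ U : 𝒦, b (f U) :=
        Finset.sum_le_sum fun U _ => hab U U.2 _ (Finset.mem_inter.1 (hfm U)).1
    _ = ∑ e ∈ Finset.univ.image f, b e := (Finset.sum_image fun U _ W _ h => hf h).symm
    _ ≤ ∑ e ∈ A, b e := by
        refine Finset.sum_le_sum_of_subset_of_nonneg ?_ fun e _ _ => hb e
        intro e he
        obtain ⟨U, -, rfl⟩ := Finset.mem_image.1 he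
        exact (Finset.mem_inter.1 (hfm U)).2

theorem edgeCost_nonneg [MetricSpace V] (e : Sym2 V) : 0 ≤ edgeCost e := by
  induction e using Sym2.ind with
  | _ u v => exact dist_nonneg

theorem setCost_nonneg [MetricSpace V] (A : Finset (Edge V)) : 0 ≤ setCost A :=
  Finset.sum_nonneg fun e _ => edgeCost_nonneg e.1

theorem setCost_biUnion_le [MetricSpace V] {ι : Type*} (I : Finset ι) (f : ι → Finset (Edge V)) :
    setCost (I.biUnion f) ≤ ∑ i ∈ I, setCost (f i) := by
  classical
  induction I using Finset.induction_on with
  | empty => simp [setCost]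
  | insert a I ha ih =>
    rw [Finset.biUnion_insert, Finset.sum_insert ha]
    have h1 : setCost (f a ∪ I.biUnion f) + setCost (f a ∩ I.biUnion f)
        = setCost (f a) + setCost (I.biUnion f) := Finset.sum_union_inter
    linarith [setCost_nonneg (f a ∩ I.biUnion f)]

end Lonely

/-! ### Lonely cuts of a tree and the modified cost -/

namespace TreeDecomposition

variable {V : Type*} [Fintype V] [DecidableEq V] {s t : V} {x : Edge V → ℝ}
  (D : TreeDecomposition s t x) {j : Fin D.k}

theorem mem_lonelyCuts {U : Finset V} : U ∈ D.lonelyCuts j ↔ U ∈ narrowCuts s t x ∧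
    (cut U ∩ D.S j).card = 1 ∧ ∑ i ∈ Finset.Iic j, D.p i ≤ 2 - vecSum x (cut U) := by
  simp [lonelyCuts]

theorem forest_subset : D.forest j ⊆ D.S j := Finset.sdiff_subset

theorem exists_lonelyCut_of_notMem_forest {e : Edge V} (he : e ∈ D.S j) (he' : e ∉ D.forest j) :
    ∃ U ∈ D.lonelyCuts j, e ∈ cut U := by
  have : e ∈ D.lonelyEdges j := by
    by_contra h
    exact he' (Finset.mem_sdiff.2 ⟨he, h⟩)
  obtain ⟨U, hU, heU⟩ := Finset.mem_biUnion.1 this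
  exact ⟨U, hU, (Finset.mem_inter.1 heU).1⟩

theorem forest_inter_cut {U : Finset V} (hU : U ∈ D.lonelyCuts j) : D.forest j ∩ cut U = ∅ := by
  rw [Finset.eq_empty_iff_forall_notMem]
  intro e he
  obtain ⟨h1, h2⟩ := Finset.mem_inter.1 he
  obtain ⟨h3, h4⟩ := Finset.mem_sdiff.1 h1
  exact h4 (Finset.mem_biUnion.2 ⟨U, hU, Finset.mem_inter.2 ⟨h2, h3⟩⟩)

/-- Different lonely cuts have different lonely edges. -/
theorem eq_of_mem_cut {U W : Finset V} (hU : U ∈ narrowCuts s t x) (hW : W ∈ narrowCuts s t x)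
    (hU1 : (cut U ∩ D.S j).card = 1) (hW1 : (cut W ∩ D.S j).card = 1) {e : Edge V}
    (he : e ∈ D.S j) (heU : e ∈ cut U) (heW : e ∈ cut W) : U = W :=
  eq_of_inter_cut_eq (D.tree j).joined
    ((inter_cut_eq_singleton hU1 heU he).trans (inter_cut_eq_singleton hW1 heW he).symm)
    (mem_narrowCuts.1 hU).1 (mem_narrowCuts.1 hW).1

/-- This shows that `Tⱼ`-joins exist, and it translates parities of `Tⱼ` into parities of cuts of
`Fⱼ` together with the edge `st`. -/
theorem isTJoin_wrongParity (hst : s ≠ t) :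
    IsTJoin (D.wrongParity j) (symmDiff (D.forest j) {mkEdge s t hst}) := by
  rw [IsTJoin, oddVertices_symmDiff, oddVertices_singleton, wrongParity]
  congr 1
  ext v
  simp only [Finset.mem_symmDiff, Finset.mem_singleton, Finset.mem_insert]
  constructor
  · rintro (⟨h, -⟩ | ⟨h, -⟩) <;> simp [h]
  · rintro (rfl | rfl)
    · exact Or.inl ⟨rfl, hst⟩
    · exact Or.inr ⟨rfl, hst.symm⟩

theorem odd_inter_wrongParity (hst : s ≠ t) (X : Finset V) : Odd (X ∩ D.wrongParity j).card ↔
    cutParity (D.forest j) X + (if mkEdge s t hst ∈ cut X then 1 else 0) = 1 := by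
  have h := D.isTJoin_wrongParity (j := j) hst
  rw [IsTJoin] at h
  rw [← h, ← odd_inter_cut_iff_odd_inter, odd_inter_cut_iff, cutParity_symmDiff,
    cutParity_eq_sum {_}, Finset.sum_singleton]

/-- The forest has no edge in a lonely cut, so only the edge `st` contributes. Hence every `Tⱼ`-join
must cross all lonely cuts. -/
theorem odd_inter_of_lonely (hst : s ≠ t) {U : Finset V} (hU : U ∈ D.lonelyCuts j) :
    Odd (U ∩ D.wrongParity j).card := by
  obtain ⟨h1, h2, -⟩ := mem_narrowCuts.1 (D.mem_lonelyCuts.1 hU).1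
  rw [D.odd_inter_wrongParity hst, cutParity, D.forest_inter_cut hU,
    if_pos (mkEdge_mem_cut.2 (Or.inl ⟨h1, h2⟩))]
  simp

/-- A cut with the wrong parity that separates `s` and `t` and is not lonely is crossed at least
twice. -/
theorem two_le_card_of_not_lonely (hst : s ≠ t) {U : Finset V} (hU : U ∈ narrowCuts s t x)
    (hodd : Odd (U ∩ D.wrongParity j).card) (hl : U ∉ D.lonelyCuts j) :
    2 ≤ (cut U ∩ D.S j).card := by
  obtain ⟨h1, h2, -⟩ := mem_narrowCuts.1 hU
  rw [D.odd_inter_wrongParity hst, if_pos (mkEdge_mem_cut.2 (Or.inl ⟨h1, h2⟩)),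
    add_eq_right, cutParity] at hodd
  obtain ⟨y, hy, y', hy', ⟨hne, hm⟩, -⟩ := ((D.tree j).joined s t).exists_crossing h1 h2
  have hmem : mkEdge y y' hne ∈ cut U ∩ D.S j :=
    Finset.mem_inter.2 ⟨mkEdge_mem_cut.2 (Or.inl ⟨hy, hy'⟩), hm⟩
  have hpos : 0 < (cut U ∩ D.S j).card := Finset.card_pos.2 ⟨_, hmem⟩
  by_contra hlt
  have hone : (cut U ∩ D.S j).card = 1 := by omega
  have hnf : mkEdge y y' hne ∉ D.forest j := by
    intro hf
    have h3 : D.forest j ∩ cut U = {mkEdge y y' hne} := by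
      refine Finset.Subset.antisymm ?_ (Finset.singleton_subset_iff.2
        (Finset.mem_inter.2 ⟨hf, (Finset.mem_inter.1 hmem).1⟩))
      rw [← inter_cut_eq_singleton hone (Finset.mem_inter.1 hmem).1 hm, Finset.inter_comm]
      exact Finset.inter_subset_inter_left D.forest_subset
    rw [h3] at hodd
    simp at hodd
  obtain ⟨W, hW, heW⟩ := D.exists_lonelyCut_of_notMem_forest hm hnf
  have hW' := D.mem_lonelyCuts.1 hW
  rw [D.eq_of_mem_cut hU hW'.1 hone hW'.2.1 hm (Finset.mem_inter.1 hmem).1 heW] at hl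
  exact hl hW

variable [MetricSpace V]

/-- The maximum that is subtracted in the modified cost. -/
noncomputable def saving (j : Fin D.k) (e : Edge V) : ℝ :=
  Finset.fold max 0 (fun U => 2 * setCost (cut U ∩ D.S j))
    ((D.lonelyCuts j).filter (fun U => e ∈ cut U))

theorem modCost_eq (j : Fin D.k) (e : Edge V) : D.modCost j e = edgeCost e.1
    + ∑ U ∈ (D.lonelyCuts j).filter (fun U => e ∈ cut U), 2 * setCost (cut U ∩ D.S j)
    - D.saving j e := rfl

theorem saving_nonneg (e : Edge V) : 0 ≤ D.saving j e := by
  rw [saving, Finset.le_fold_max]; exact Or.inl le_rfl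

theorem le_saving {e : Edge V} {U : Finset V} (hU : U ∈ D.lonelyCuts j) (he : e ∈ cut U) :
    2 * setCost (cut U ∩ D.S j) ≤ D.saving j e := by
  rw [saving, Finset.le_fold_max]
  exact Or.inr ⟨U, Finset.mem_filter.2 ⟨hU, he⟩, le_rfl⟩

theorem saving_eq (e : Edge V) : ((D.lonelyCuts j).filter (fun U => e ∈ cut U) = ∅ ∧
      D.saving j e = 0) ∨
    ∃ U ∈ (D.lonelyCuts j).filter (fun U => e ∈ cut U),
      D.saving j e = 2 * setCost (cut U ∩ D.S j) := by
  by_cases hne : ((D.lonelyCuts j).filter (fun U => e ∈ cut U)).Nonempty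
  · right
    obtain ⟨U, hU, hmax⟩ := Finset.exists_max_image _
      (fun U => 2 * setCost (cut U ∩ D.S j)) hne
    refine ⟨U, hU, le_antisymm ?_ (D.le_saving (Finset.mem_filter.1 hU).1
      (Finset.mem_filter.1 hU).2)⟩
    rw [saving, Finset.fold_max_le]
    exact ⟨mul_nonneg zero_le_two (setCost_nonneg _), hmax⟩
  · left
    rw [Finset.not_nonempty_iff_eq_empty] at hne
    refine ⟨hne, ?_⟩
    rw [saving, hne, Finset.fold_empty]

/-- The subtracted maximum is zero or one of the summands. Nonnegative costs are what
`exists_join_le` asks for. -/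
theorem modCost_nonneg (e : Edge V) : 0 ≤ D.modCost j e := by
  rw [modCost_eq]
  have h0 := edgeCost_nonneg e.1
  rcases D.saving_eq (j := j) e with ⟨h1, h2⟩ | ⟨U, hU, h2⟩
  · rw [h1, h2]; simpa using h0
  · have := Finset.single_le_sum (f := fun U => 2 * setCost (cut U ∩ D.S j))
      (fun U _ => mul_nonneg zero_le_two (setCost_nonneg _)) hU
    linarith

theorem modCost_eq_edgeCost {e : Edge V}
    (h : ∀ U ∈ D.lonelyCuts j, ∀ W ∈ D.lonelyCuts j, e ∈ cut U → e ∈ cut W → U = W) :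
    D.modCost j e = edgeCost e.1 := by
  rw [modCost_eq]
  rcases D.saving_eq (j := j) e with ⟨h1, h2⟩ | ⟨U, hU, h2⟩
  · rw [h1, h2]; simp
  · have : (D.lonelyCuts j).filter (fun U => e ∈ cut U) = {U} := by
      refine Finset.eq_singleton_iff_unique_mem.2 ⟨hU, fun W hW => ?_⟩
      rw [Finset.mem_filter] at hU hW
      exact h W hW.1 U hU.1 hW.2 hU.2
    rw [h2, this, Finset.sum_singleton]
    ring

/-- An edge of `Sⱼ` lies in at most one lonely cut, so sum and maximum cancel. -/
theorem modCost_of_mem_tree {e : Edge V} (he : e ∈ D.S j) : D.modCost j e = edgeCost e.1 :=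
  D.modCost_eq_edgeCost fun _ hU _ hW heU heW =>
    D.eq_of_mem_cut (D.mem_lonelyCuts.1 hU).1 (D.mem_lonelyCuts.1 hW).1
      (D.mem_lonelyCuts.1 hU).2.1 (D.mem_lonelyCuts.1 hW).2.1 he heU heW

theorem setCost_forest_add :
    setCost (D.forest j) + ∑ U ∈ D.lonelyCuts j, setCost (cut U ∩ D.S j) = setCost (D.S j) := by
  have h1 : setCost (D.lonelyEdges j) = ∑ U ∈ D.lonelyCuts j, setCost (cut U ∩ D.S j) := by
    rw [setCost, lonelyEdges, Finset.sum_biUnion]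
    · rfl
    · intro U hU W hW hne
      rw [Function.onFun, Finset.disjoint_left]
      intro e heU heW
      rw [Finset.mem_inter] at heU heW
      have hU' := D.mem_lonelyCuts.1 hU
      have hW' := D.mem_lonelyCuts.1 hW
      exact hne (D.eq_of_mem_cut hU'.1 hW'.1 hU'.2.1 hW'.2.1 heU.2 heU.1 heW.1)
  rw [← h1]
  refine Finset.sum_sdiff ?_
  intro e he
  obtain ⟨U, -, heU⟩ := Finset.mem_biUnion.1 he
  exact (Finset.mem_inter.1 heU).2

/-- Each tree of the combination picks up savings of at least the total over all lonely cuts, by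
`sum_le_sum_of_chain`; averaging over the trees transfers this to `x`. This accounts for the `- 1`.
-/
theorem sum_modCost_mul_le (hx : IsFeasible s t x) :
    ∑ e, D.modCost j e * x e ≤ vecCost x
      + ∑ U ∈ D.lonelyCuts j, 2 * setCost (cut U ∩ D.S j) * (vecSum x (cut U) - 1) := by
  have h1 : ∑ U ∈ D.lonelyCuts j, 2 * setCost (cut U ∩ D.S j) ≤ ∑ e, D.saving j e * x e := by
    have h2 : ∀ i, ∑ U ∈ D.lonelyCuts j, 2 * setCost (cut U ∩ D.S j)
        ≤ ∑ e ∈ D.S i, D.saving j e := fun i =>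
      sum_le_sum_of_chain (D.tree i).joined
        (fun U hU W hW => hx.narrow_chain (D.mem_lonelyCuts.1 hU).1 (D.mem_lonelyCuts.1 hW).1)
        (fun U hU => (mem_narrowCuts.1 (D.mem_lonelyCuts.1 hU).1).1)
        (fun U hU => (mem_narrowCuts.1 (D.mem_lonelyCuts.1 hU).1).2.1)
        _ _ (fun e => D.saving_nonneg e) (fun U hU e he => D.le_saving hU he)
    calc ∑ U ∈ D.lonelyCuts j, 2 * setCost (cut U ∩ D.S j)
        = ∑ i, D.p i * ∑ U ∈ D.lonelyCuts j, 2 * setCost (cut U ∩ D.S j) := by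
          rw [← Finset.sum_mul, D.sum_eq_one, one_mul]
      _ ≤ ∑ i, D.p i * ∑ e ∈ D.S i, D.saving j e :=
          Finset.sum_le_sum fun i _ => mul_le_mul_of_nonneg_left (h2 i) (D.nonneg i)
      _ = ∑ i, ∑ e, D.saving j e * (D.p i * if e ∈ D.S i then 1 else 0) := by
          refine Finset.sum_congr rfl fun i _ => ?_
          have h4 := vecSum_eq_sum_ite (D.saving j) (D.S i)
          rw [vecSum] at h4
          rw [h4, Finset.mul_sum]
          refine Finset.sum_congr rfl fun e _ => ?_
          split_ifs <;> ring
      _ = ∑ e, D.saving j e * x e := by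
          rw [Finset.sum_comm]
          refine Finset.sum_congr rfl fun e _ => ?_
          rw [D.eq_sum e, Finset.mul_sum]
  have h3 : ∑ e, (∑ U ∈ (D.lonelyCuts j).filter (fun U => e ∈ cut U),
        2 * setCost (cut U ∩ D.S j)) * x e
      = ∑ U ∈ D.lonelyCuts j, 2 * setCost (cut U ∩ D.S j) * vecSum x (cut U) := by
    simp only [Finset.sum_filter, Finset.sum_mul]
    rw [Finset.sum_comm]
    refine Finset.sum_congr rfl fun U _ => ?_
    rw [vecSum_eq_sum_ite, Finset.mul_sum]
    refine Finset.sum_congr rfl fun e _ => ?_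
    split_ifs <;> simp
  simp only [modCost_eq, sub_mul, add_mul, Finset.sum_sub_distrib, Finset.sum_add_distrib, h3,
    mul_sub, mul_one]
  rw [vecCost]
  linarith

end TreeDecomposition

end PathTSP

namespace PathTSP

/-! ### Reconnection, existence of tours, and the basic tour bound -/

namespace TreeDecomposition

variable {V : Type*} [Fintype V] [DecidableEq V] {s t : V} {x : Edge V → ℝ}
  (D : TreeDecomposition s t x) {j : Fin D.k}

/-- If an edge of a wrong parity join replaces the lonely edge of one of its lonely cuts, then the
lonely edges of its other lonely cuts suffice to reconnect the ends of the replaced edge. -/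
theorem joined_of_exchange {Z : Finset (Edge V)} (hF : D.forest j ⊆ Z) {a b : V} {hab : a ≠ b}
    (habZ : mkEdge a b hab ∈ Z) {U : Finset V} (hU : U ∈ D.lonelyCuts j)
    (hab' : mkEdge a b hab ∈ cut U)
    (hZ : ∀ W ∈ D.lonelyCuts j, W ≠ U → mkEdge a b hab ∈ cut W → cut W ∩ D.S j ⊆ Z)
    {r r' : V} {hr : r ≠ r'} (hrS : mkEdge r r' hr ∈ D.S j) (hrU : mkEdge r r' hr ∈ cut U) :
    Joined Z r r' := by
  -- The tree path from `a` to `b` contains the lonely edge `rr'`. Replacing `rr'` by `ab` leaves a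
  -- connection of `r` and `r'`. Any other edge of `P` is in the forest or is the lonely edge of a
  -- cut `W` that `ab` must cross as well.
  obtain ⟨P, hPS, hP⟩ := ((D.tree j).joined a b).exists_join
  have hsep : ∀ W : Finset V, cutParity P W = if mkEdge a b hab ∈ cut W then 1 else 0 := by
    intro W
    have h1 : oddVertices P = oddVertices {mkEdge a b hab} := by rw [hP, oddVertices_singleton]
    have h2 : cutParity P W = cutParity {mkEdge a b hab} W := by
      have h3 := odd_inter_cut_iff_odd_inter P W
      have h4 := odd_inter_cut_iff_odd_inter {mkEdge a b hab} W
      rw [h1, ← h4, odd_inter_cut_iff, odd_inter_cut_iff] at h3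
      rcases zmod_two_cases (cutParity P W) with h5 | h5 <;>
        rcases zmod_two_cases (cutParity {mkEdge a b hab} W) with h6 | h6 <;>
        simp [h5, h6] at h3 ⊢
    rw [h2, cutParity_eq_sum, Finset.sum_singleton]
  have hUone := (D.mem_lonelyCuts.1 hU).2.1
  have hrP : mkEdge r r' hr ∈ P := by
    have h1 := hsep U
    rw [if_pos hab'] at h1
    obtain ⟨w, hw, u, hu, hne, hm⟩ := exists_mem_cut_of_parity h1
    have h2 : mkEdge w u hne ∈ cut U ∩ D.S j :=
      Finset.mem_inter.2 ⟨mkEdge_mem_cut.2 (Or.inl ⟨hw, hu⟩), hPS hm⟩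
    rw [inter_cut_eq_singleton hUone hrU hrS, Finset.mem_singleton] at h2
    rwa [← h2]
  have hodd : oddVertices (symmDiff (symmDiff P {mkEdge r r' hr}) {mkEdge a b hab})
      = symmDiff {r} {r'} := by
    rw [oddVertices_symmDiff, oddVertices_symmDiff, hP, oddVertices_singleton,
      oddVertices_singleton]
    generalize symmDiff ({a} : Finset V) {b} = p
    rw [symmDiff_comm p, symmDiff_assoc, symmDiff_self, symmDiff_bot]
  refine (joined_of_oddVertices_eq hodd).mono ?_
  intro f hf
  by_cases hfab : f = mkEdge a b hab
  · rw [hfab]; exact habZ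
  have hf1 : f ∈ P ∧ f ≠ mkEdge r r' hr := by
    simp only [Finset.mem_symmDiff, Finset.mem_singleton] at hf
    rcases hf with ⟨⟨h1, h2⟩ | ⟨h1, h2⟩, -⟩ | ⟨h1, -⟩
    · exact ⟨h1, h2⟩
    · exact absurd (h1 ▸ hrP) h2
    · exact absurd h1 hfab
  by_cases hfF : f ∈ D.forest j
  · exact hF hfF
  obtain ⟨W, hW, hfW⟩ := D.exists_lonelyCut_of_notMem_forest (hPS hf1.1) hfF
  have hWone := (D.mem_lonelyCuts.1 hW).2.1
  have hWU : W ≠ U := by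
    rintro rfl
    have h2 : f ∈ cut W ∩ D.S j := Finset.mem_inter.2 ⟨hfW, hPS hf1.1⟩
    rw [inter_cut_eq_singleton hUone hrU hrS, Finset.mem_singleton] at h2
    exact hf1.2 h2
  refine hZ W hW hWU ?_ (Finset.mem_inter.2 ⟨hfW, hPS hf1.1⟩)
  by_contra hnot
  have h1 := hsep W
  rw [if_neg hnot, cutParity] at h1
  have h2 : P ∩ cut W = {f} := by
    refine Finset.Subset.antisymm ?_ (Finset.singleton_subset_iff.2
      (Finset.mem_inter.2 ⟨hf1.1, hfW⟩))
    rw [← inter_cut_eq_singleton hWone hfW (hPS hf1.1), Finset.inter_comm]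
    exact Finset.inter_subset_inter_left hPS
  rw [h2] at h1
  simp at h1

theorem connected_of_joined [Nonempty V] {Z : Finset (Edge V)} (hF : D.forest j ⊆ Z)
    (h : ∀ r r', ∀ hr : r ≠ r', mkEdge r r' hr ∈ D.S j → mkEdge r r' hr ∉ D.forest j →
      Joined Z r r') : (edgeGraph Z).Connected := by
  rw [edgeGraph_connected]
  intro u v
  induction (D.tree j).joined u v with
  | refl => exact Joined.refl _ _
  | tail _ hbc ih =>
    obtain ⟨hne, hm⟩ := hbc
    refine ih.trans ?_
    by_cases hf : mkEdge _ _ hne ∈ D.forest j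
    · exact Joined.of_mem (hF hf)
    · exact h _ _ hne hm hf

variable [MetricSpace V]

/-- Let each edge of `J` substitute the lonely edge of the dearest lonely cut it crosses, and buy
the lonely edges of its other lonely cuts. Paid twice, these cost at most the excess of `c^j` over
`c`. -/
theorem exists_reconnection_le (hst : s ≠ t) {J : Finset (Edge V)}
    (hJ : IsTJoin (D.wrongParity j) J) :
    ∃ R, D.IsReconnection j J R ∧ setCost J + 2 * setCost R ≤ ∑ e ∈ J, D.modCost j e := by
  classical
  have : Nonempty V := ⟨s⟩
  set L : Edge V → Finset (Finset V) := fun e => (D.lonelyCuts j).filter (fun U => e ∈ cut U)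
    with hL
  -- The cut `m` attains the maximum in `c^j`. For an edge in no lonely cut the empty set is a
  -- dummy, and erasing it changes nothing.
  have hex : ∀ e, ∃ m : Finset V, (m ∈ L e ∨ L e = ∅) ∧
      ∑ U ∈ (L e).erase m, 2 * setCost (cut U ∩ D.S j)
        = ∑ U ∈ L e, 2 * setCost (cut U ∩ D.S j) - D.saving j e := by
    intro e
    rcases D.saving_eq (j := j) e with ⟨h1, h2⟩ | ⟨U, hU, h2⟩
    · refine ⟨∅, Or.inr h1, ?_⟩
      rw [h2, hL]
      simp only [h1]
      simp
    · refine ⟨U, Or.inl hU, ?_⟩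
      rw [h2, eq_sub_iff_add_eq, Finset.sum_erase_add _ _ hU]
  choose m hm hms using hex
  set R : Finset (Edge V) := J.biUnion fun e => ((L e).erase (m e)).biUnion fun U => cut U ∩ D.S j
    with hR
  have hRmem : ∀ e ∈ J, ∀ U ∈ D.lonelyCuts j, e ∈ cut U → U ≠ m e → cut U ∩ D.S j ⊆ R := by
    intro e he U hU heU hne f hf
    exact Finset.mem_biUnion.2 ⟨e, he, Finset.mem_biUnion.2
      ⟨U, Finset.mem_erase.2 ⟨hne, Finset.mem_filter.2 ⟨hU, heU⟩⟩, hf⟩⟩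
  refine ⟨R, ⟨?_, ?_⟩, ?_⟩
  · intro f hf
    obtain ⟨e, -, hf⟩ := Finset.mem_biUnion.1 hf
    obtain ⟨U, hU, hf⟩ := Finset.mem_biUnion.1 hf
    have hU' := (Finset.mem_filter.1 (Finset.mem_erase.1 hU).2).1
    obtain ⟨h1, h2⟩ := Finset.mem_inter.1 hf
    refine Finset.mem_sdiff.2 ⟨h2, fun h3 => ?_⟩
    have h4 : f ∈ D.forest j ∩ cut U := Finset.mem_inter.2 ⟨h3, h1⟩
    rw [D.forest_inter_cut hU'] at h4
    simp at h4
  · have hF : D.forest j ⊆ D.forest j ∪ J ∪ R :=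
      Finset.subset_union_left.trans Finset.subset_union_left
    have hJZ : J ⊆ D.forest j ∪ J ∪ R := Finset.subset_union_right.trans Finset.subset_union_left
    refine D.connected_of_joined hF fun r r' hr hrS hrF => ?_
    obtain ⟨U, hU, hrU⟩ := D.exists_lonelyCut_of_notMem_forest hrS hrF
    have hodd := D.odd_inter_of_lonely hst hU
    rw [← hJ, ← odd_inter_cut_iff_odd_inter, odd_inter_cut_iff] at hodd
    obtain ⟨a, ha, b, hb, hab, hmJ⟩ := exists_mem_cut_of_parity hodd
    have habU : mkEdge a b hab ∈ cut U := mkEdge_mem_cut.2 (Or.inl ⟨ha, hb⟩)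
    -- Some edge of `J` crosses `U`. Either it substitutes the lonely edge of `U` by exchange, or
    -- that lonely edge was bought.
    by_cases hUm : U = m (mkEdge a b hab)
    · refine D.joined_of_exchange hF (hJZ hmJ) hU habU (fun W hW hWU habW => ?_) hrS hrU
      exact (hRmem _ hmJ W hW habW (hUm ▸ hWU)).trans Finset.subset_union_right
    · exact Joined.of_mem (Finset.mem_union_right _
        (hRmem _ hmJ U hU habU hUm (Finset.mem_inter.2 ⟨hrU, hrS⟩)))
  · have h1 : setCost R ≤ ∑ e ∈ J, ∑ U ∈ (L e).erase (m e), setCost (cut U ∩ D.S j) := by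
      exact (setCost_biUnion_le _ _).trans
        (Finset.sum_le_sum fun e _ => setCost_biUnion_le _ _)
    have h2 : ∑ e ∈ J, D.modCost j e
        = setCost J + 2 * ∑ e ∈ J, ∑ U ∈ (L e).erase (m e), setCost (cut U ∩ D.S j) := by
      rw [setCost, Finset.mul_sum, ← Finset.sum_add_distrib]
      refine Finset.sum_congr rfl fun e _ => ?_
      rw [Finset.mul_sum, hms e, modCost_eq]
      ring
    linarith

theorem exists_minJoin (hst : s ≠ t) (j : Fin D.k) : ∃ J, D.IsMinJoin j J :=
  exists_min_join (D.modCost j) ⟨_, D.isTJoin_wrongParity hst⟩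

theorem exists_minReconnection (J : Finset (Edge V)) (j : Fin D.k) :
    ∃ R, D.IsMinReconnection j J R := by
  have : Nonempty V := ⟨s⟩
  obtain ⟨R, hR, hmin⟩ := Set.exists_min_image {R | D.IsReconnection j J R} setCost
    (Set.toFinite _) ⟨D.S j \ D.forest j, subset_rfl, by
      refine D.connected_of_joined (Finset.subset_union_left.trans Finset.subset_union_left)
        fun r r' hr hrS hrF => Joined.of_mem (h := hr) ?_
      exact Finset.mem_union_right _ (Finset.mem_sdiff.2 ⟨hrS, hrF⟩)⟩
  exact ⟨R, hR, hmin⟩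

theorem joined_multiEdges {J R : Finset (Edge V)} (hR : D.IsReconnection j J R) (u v : V) :
    Joined (D.multiEdges j J R).toFinset u v := by
  have : Nonempty V := ⟨u⟩
  refine (edgeGraph_connected.1 hR.2 u v).mono ?_
  intro e he
  simp only [multiEdges, Multiset.mem_toFinset, Multiset.mem_add, Finset.mem_val]
  simp only [Finset.mem_union] at he
  tauto

theorem exists_eulerian (hst : s ≠ t) {J R : Finset (Edge V)}
    (hJ : IsTJoin (D.wrongParity j) J) (hR : D.IsReconnection j J R) :
    ∃ w : (⊤ : SimpleGraph V).Walk s t, IsEulerianIn w (D.multiEdges j J R) := by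
  refine (exists_trail_of_connected (fun v => ?_) (D.joined_multiEdges hR)).exists_walk
  have h1 := D.isTJoin_wrongParity (j := j) hst
  have h2 : cutParity J {v} = cutParity (symmDiff (D.forest j) {mkEdge s t hst}) {v} := by
    have h3 : v ∈ oddVertices J ↔ v ∈ oddVertices (symmDiff (D.forest j) {mkEdge s t hst}) := by
      rw [hJ, h1]
    rw [mem_oddVertices, mem_oddVertices] at h3
    rcases zmod_two_cases (cutParity J {v}) with h5 | h5 <;>
      rcases zmod_two_cases (cutParity (symmDiff (D.forest j) {mkEdge s t hst}) {v}) with h6 | h6 <;>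
      simp [h5, h6] at h3 ⊢
  rw [cutParity_symmDiff, cutParity_eq_sum {_}, Finset.sum_singleton] at h2
  simp only [multiEdges, degParity_add, degParity_val]
  rw [h2, add_assoc _ (cutParity R {v}), CharTwo.add_self_eq_zero, add_zero, ← add_assoc,
    CharTwo.add_self_eq_zero, zero_add]
  simp only [mkEdge_mem_cut_singleton]
  by_cases hs : v = s
  · subst hs; simp [hst]
  · by_cases ht : v = t
    · subst ht; simp [hs]
    · simp [hs, ht]

theorem exists_isTreeTour (hst : s ≠ t) (j : Fin D.k) : ∃ P, D.IsTreeTour j P := by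
  obtain ⟨J, hJ⟩ := D.exists_minJoin hst j
  obtain ⟨R, hR⟩ := D.exists_minReconnection J j
  obtain ⟨w, hw⟩ := D.exists_eulerian hst hJ.1 hR.1
  obtain ⟨P, hP⟩ := exists_shortcut hst w
  exact ⟨P, J, R, hJ, hR, w, hw, hP⟩

theorem exists_isOutput (hst : s ≠ t) : ∃ P, D.IsOutput P := by
  choose Q hQ using D.exists_isTreeTour hst
  have hne : (Finset.univ : Finset (Fin D.k)).Nonempty := by
    by_contra h
    have := D.sum_eq_one
    rw [Finset.not_nonempty_iff_eq_empty.1 h] at this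
    simp at this
  obtain ⟨j, -, hj⟩ := Finset.exists_min_image Finset.univ (fun j => walkCost (Q j)) hne
  exact ⟨Q j, Q, hQ, j, rfl, fun i => hj i (Finset.mem_univ i)⟩

theorem IsTreeTour.isHamiltonian (hst : s ≠ t) {P : (⊤ : SimpleGraph V).Walk s t}
    (h : D.IsTreeTour j P) : P.IsHamiltonian := by
  obtain ⟨J, R, hJ, hR, w, hw, hP⟩ := h
  refine hP.isHamiltonian fun v => ?_
  obtain ⟨u, hu⟩ : ∃ u, v ≠ u := by
    by_cases hv : v = s
    · exact ⟨t, hv ▸ hst⟩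
    · exact ⟨s, hv⟩
  obtain ⟨y, hy, y', hy', ⟨hne, hm⟩, -⟩ := (D.joined_multiEdges hR.1 v u).exists_crossing
    (Finset.mem_singleton_self v) (fun h => hu (Finset.mem_singleton.1 h).symm)
  rw [Finset.mem_singleton] at hy
  subst hy
  exact hw.mem_support (Multiset.mem_toFinset.1 hm)

/-- The cost of a tour is bounded by means of any vector in the join polyhedron. -/
theorem IsTreeTour.walkCost_le (hst : s ≠ t) {P : (⊤ : SimpleGraph V).Walk s t}
    (h : D.IsTreeTour j P) {y : Edge V → ℝ} (hy : ∀ e, 0 ≤ y e)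
    (hcut : ∀ X, Odd (X ∩ D.wrongParity j).card → 1 ≤ vecSum y (cut X)) :
    walkCost P + ∑ U ∈ D.lonelyCuts j, setCost (cut U ∩ D.S j)
      ≤ setCost (D.S j) + ∑ e, D.modCost j e * y e := by
  obtain ⟨J, R, hJ, hR, w, hw, hP⟩ := h
  obtain ⟨R', hR', hle⟩ := D.exists_reconnection_le hst hJ.1
  obtain ⟨J', hJ', hle'⟩ := exists_join_le (D.modCost j) y D.modCost_nonneg hy ⟨J, hJ.1⟩ hcut
  have h1 := hP.walkCost_le
  have h2 : walkCost w = setCost (D.forest j) + setCost J + setCost R + setCost R := by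
    rw [hw.walkCost]
    simp only [multiEdges, Multiset.map_add, Multiset.sum_add]
    rfl
  have h3 := hR.2 R' hR'
  have h4 := hJ.2 J' hJ'
  have h5 := D.setCost_forest_add (j := j)
  rw [vecSum] at hle'
  linarith

end TreeDecomposition

end PathTSP

/-! ### The correction vector and the bound for a single tour -/

namespace PathTSP

/-- Weights proportional to `q` work; if all `q` vanish then `K = 0` and any weights do. -/
theorem exists_weights {ι : Type*} (I : Finset ι) (hI : I.Nonempty) {q a : ι → ℝ}
    (hq : ∀ i ∈ I, 0 ≤ q i) (ha : ∀ i ∈ I, 0 ≤ a i) {K : ℝ} (hK : 0 ≤ K)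
    (hKq : K ≤ ∑ i ∈ I, q i) :
    ∃ θ : ι → ℝ, (∀ i ∈ I, 0 ≤ θ i) ∧ ∑ i ∈ I, θ i = 1 ∧
      K * ∑ i ∈ I, θ i * a i ≤ ∑ i ∈ I, q i * a i := by
  classical
  have hqa : 0 ≤ ∑ i ∈ I, q i * a i :=
    Finset.sum_nonneg fun i hi => mul_nonneg (hq i hi) (ha i hi)
  rcases (Finset.sum_nonneg hq).eq_or_lt with h0 | hpos
  · obtain ⟨i₀, hi₀⟩ := hI
    refine ⟨fun i => if i = i₀ then 1 else 0, fun i _ => by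
      dsimp only; split_ifs <;> simp, by simp [hi₀], ?_⟩
    rw [le_antisymm (h0 ▸ hKq) hK, zero_mul]
    exact hqa
  · refine ⟨fun i => q i / ∑ i ∈ I, q i, fun i hi => div_nonneg (hq i hi) hpos.le, ?_, ?_⟩
    · rw [← Finset.sum_div, div_self hpos.ne']
    · have h1 : ∑ i ∈ I, q i / (∑ i ∈ I, q i) * a i = (∑ i ∈ I, q i * a i) / ∑ i ∈ I, q i := by
        rw [Finset.sum_div]
        exact Finset.sum_congr rfl fun i _ => by ring
      rw [h1, mul_div_assoc', div_le_iff₀ hpos, mul_comm]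
      exact mul_le_mul_of_nonneg_left hKq hqa

namespace TreeDecomposition

variable {V : Type*} [Fintype V] [DecidableEq V] {s t : V} {x : Edge V → ℝ}
  (D : TreeDecomposition s t x) {j : Fin D.k}

/-- `r` assigns to every narrow cut the index of the last tree for which it may be lonely. -/
structure IsLast (r : Finset V → Fin D.k) : Prop where
  sum_eq : ∀ U ∈ narrowCuts s t x, ∑ i ∈ Finset.Iic (r U), D.p i = 2 - vecSum x (cut U)
  card_eq : ∀ U ∈ narrowCuts s t x, ∀ j, j ≤ r U → (cut U ∩ D.S j).card = 1

theorem nonempty_index : Nonempty (Fin D.k) := by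
  by_contra h
  rw [not_nonempty_iff] at h
  have := D.sum_eq_one
  rw [Finset.univ_eq_empty, Finset.sum_empty] at this
  exact zero_ne_one this

theorem exists_isLast : ∃ r, D.IsLast r := by
  have := D.nonempty_index
  choose! r hr1 hr2 using D.narrow
  exact ⟨r, hr1, hr2⟩

variable {r : Finset V → Fin D.k}

/-- Positivity of `pⱼ` is essential: a tree of weight zero placed after `r U` still meets the prefix
condition and may cross `U` once. -/
theorem IsLast.mem_lonelyCuts (hr : D.IsLast r) (hj : 0 < D.p j) {U : Finset V}
    (hU : U ∈ narrowCuts s t x) : U ∈ D.lonelyCuts j ↔ j ≤ r U := by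
  rw [D.mem_lonelyCuts]
  constructor
  · rintro ⟨-, -, h3⟩
    by_contra hlt
    rw [not_le] at hlt
    rw [← hr.sum_eq U hU] at h3
    have h4 : ∑ i ∈ insert j (Finset.Iic (r U)), D.p i ≤ ∑ i ∈ Finset.Iic j, D.p i := by
      refine Finset.sum_le_sum_of_subset_of_nonneg ?_ fun i _ _ => D.nonneg i
      intro i hi
      rw [Finset.mem_insert, Finset.mem_Iic] at hi
      rw [Finset.mem_Iic]
      rcases hi with rfl | hi
      · exact le_rfl
      · exact hi.trans hlt.le
    rw [Finset.sum_insert (by rw [Finset.mem_Iic]; exact not_le.2 hlt)] at h4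
    linarith
  · intro hle
    refine ⟨hU, hr.card_eq U hU j hle, ?_⟩
    rw [← hr.sum_eq U hU]
    exact Finset.sum_le_sum_of_subset_of_nonneg (Finset.Iic_subset_Iic.2 hle)
      fun i _ _ => D.nonneg i

theorem IsLast.filter_eq (hr : D.IsLast r) (hj : 0 < D.p j) :
    (narrowCuts s t x).filter (fun U => j ≤ r U) = D.lonelyCuts j := by
  ext U
  rw [Finset.mem_filter]
  constructor
  · rintro ⟨h1, h2⟩
    exact (hr.mem_lonelyCuts D hj h1).2 h2
  · intro h
    have h1 := (D.mem_lonelyCuts.1 h).1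
    exact ⟨h1, (hr.mem_lonelyCuts D hj h1).1 h⟩

/-- The vector with which the parity of the forest is corrected, up to scaling. -/
noncomputable def correction (r : Finset V → Fin D.k) (θ : Finset V → Fin D.k → ℝ) (j : Fin D.k)
    (η : ℝ) (e : Edge V) : ℝ :=
  η * x e + (1 - η) * (if e ∈ D.S j then 1 else 0)
    + ∑ U ∈ (narrowCuts s t x).filter (fun U => j ≤ r U),
        η * (2 - vecSum x (cut U)) * (if e ∈ cut U ∩ D.S j then 1 else 0)
    + ∑ U ∈ (narrowCuts s t x).filter (fun U => ¬ j ≤ r U),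
        max 0 (η - 1 + (2 - vecSum x (cut U)) * η) *
          ∑ i ∈ Finset.Iic (r U), θ U i * (if e ∈ cut U ∩ D.S i then 1 else 0)

theorem sum_mul_correction (θ : Finset V → Fin D.k → ℝ) (η : ℝ) (f : Edge V → ℝ) :
    ∑ e, f e * D.correction r θ j η e = η * ∑ e, f e * x e + (1 - η) * vecSum f (D.S j)
      + ∑ U ∈ (narrowCuts s t x).filter (fun U => j ≤ r U),
        η * (2 - vecSum x (cut U)) * vecSum f (cut U ∩ D.S j)
      + ∑ U ∈ (narrowCuts s t x).filter (fun U => ¬ j ≤ r U),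
        max 0 (η - 1 + (2 - vecSum x (cut U)) * η) *
          ∑ i ∈ Finset.Iic (r U), θ U i * vecSum f (cut U ∩ D.S i) := by
  have hind : ∀ A : Finset (Edge V), vecSum f A = ∑ e, f e * (if e ∈ A then 1 else 0) := by
    intro A
    rw [vecSum_eq_sum_ite]
    exact Finset.sum_congr rfl fun e _ => by split_ifs <;> simp
  simp only [correction, mul_add, Finset.sum_add_distrib]
  congr 1
  · congr 1
    · congr 1
      · rw [Finset.mul_sum]
        exact Finset.sum_congr rfl fun e _ => by ring
      · rw [hind, Finset.mul_sum]
        exact Finset.sum_congr rfl fun e _ => by ring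
    · simp only [Finset.mul_sum]
      rw [Finset.sum_comm]
      refine Finset.sum_congr rfl fun U _ => ?_
      rw [hind, Finset.mul_sum]
      exact Finset.sum_congr rfl fun e _ => by ring
  · simp only [Finset.mul_sum]
    rw [Finset.sum_comm]
    refine Finset.sum_congr rfl fun U _ => ?_
    rw [Finset.sum_comm]
    refine Finset.sum_congr rfl fun i _ => ?_
    rw [hind, Finset.mul_sum, Finset.mul_sum]
    exact Finset.sum_congr rfl fun e _ => by ring

/-- Convex combinations of the edges of a narrow cut in the trees for which it may be lonely. -/
structure IsCutWeight (r : Finset V → Fin D.k) (θ : Finset V → Fin D.k → ℝ) : Prop where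
  nonneg : ∀ U ∈ narrowCuts s t x, ∀ i, i ≤ r U → 0 ≤ θ U i
  sum_eq : ∀ U ∈ narrowCuts s t x, ∑ i ∈ Finset.Iic (r U), θ U i = 1

variable {θ : Finset V → Fin D.k → ℝ}

theorem correction_nonneg (hx : IsFeasible s t x) (hθ : D.IsCutWeight r θ) {η : ℝ} (h0 : 0 ≤ η)
    (h1 : η ≤ 1) (e : Edge V) : 0 ≤ D.correction r θ j η e := by
  have hi : ∀ A : Finset (Edge V), (0 : ℝ) ≤ if e ∈ A then 1 else 0 := by
    intro A; split_ifs <;> simp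
  refine add_nonneg (add_nonneg (add_nonneg (mul_nonneg h0 (hx.nonneg e))
    (mul_nonneg (sub_nonneg.2 h1) (hi _))) ?_) ?_
  · refine Finset.sum_nonneg fun U hU => mul_nonneg (mul_nonneg h0 ?_) (hi _)
    linarith [(mem_narrowCuts.1 (Finset.mem_filter.1 hU).1).2.2]
  · refine Finset.sum_nonneg fun U hU => mul_nonneg (le_max_left _ _) ?_
    exact Finset.sum_nonneg fun i hi' => mul_nonneg
      (hθ.nonneg U (Finset.mem_filter.1 hU).1 i (Finset.mem_Iic.1 hi')) (hi _)

/-- The correction vector has value at least `1 + η` on all cuts of the wrong parity. -/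
theorem le_vecSum_correction (hx : IsFeasible s t x) (hst : s ≠ t) (hr : D.IsLast r)
    (hθ : D.IsCutWeight r θ) (hj : 0 < D.p j) {η : ℝ} (h0 : 0 ≤ η) (h1 : η ≤ 1) {X : Finset V}
    (hX : Odd (X ∩ D.wrongParity j).card) :
    1 + η ≤ vecSum (D.correction r θ j η) (cut X) := by
  -- Both sides are invariant under complementation of `X`. After this choice, a set separating `s`
  -- and `t` contains `s`, as the members of `narrowCuts` do.
  wlog hs : t ∈ X → s ∈ X generalizing X
  · have h2 : Odd (Xᶜ ∩ D.wrongParity j).card := by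
      rw [D.odd_inter_wrongParity hst] at hX ⊢
      rwa [cutParity, cut_compl]
    have := this h2 (by simp only [Finset.mem_compl]; tauto)
    rwa [cut_compl] at this
  set f : Edge V → ℝ := fun e => if e ∈ cut X then 1 else 0 with hf
  have hfs : ∀ y : Edge V → ℝ, vecSum y (cut X) = ∑ e, f e * y e := by
    intro y
    rw [vecSum_eq_sum_ite]
    exact Finset.sum_congr rfl fun e _ => by simp [hf]
  have hcard : ∀ A, vecSum f A = ((cut X ∩ A).card : ℝ) := by
    intro A
    rw [vecSum, hf, Finset.sum_ite_mem, Finset.sum_const, nsmul_eq_mul, mul_one, Finset.inter_comm]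
  rw [hfs, sum_mul_correction, ← hfs]
  have hzpos : ∀ U ∈ narrowCuts s t x, 0 ≤ 2 - vecSum x (cut U) := fun U hU => by
    linarith [(mem_narrowCuts.1 hU).2.2]
  have hl0 : ∀ U ∈ (narrowCuts s t x).filter (fun U => j ≤ r U),
      0 ≤ η * (2 - vecSum x (cut U)) * vecSum f (cut U ∩ D.S j) := by
    intro U hU
    refine mul_nonneg (mul_nonneg h0 (hzpos U (Finset.mem_filter.1 hU).1)) ?_
    rw [hcard]; positivity
  have hn0 : ∀ U ∈ (narrowCuts s t x).filter (fun U => ¬ j ≤ r U),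
      0 ≤ max 0 (η - 1 + (2 - vecSum x (cut U)) * η) *
          ∑ i ∈ Finset.Iic (r U), θ U i * vecSum f (cut U ∩ D.S i) := by
    intro U hU
    refine mul_nonneg (le_max_left _ _) (Finset.sum_nonneg fun i hi => mul_nonneg
      (hθ.nonneg U (Finset.mem_filter.1 hU).1 i (Finset.mem_Iic.1 hi)) ?_)
    rw [hcard]; positivity
  have hne : X.Nonempty := by
    rw [Finset.nonempty_iff_ne_empty]
    rintro rfl
    simp at hX
  have hne' : X ≠ Finset.univ := by
    rintro rfl
    rw [D.odd_inter_wrongParity hst, cutParity] at hX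
    have : cut (Finset.univ : Finset V) = ∅ := by ext e; simp [cut]
    simp [this] at hX
  have hone : (1 : ℝ) ≤ vecSum f (D.S j) := by
    rw [hcard]
    obtain ⟨u, hu⟩ := hne
    obtain ⟨v, hv⟩ : ∃ v, v ∉ X := by
      by_contra! hcon
      exact hne' (Finset.eq_univ_iff_forall.2 hcon)
    obtain ⟨y, hy, y', hy', ⟨hyy, hm⟩, -⟩ := ((D.tree j).joined u v).exists_crossing hu hv
    have : 0 < (cut X ∩ D.S j).card := Finset.card_pos.2
      ⟨_, Finset.mem_inter.2 ⟨mkEdge_mem_cut.2 (Or.inl ⟨hy, hy'⟩), hm⟩⟩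
    exact_mod_cast this
  by_cases hnarrow : X ∈ narrowCuts s t x
  · by_cases hl : j ≤ r X
    · have h2 := Finset.single_le_sum hl0 (Finset.mem_filter.2 ⟨hnarrow, hl⟩)
      have h3 := Finset.sum_nonneg hn0
      have h4 : vecSum f (cut X ∩ D.S j) = 1 := by
        rw [hcard, ← Finset.inter_assoc, Finset.inter_self, hr.card_eq X hnarrow j hl]
        simp
      rw [h4] at h2
      -- With `z = 2 - x(δ(X))`: `η(2 - z) + (1 - η) + ηz = 1 + η`.
      nlinarith
    · have h2 := Finset.single_le_sum hn0 (Finset.mem_filter.2 ⟨hnarrow, hl⟩)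
      have h3 := Finset.sum_nonneg hl0
      have h4 : ∑ i ∈ Finset.Iic (r X), θ X i * vecSum f (cut X ∩ D.S i) = 1 := by
        rw [← hθ.sum_eq X hnarrow]
        refine Finset.sum_congr rfl fun i hi => ?_
        rw [hcard, ← Finset.inter_assoc, Finset.inter_self,
          hr.card_eq X hnarrow i (Finset.mem_Iic.1 hi)]
        simp
      have h5 : (2 : ℝ) ≤ vecSum f (D.S j) := by
        rw [hcard]
        exact_mod_cast D.two_le_card_of_not_lonely hst hnarrow hX
          fun h => hl ((hr.mem_lonelyCuts D hj hnarrow).1 h)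
      rw [h4, mul_one] at h2
      have h6 := le_max_right 0 (η - 1 + (2 - vecSum x (cut X)) * η)
      have h7 := mul_le_mul_of_nonneg_left h5 (sub_nonneg.2 h1)
      -- Here `η(2 - z) + 2(1 - η) + (η - 1 + zη) = 1 + η`.
      linarith
  · have h2 : 2 ≤ vecSum x (cut X) := by
      by_cases hiff : s ∈ X ↔ t ∈ X
      · exact hx.two_le_cut hne hne' hiff
      · by_contra hlt
        exact hnarrow (mem_narrowCuts.2 ⟨by tauto, by tauto, not_le.1 hlt⟩)
    have h3 := Finset.sum_nonneg hl0
    have h4 := Finset.sum_nonneg hn0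
    have h5 := mul_le_mul_of_nonneg_left h2 h0
    have h6 := mul_le_mul_of_nonneg_left hone (sub_nonneg.2 h1)
    linarith

variable [MetricSpace V]

/-- If `e` lay in a cut `W` lonely in `Sⱼ`, then `i ≤ r U < j ≤ r W`, so `e` would be the only edge
of `Sᵢ` in both `U` and `W`. This forces `U = W`, a contradiction. Thus spreading a narrow cut over
earlier trees incurs no surcharge. -/
theorem IsLast.modCost_eq (hr : D.IsLast r) (hj : 0 < D.p j) {U : Finset V}
    (hU : U ∈ narrowCuts s t x) (hl : ¬ j ≤ r U) {i : Fin D.k} (hi : i ≤ r U) {e : Edge V}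
    (he : e ∈ cut U ∩ D.S i) : D.modCost j e = edgeCost e.1 := by
  obtain ⟨heU, heS⟩ := Finset.mem_inter.1 he
  have hno : ∀ W ∈ D.lonelyCuts j, e ∉ cut W := by
    intro W hW heW
    have hW' := (D.mem_lonelyCuts.1 hW).1
    have h1 := (hr.mem_lonelyCuts D hj hW').1 hW
    have h2 : i ≤ r W := hi.trans ((not_le.1 hl).le.trans h1)
    have h3 := D.eq_of_mem_cut hU hW' (hr.card_eq U hU i hi) (hr.card_eq W hW' i h2) heS heU heW
    exact hl (h3 ▸ h1)
  exact D.modCost_eq_edgeCost fun W hW _ _ heW => absurd heW (hno W hW)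

theorem walkCost_mul_le (hx : IsFeasible s t x) (hst : s ≠ t) (hr : D.IsLast r)
    (hθ : D.IsCutWeight r θ) (hj : 0 < D.p j) {η : ℝ} (h0 : 0 ≤ η) (h1 : η ≤ 1)
    {P : (⊤ : SimpleGraph V).Walk s t} (hP : D.IsTreeTour j P) :
    walkCost P * (1 + η) ≤ 2 * setCost (D.S j) + η * vecCost x
      + ∑ U ∈ (narrowCuts s t x).filter (fun U => j ≤ r U),
        (η - 1 - (2 - vecSum x (cut U)) * η) * setCost (cut U ∩ D.S j)
      + ∑ U ∈ (narrowCuts s t x).filter (fun U => ¬ j ≤ r U),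
        max 0 (η - 1 + (2 - vecSum x (cut U)) * η) *
          ∑ i ∈ Finset.Iic (r U), θ U i * setCost (cut U ∩ D.S i) := by
  have hpos : 0 < 1 + η := by linarith
  set y : Edge V → ℝ := fun e => (1 + η)⁻¹ * D.correction r θ j η e with hy
  have hbound := hP.walkCost_le D hst (y := y)
    (fun e => mul_nonneg (inv_nonneg.2 hpos.le) (D.correction_nonneg hx hθ h0 h1 e))
    (by
      intro X hX
      have h2 := D.le_vecSum_correction hx hst hr hθ hj h0 h1 hX
      rw [hy, vecSum, ← Finset.mul_sum, inv_mul_eq_div, le_div_iff₀ hpos, one_mul]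
      exact h2)
  have hsum : (∑ e, D.modCost j e * y e) * (1 + η)
      = ∑ e, D.modCost j e * D.correction r θ j η e := by
    rw [Finset.sum_mul]
    refine Finset.sum_congr rfl fun e _ => ?_
    rw [hy]
    field_simp
  rw [sum_mul_correction] at hsum
  have hc1 : vecSum (D.modCost j) (D.S j) = setCost (D.S j) :=
    Finset.sum_congr rfl fun e he => D.modCost_of_mem_tree he
  have hc2 : ∀ U : Finset V, vecSum (D.modCost j) (cut U ∩ D.S j) = setCost (cut U ∩ D.S j) :=
    fun U => Finset.sum_congr rfl fun e he => D.modCost_of_mem_tree (Finset.mem_inter.1 he).2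
  have hc3 : ∑ U ∈ (narrowCuts s t x).filter (fun U => ¬ j ≤ r U),
        max 0 (η - 1 + (2 - vecSum x (cut U)) * η) *
          ∑ i ∈ Finset.Iic (r U), θ U i * vecSum (D.modCost j) (cut U ∩ D.S i)
      = ∑ U ∈ (narrowCuts s t x).filter (fun U => ¬ j ≤ r U),
        max 0 (η - 1 + (2 - vecSum x (cut U)) * η) *
          ∑ i ∈ Finset.Iic (r U), θ U i * setCost (cut U ∩ D.S i) := by
    refine Finset.sum_congr rfl fun U hU => ?_
    congr 1
    refine Finset.sum_congr rfl fun i hi => ?_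
    congr 1
    exact Finset.sum_congr rfl fun e he => hr.modCost_eq D hj (Finset.mem_filter.1 hU).1
      (Finset.mem_filter.1 hU).2 (Finset.mem_Iic.1 hi) he
  have hx' := mul_le_mul_of_nonneg_left (D.sum_modCost_mul_le (j := j) hx) h0
  rw [hc1, hc3] at hsum
  simp only [hc2] at hsum
  rw [← hr.filter_eq D hj] at hx' hbound
  have hb := mul_le_mul_of_nonneg_right hbound hpos.le
  rw [add_mul, add_mul, hsum] at hb
  -- The cost of a lonely edge collects `-(1 + η)` from its deletion, `2η(1 - z)` from the modified
  -- cost of `x`, and `ηz` from the correction.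
  have hfin : ∑ U ∈ (narrowCuts s t x).filter (fun U => j ≤ r U),
        (η - 1 - (2 - vecSum x (cut U)) * η) * setCost (cut U ∩ D.S j)
      = η * (∑ U ∈ (narrowCuts s t x).filter (fun U => j ≤ r U),
          2 * setCost (cut U ∩ D.S j) * (vecSum x (cut U) - 1))
        + ∑ U ∈ (narrowCuts s t x).filter (fun U => j ≤ r U),
          η * (2 - vecSum x (cut U)) * setCost (cut U ∩ D.S j)
        - (∑ U ∈ (narrowCuts s t x).filter (fun U => j ≤ r U), setCost (cut U ∩ D.S j)) * (1 + η) := by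
    rw [Finset.mul_sum, Finset.sum_mul, ← Finset.sum_add_distrib, ← Finset.sum_sub_distrib]
    exact Finset.sum_congr rfl fun U _ => by ring
  rw [hfin]
  linarith

end TreeDecomposition

end PathTSP

/-! ### Averaging over the trees by integration -/

namespace PathTSP

open MeasureTheory

theorem intervalIntegrable_of_unit {g : ℝ → ℝ} (hg : IntegrableOn g (Set.Icc 0 1)) {a b : ℝ}
    (ha : 0 ≤ a) (hab : a ≤ b) (hb : b ≤ 1) : IntervalIntegrable g volume a b := by
  rw [intervalIntegrable_iff_integrableOn_Ioc_of_le hab]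
  exact hg.mono_set fun y hy => ⟨ha.trans hy.1.le, hy.2.trans hb⟩

namespace TreeDecomposition

variable {V : Type*} [Fintype V] [DecidableEq V] {s t : V} {x : Edge V → ℝ}
  (D : TreeDecomposition s t x)

/-- The total weight of the first `n` trees. -/
noncomputable def accum (n : ℕ) : ℝ :=
  ∑ i ∈ Finset.range n, if h : i < D.k then D.p ⟨i, h⟩ else 0

theorem accum_zero : D.accum 0 = 0 := by simp [accum]

theorem accum_succ (j : Fin D.k) : D.accum (j + 1) = D.accum j + D.p j := by
  rw [accum, Finset.sum_range_succ, dif_pos j.2]; rfl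

theorem accum_mono : Monotone D.accum := by
  refine monotone_nat_of_le_succ fun n => ?_
  rw [accum, accum, Finset.sum_range_succ, le_add_iff_nonneg_right]
  split_ifs
  · exact D.nonneg _
  · exact le_rfl

theorem sum_Iic_eq (r : Fin D.k) (g : ℕ → ℝ) :
    ∑ i ∈ Finset.Iic r, g i = ∑ i ∈ Finset.range (r + 1), g i := by
  rw [Nat.range_succ_eq_Iic, ← Fin.map_valEmbedding_Iic, Finset.sum_map]
  rfl

theorem accum_eq_sum_Iic (r : Fin D.k) : D.accum (r + 1) = ∑ i ∈ Finset.Iic r, D.p i := by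
  rw [accum, ← D.sum_Iic_eq r]
  exact Finset.sum_congr rfl fun i _ => dif_pos i.2

theorem accum_last : D.accum D.k = 1 := by
  rw [accum, Finset.sum_range, ← D.sum_eq_one]
  exact Finset.sum_congr rfl fun i _ => dif_pos i.2

theorem accum_mem (n : ℕ) (hn : n ≤ D.k) : 0 ≤ D.accum n ∧ D.accum n ≤ 1 :=
  ⟨D.accum_zero ▸ D.accum_mono (Nat.zero_le n), D.accum_last ▸ D.accum_mono hn⟩

/-- The integral over the interval belonging to the tree `Sⱼ`. -/
noncomputable def share (g : ℝ → ℝ) (j : Fin D.k) : ℝ :=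
  ∫ σ in D.accum j..D.accum (j + 1), g σ

variable {g : ℝ → ℝ}

theorem intervalIntegrable_share (hg : IntegrableOn g (Set.Icc 0 1)) (j : Fin D.k) :
    IntervalIntegrable g volume (D.accum j) (D.accum (j + 1)) :=
  intervalIntegrable_of_unit hg (D.accum_mem j j.2.le).1 (D.accum_mono (Nat.le_succ _))
    (D.accum_mem (j + 1) j.2).2

theorem sum_share (hg : IntegrableOn g (Set.Icc 0 1)) : ∑ j, D.share g j = ∫ σ in (0 : ℝ)..1, g σ := by
  have := intervalIntegral.sum_integral_adjacent_intervals (f := g) (μ := volume) (a := D.accum)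
    (n := D.k) fun i hi => D.intervalIntegrable_share hg ⟨i, hi⟩
  rw [D.accum_zero, D.accum_last] at this
  rw [← this, Finset.sum_range]
  rfl

theorem sum_share_Iic (hg : IntegrableOn g (Set.Icc 0 1)) (r : Fin D.k) :
    ∑ j ∈ Finset.Iic r, D.share g j = ∫ σ in (0 : ℝ)..∑ i ∈ Finset.Iic r, D.p i, g σ := by
  have := intervalIntegral.sum_integral_adjacent_intervals (f := g) (μ := volume) (a := D.accum)
    (n := r + 1) fun i hi => D.intervalIntegrable_share hg ⟨i, by omega⟩
  rw [D.accum_zero, D.accum_eq_sum_Iic] at this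
  rw [← this, ← D.sum_Iic_eq r]
  rfl

theorem sum_share_not_le (hg : IntegrableOn g (Set.Icc 0 1)) (r : Fin D.k) :
    ∑ j ∈ Finset.univ.filter (fun j => ¬ j ≤ r), D.share g j
      = ∫ σ in (∑ i ∈ Finset.Iic r, D.p i)..1, g σ := by
  have h1 := Finset.sum_filter_add_sum_filter_not Finset.univ (fun j => j ≤ r) (D.share g)
  have h2 : Finset.univ.filter (fun j => j ≤ r) = Finset.Iic r := by ext; simp
  have h3 := D.accum_mem (r + 1) r.2
  rw [D.accum_eq_sum_Iic] at h3
  have h4 := intervalIntegral.integral_add_adjacent_intervals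
    (intervalIntegrable_of_unit hg le_rfl h3.1 h3.2) (intervalIntegrable_of_unit hg h3.1 h3.2 le_rfl)
  rw [h2, D.sum_share hg, D.sum_share_Iic hg] at h1
  linarith

theorem share_nonneg (hg : ∀ σ ∈ Set.Icc (0 : ℝ) 1, 0 ≤ g σ) (j : Fin D.k) : 0 ≤ D.share g j :=
  intervalIntegral.integral_nonneg (D.accum_mono (Nat.le_succ _)) fun σ hσ =>
    hg σ ⟨(D.accum_mem j j.2.le).1.trans hσ.1, hσ.2.trans (D.accum_mem (j + 1) j.2).2⟩

theorem share_of_eq_zero {j : Fin D.k} (hj : D.p j = 0) : D.share g j = 0 := by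
  rw [share, D.accum_succ, hj, add_zero, intervalIntegral.integral_same]

variable [MetricSpace V] {h : ℝ → ℝ}

theorem integrableOn_gain (h_int : IntegrableOn h (Set.Icc (0 : ℝ) 1)) (z : ℝ) :
    IntegrableOn (fun σ => max 0 (h σ - 1 + z * h σ)) (Set.Icc (0 : ℝ) 1) := by
  have h1 : IntegrableOn (fun _ : ℝ => (1 : ℝ)) (Set.Icc (0 : ℝ) 1) := by simp
  have h0 : IntegrableOn (fun _ : ℝ => (0 : ℝ)) (Set.Icc (0 : ℝ) 1) := by simp
  exact Integrable.sup h0 ((Integrable.sub h_int h1).add (Integrable.const_mul h_int z))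

theorem integrableOn_loss (h_int : IntegrableOn h (Set.Icc (0 : ℝ) 1)) (z : ℝ) :
    IntegrableOn (fun σ => h σ - 1 - z * h σ) (Set.Icc (0 : ℝ) 1) := by
  have h1 : IntegrableOn (fun _ : ℝ => (1 : ℝ)) (Set.Icc (0 : ℝ) 1) := by simp
  exact (Integrable.sub h_int h1).sub (Integrable.const_mul h_int z)

/-- The bound on the cost of a tour, integrated over the interval of its tree. -/
theorem mul_share_le (hx : IsFeasible s t x) (hst : s ≠ t) {r : Finset V → Fin D.k}
    {θ : Finset V → Fin D.k → ℝ} (hr : D.IsLast r) (hθ : D.IsCutWeight r θ)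
    (h_range : ∀ σ ∈ Set.Icc (0 : ℝ) 1, h σ ∈ Set.Icc (0 : ℝ) 1)
    (h_int : IntegrableOn h (Set.Icc (0 : ℝ) 1)) {j : Fin D.k}
    {P : (⊤ : SimpleGraph V).Walk s t} (hP : D.IsTreeTour j P) {M : ℝ} (hM : M ≤ walkCost P) :
    M * (D.p j + D.share h j) ≤ 2 * (D.p j * setCost (D.S j)) + D.share h j * vecCost x
      + ∑ U ∈ (narrowCuts s t x).filter (fun U => j ≤ r U),
        D.share (fun σ => h σ - 1 - (2 - vecSum x (cut U)) * h σ) j * setCost (cut U ∩ D.S j)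
      + ∑ U ∈ (narrowCuts s t x).filter (fun U => ¬ j ≤ r U),
        D.share (fun σ => max 0 (h σ - 1 + (2 - vecSum x (cut U)) * h σ)) j *
          ∑ i ∈ Finset.Iic (r U), θ U i * setCost (cut U ∩ D.S i) := by
  -- A tree of weight zero owns a degenerate interval and contributes nothing; for it the
  -- description of lonely cuts by `r` could fail.
  rcases (D.nonneg j).eq_or_lt with h0 | hj
  · simp only [D.share_of_eq_zero h0.symm, ← h0]
    simp
  have hmono : D.accum j ≤ D.accum (j + 1) := D.accum_mono (Nat.le_succ _)
  have hii : ∀ {g : ℝ → ℝ}, IntegrableOn g (Set.Icc (0 : ℝ) 1) →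
      IntervalIntegrable g volume (D.accum j) (D.accum (j + 1)) := fun hg =>
    D.intervalIntegrable_share hg j
  have hconst : ∀ c : ℝ, IntervalIntegrable (fun _ : ℝ => c) volume (D.accum j) (D.accum (j + 1)) :=
    fun c => intervalIntegrable_const
  have hlen : D.accum (j + 1) - D.accum j = D.p j := by rw [D.accum_succ]; ring
  set G : ℝ → ℝ := fun σ => ∑ U ∈ (narrowCuts s t x).filter (fun U => j ≤ r U),
        (h σ - 1 - (2 - vecSum x (cut U)) * h σ) * setCost (cut U ∩ D.S j) with hG
  set K : ℝ → ℝ := fun σ => ∑ U ∈ (narrowCuts s t x).filter (fun U => ¬ j ≤ r U),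
        max 0 (h σ - 1 + (2 - vecSum x (cut U)) * h σ) *
          ∑ i ∈ Finset.Iic (r U), θ U i * setCost (cut U ∩ D.S i) with hK
  have hGi : ∀ U ∈ (narrowCuts s t x).filter (fun U => j ≤ r U), IntervalIntegrable
      (fun σ => (h σ - 1 - (2 - vecSum x (cut U)) * h σ) * setCost (cut U ∩ D.S j)) volume
      (D.accum j) (D.accum (j + 1)) := fun U _ => (hii (integrableOn_loss h_int _)).mul_const _
  have hKi : ∀ U ∈ (narrowCuts s t x).filter (fun U => ¬ j ≤ r U), IntervalIntegrable
      (fun σ => max 0 (h σ - 1 + (2 - vecSum x (cut U)) * h σ) *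
          ∑ i ∈ Finset.Iic (r U), θ U i * setCost (cut U ∩ D.S i)) volume
      (D.accum j) (D.accum (j + 1)) := fun U _ => (hii (integrableOn_gain h_int _)).mul_const _
  have hGint : IntervalIntegrable G volume (D.accum j) (D.accum (j + 1)) :=
    hii (integrable_finsetSum _ fun U _ => Integrable.mul_const (integrableOn_loss h_int _) _)
  have hKint : IntervalIntegrable K volume (D.accum j) (D.accum (j + 1)) :=
    hii (integrable_finsetSum _ fun U _ => Integrable.mul_const (integrableOn_gain h_int _) _)
  have hG' : ∫ σ in D.accum j..D.accum (j + 1), G σ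
      = ∑ U ∈ (narrowCuts s t x).filter (fun U => j ≤ r U),
        D.share (fun σ => h σ - 1 - (2 - vecSum x (cut U)) * h σ) j * setCost (cut U ∩ D.S j) := by
    rw [hG, intervalIntegral.integral_finsetSum hGi]
    exact Finset.sum_congr rfl fun U _ => intervalIntegral.integral_mul_const _ _
  have hK' : ∫ σ in D.accum j..D.accum (j + 1), K σ
      = ∑ U ∈ (narrowCuts s t x).filter (fun U => ¬ j ≤ r U),
        D.share (fun σ => max 0 (h σ - 1 + (2 - vecSum x (cut U)) * h σ)) j *
          ∑ i ∈ Finset.Iic (r U), θ U i * setCost (cut U ∩ D.S i) := by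
    rw [hK, intervalIntegral.integral_finsetSum hKi]
    exact Finset.sum_congr rfl fun U _ => intervalIntegral.integral_mul_const _ _
  have hL : ∫ σ in D.accum j..D.accum (j + 1), M * (1 + h σ) = M * (D.p j + D.share h j) := by
    rw [intervalIntegral.integral_const_mul, intervalIntegral.integral_add (hconst 1) (hii h_int),
      intervalIntegral.integral_const, hlen, smul_eq_mul, mul_one]
    rfl
  have hhc : IntervalIntegrable (fun σ => h σ * vecCost x) volume (D.accum j) (D.accum (j + 1)) :=
    (hii h_int).mul_const _
  have hR : ∫ σ in D.accum j..D.accum (j + 1),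
        (2 * setCost (D.S j) + h σ * vecCost x + G σ + K σ)
      = 2 * (D.p j * setCost (D.S j)) + D.share h j * vecCost x
        + (∫ σ in D.accum j..D.accum (j + 1), G σ) + ∫ σ in D.accum j..D.accum (j + 1), K σ := by
    rw [intervalIntegral.integral_add (((hconst _).add hhc).add hGint) hKint,
      intervalIntegral.integral_add ((hconst _).add hhc) hGint,
      intervalIntegral.integral_add (hconst _) hhc, intervalIntegral.integral_const, hlen,
      intervalIntegral.integral_mul_const, smul_eq_mul, share]
    ring
  rw [← hG', ← hK', ← hR, ← hL]
  refine intervalIntegral.integral_mono_on hmono (((hconst 1).add (hii h_int)).const_mul M)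
    ((((hconst _).add hhc).add hGint).add hKint) fun σ hσ => ?_
  have hσ' : σ ∈ Set.Icc (0 : ℝ) 1 :=
    ⟨(D.accum_mem j j.2.le).1.trans hσ.1, hσ.2.trans (D.accum_mem (j + 1) j.2).2⟩
  obtain ⟨h1, h2⟩ := h_range σ hσ'
  exact (mul_le_mul_of_nonneg_right hM (by linarith)).trans
    (D.walkCost_mul_le hx hst hr hθ hj h1 h2 hP)

theorem sum_mul_setCost : ∑ j, D.p j * setCost (D.S j) = vecCost x := by
  rw [vecCost]
  have h1 : ∀ j, D.p j * setCost (D.S j)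
      = ∑ e, edgeCost e.1 * (D.p j * if e ∈ D.S j then 1 else 0) := by
    intro j
    have := vecSum_eq_sum_ite (fun e : Edge V => edgeCost e.1) (D.S j)
    rw [show setCost (D.S j) = vecSum (fun e : Edge V => edgeCost e.1) (D.S j) from rfl, this,
      Finset.mul_sum]
    exact Finset.sum_congr rfl fun e _ => by split_ifs <;> ring
  simp only [h1]
  rw [Finset.sum_comm]
  refine Finset.sum_congr rfl fun e _ => ?_
  rw [← Finset.mul_sum, ← D.eq_sum e]

/-- The weights by which a narrow cut is paid for by the trees in which it is lonely. -/
theorem exists_isCutWeight {r : Finset V → Fin D.k} (hr : D.IsLast r)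
    (h_range : ∀ σ ∈ Set.Icc (0 : ℝ) 1, h σ ∈ Set.Icc (0 : ℝ) 1)
    (h_int : IntegrableOn h (Set.Icc (0 : ℝ) 1))
    (h_req : ∀ z ∈ Set.Icc (0 : ℝ) 1,
      (∫ σ in z..1, max 0 (h σ - 1 + z * h σ)) + (∫ σ in (0 : ℝ)..z, (h σ - 1 - z * h σ)) ≤ 0) :
    ∃ θ, D.IsCutWeight r θ ∧ ∀ U ∈ narrowCuts s t x,
      (∑ j ∈ Finset.Iic (r U),
          D.share (fun σ => h σ - 1 - (2 - vecSum x (cut U)) * h σ) j * setCost (cut U ∩ D.S j))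
        + (∑ j ∈ Finset.univ.filter (fun j => ¬ j ≤ r U),
          D.share (fun σ => max 0 (h σ - 1 + (2 - vecSum x (cut U)) * h σ)) j)
            * ∑ i ∈ Finset.Iic (r U), θ U i * setCost (cut U ∩ D.S i) ≤ 0 := by
  have key : ∀ U ∈ narrowCuts s t x, ∃ θ : Fin D.k → ℝ, (∀ i ∈ Finset.Iic (r U), 0 ≤ θ i) ∧
      ∑ i ∈ Finset.Iic (r U), θ i = 1 ∧
      (∑ j ∈ Finset.Iic (r U),
          D.share (fun σ => h σ - 1 - (2 - vecSum x (cut U)) * h σ) j * setCost (cut U ∩ D.S j))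
        + (∑ j ∈ Finset.univ.filter (fun j => ¬ j ≤ r U),
          D.share (fun σ => max 0 (h σ - 1 + (2 - vecSum x (cut U)) * h σ)) j)
            * ∑ i ∈ Finset.Iic (r U), θ i * setCost (cut U ∩ D.S i) ≤ 0 := by
    intro U hU
    set z := 2 - vecSum x (cut U) with hz
    have hz' := hr.sum_eq U hU
    have hzmem := D.accum_mem (r U + 1) (r U).2
    rw [D.accum_eq_sum_Iic, hz'] at hzmem
    have hq : ∀ i ∈ Finset.Iic (r U), 0 ≤ - D.share (fun σ => h σ - 1 - z * h σ) i := by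
      intro i _
      have : - D.share (fun σ => h σ - 1 - z * h σ) i
          = D.share (fun σ => -(h σ - 1 - z * h σ)) i := by
        rw [share, share, intervalIntegral.integral_neg]
      rw [this]
      refine D.share_nonneg (fun σ hσ => ?_) i
      obtain ⟨h1, h2⟩ := h_range σ hσ
      have := mul_nonneg hzmem.1 h1
      linarith
    -- Here `K` is the gain integrated over `σ > z`, and the sum of the weights `q` is the loss over
    -- `σ < z`, since the trees up to `r U` fill exactly `[0, z]`. The condition on `h` at `z` is `K
    -- ≤ ∑ q`.
    obtain ⟨θ, h1, h2, h3⟩ := exists_weights (Finset.Iic (r U)) ⟨r U, by simp⟩ hq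
      (fun i _ => setCost_nonneg (cut U ∩ D.S i))
      (K := ∑ j ∈ Finset.univ.filter (fun j => ¬ j ≤ r U),
          D.share (fun σ => max 0 (h σ - 1 + z * h σ)) j)
      (Finset.sum_nonneg fun i _ => D.share_nonneg (fun σ _ => le_max_left _ _) i)
      (by
        have h4 := h_req z ⟨hzmem.1, hzmem.2⟩
        rw [Finset.sum_neg_distrib, D.sum_share_Iic (integrableOn_loss h_int z),
          D.sum_share_not_le (integrableOn_gain h_int z), hz']
        linarith)
    refine ⟨θ, h1, h2, ?_⟩
    simp only [neg_mul, Finset.sum_neg_distrib] at h3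
    linarith
  choose! θ h1 h2 h3 using key
  exact ⟨θ, ⟨fun U hU i hi => h1 U hU i (Finset.mem_Iic.2 hi), h2⟩, h3⟩

/-- The cheapest tour obeys the bound of every tree. Summed over the trees, the main terms give `M(1
+ ∫h) ≤ (2 + ∫h) c(x)`, provided the contributions of the narrow cuts are together nonpositive. -/
theorem IsOutput.walkCost_le (hx : IsFeasible s t x) (hst : s ≠ t)
    (h_range : ∀ σ ∈ Set.Icc (0 : ℝ) 1, h σ ∈ Set.Icc (0 : ℝ) 1)
    (h_int : IntegrableOn h (Set.Icc (0 : ℝ) 1))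
    (h_req : ∀ z ∈ Set.Icc (0 : ℝ) 1,
      (∫ σ in z..1, max 0 (h σ - 1 + z * h σ)) + (∫ σ in (0 : ℝ)..z, (h σ - 1 - z * h σ)) ≤ 0)
    {P : (⊤ : SimpleGraph V).Walk s t} (hP : D.IsOutput P) :
    walkCost P ≤ (1 + 1 / (1 + ∫ σ in (0 : ℝ)..1, h σ)) * vecCost x := by
  obtain ⟨Q, hQ, j₀, rfl, hmin⟩ := hP
  obtain ⟨r, hr⟩ := D.exists_isLast
  obtain ⟨θ, hθ, hpay⟩ := D.exists_isCutWeight hr h_range h_int h_req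
  set M := walkCost (Q j₀) with hM
  set H := ∫ σ in (0 : ℝ)..1, h σ with hH
  have hH0 : 0 ≤ H := intervalIntegral.integral_nonneg zero_le_one fun σ hσ => (h_range σ hσ).1
  have hsum := Finset.sum_le_sum fun j (_ : j ∈ Finset.univ) =>
    D.mul_share_le hx hst hr hθ h_range h_int (hQ j) (hmin j)
  rw [← Finset.mul_sum, Finset.sum_add_distrib, D.sum_eq_one, D.sum_share h_int,
    Finset.sum_add_distrib, Finset.sum_add_distrib, Finset.sum_add_distrib, ← Finset.mul_sum,
    D.sum_mul_setCost, ← Finset.sum_mul, D.sum_share h_int] at hsum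
  -- Regrouped by cuts, each narrow cut contributes a nonpositive amount by the choice of `θ`.
  have hswap : (∑ j, ∑ U ∈ (narrowCuts s t x).filter (fun U => j ≤ r U),
        D.share (fun σ => h σ - 1 - (2 - vecSum x (cut U)) * h σ) j * setCost (cut U ∩ D.S j))
      + ∑ j, ∑ U ∈ (narrowCuts s t x).filter (fun U => ¬ j ≤ r U),
        D.share (fun σ => max 0 (h σ - 1 + (2 - vecSum x (cut U)) * h σ)) j *
          ∑ i ∈ Finset.Iic (r U), θ U i * setCost (cut U ∩ D.S i) ≤ 0 := by
    simp only [Finset.sum_filter (s := narrowCuts s t x)]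
    rw [Finset.sum_comm, Finset.sum_comm (s := Finset.univ) (t := narrowCuts s t x),
      ← Finset.sum_add_distrib]
    refine Finset.sum_nonpos fun U hU => ?_
    refine le_trans (le_of_eq ?_) (hpay U hU)
    rw [← Finset.sum_filter, ← Finset.sum_filter, Finset.sum_mul]
    congr 1
    refine Finset.sum_congr ?_ fun _ _ => rfl
    ext j; simp
  have hpos : 0 < 1 + H := by linarith
  have hfin : M * (1 + H) ≤ (2 + H) * vecCost x := by linarith
  have heq : (1 + 1 / (1 + H)) * vecCost x = (2 + H) * vecCost x / (1 + H) := by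
    field_simp
    ring
  rw [heq, le_div_iff₀ hpos]
  exact hfin

end TreeDecomposition

end PathTSP

theorem mainTheorem2 {V : Type*} [Fintype V] [DecidableEq V] [MetricSpace V]
    (s t : V) (hst : s ≠ t) (h : ℝ → ℝ)
    (h_range : ∀ σ ∈ Set.Icc (0 : ℝ) 1, h σ ∈ Set.Icc (0 : ℝ) 1)
    (h_int : MeasureTheory.IntegrableOn h (Set.Icc (0 : ℝ) 1))
    (h_req : ∀ z ∈ Set.Icc (0 : ℝ) 1,
      (∫ σ in z..1, max 0 (h σ - 1 + z * h σ)) + (∫ σ in (0 : ℝ)..z, (h σ - 1 - z * h σ)) ≤ 0) :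
    -- the linear program has an optimum solution
    (∃ x : PathTSP.Edge V → ℝ, PathTSP.IsOptimal s t x) ∧
    ∀ x : PathTSP.Edge V → ℝ, PathTSP.IsOptimal s t x →
      -- the required decomposition into spanning trees exists
      Nonempty (PathTSP.TreeDecomposition s t x) ∧
      -- the algorithm has an output, and every possible output is a cheap Hamiltonian path
      ∀ D : PathTSP.TreeDecomposition s t x,
        (∃ P, D.IsOutput P) ∧
        ∀ P, D.IsOutput P → P.IsHamiltonian ∧
          PathTSP.walkCost P ≤ (1 + 1 / (1 + ∫ σ in (0 : ℝ)..1, h σ)) * PathTSP.vecCost x := by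
  refine ⟨PathTSP.exists_optimal hst, fun x hx => ⟨hx.1.exists_treeDecomposition hst, fun D =>
    ⟨D.exists_isOutput hst, fun P hP =>
      ⟨?_, hP.walkCost_le D hx.1 hst h_range h_int h_req⟩⟩⟩⟩
  obtain ⟨Q, hQ, j, rfl, -⟩ := hP
  exact (hQ j).isHamiltonian D hst
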